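/- **Setting.** Fix countably infinite sets of concept names $A$, role names $r$ and individual names. A role $R$ is a role name $r$ or an inverse $r^-$ (with $(r^-)^-=r$). $\mathcal{ALCI}$-concepts are $C,D ::= \top\mid\bot\mid A\mid C\sqcap D\mid C\sqcup D\mid\neg C\mid\exists R.C\mid\forall R.C$; $\mathcal{ELI}$-concepts use only $\top$, $A$, $\sqcap$, $\exists R.C$. An $\mathcal{ALCFI}$-TBox $\mathcal T$ is a finite set of concept inclusions $C\sqsubseteq D$ between $\mathcal{ALCI}$-concepts and functionality assertions $\mathsf{func}(R)$, with the usual semantics. An ABox $\mathcal A$ is a non-empty finite set of assertions $A(a)$, $r(a,b)$; $\mathsf{Ind}(\mathcal A)$ is the set of individual names in it, and $r^-(a,b)\in\mathcal A$ means $r(b,a)\in\mathcal A$. Individual names are interpreted as themselves (standard names), and a model of $\mathcal A$ has $\mathsf{Ind}(\mathcal A)$ in its domain. A positive existential query (PEQ) $q(\vec x)$ is a first-order formula with free variables $\vec x$ built from atoms $A(x)$, $r(x,y)$, $\top(x)$ by $\wedge,\vee,\exists$; an ELIQ is a query $C(x)$ with $C$ an $\mathcal{ELI}$-concept. $\mathcal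 T,\mathcal A\models q(\vec a)$ means that $q(\vec a)$ holds in every model of $\mathcal T$ and $\mathcal A$; the same notation is used for infinite $\mathcal A$. The unraveling $\mathcal A^u$ of $\mathcal A$ is the (possibly infinite) ABox whose individual names are the sequences $b_0R_0b_1\cdots R_{n-1}b_n$, $n\ge 0$, with $b_i\in\mathsf{Ind}(\mathcal A)$, $R_i(b_i,b_{i+1})\in\mathcal A$ and $(b_{i-1},R_{i-1}^-)\ne(b_{i+1},R_i)$ for $0<i<n$, and whose assertions are $A(\alpha)$ whenever $\alpha$ ends in $b$ and $A(b)\in\mathcal A$, and $R(\alpha,\alpha Rb)$ for all its sequences $\alpha$, $\alpha Rb$. $\mathcal T$ is *unraveling tolerant* if, for all ABoxes $\mathcal A$, all ELIQs $C(x)$ and all $a\in\mathsf{Ind}(\mathcal A)$, $\mathcal T,\mathcal A\models C(a)$ implies $\mathcal T,\mathcal A^u\models C(a)$. A Datalog$^{\neq}$ program $\Pi$ is a finite set of rules. Heads are atoms over intensional symbols (disjoint from the concept and role names), one of which is the relation $\mathsf{goal}$, which does not occur in rule bodies. Bodies consist of atoms $A(x)$, $r(x,y)$, $\top(x)$ (the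 built-in relation true of exactly the elements of $\mathsf{Ind}(\mathcal A)$), intensional atoms and inequalities; each body has at least one atom that is not an inequality, and every variable of a rule occurs in such an atom of its body. $\Pi$ is *monadic* if all intensional symbols other than $\mathsf{goal}$ are unary. $\mathcal A\models\Pi(\vec a)$ means that $\mathsf{goal}(\vec a)$ is derived by the usual least fixed point semantics. $\Pi$ is a *rewriting* of $(\mathcal T,q(\vec x))$ if for all ABoxes $\mathcal A$ and all $\vec a$ from $\mathsf{Ind}(\mathcal A)$: $\mathcal T,\mathcal A\models q(\vec a)$ iff $\mathcal A\models\Pi(\vec a)$. For an $\mathcal{ELI}$-concept $C_0$ let $\mathsf{cl}$ be the closure under single negation of the set of subconcepts of $\mathcal T$ and $C_0$, let the type of a domain element $d$ be the set of all $C\in\mathsf{cl}$ satisfied at $d$, and let $\mathsf{tp}$ be the set of types realized in models of $\mathcal T$. Write $t\rightsquigarrow_R t'$ if some model of $\mathcal T$ has an $R$-edge from an element of type $t$ to an element of type $t'$. The *canonical program* $\Pi_{\mathcal T,C_0}$ has a unary intensional symbol $P_S$ for each set $S$ of types and the following rules, for all $S,S_0,S_1\subseteq\mathsf{tp}$: *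 $P_{\mathsf{tp}}(x)\leftarrow\top(x)$; * $P_{\{t\in\mathsf{tp}\mid A\in t\}}(x)\leftarrow A(x)$ for each concept name $A\in\mathsf{cl}$; * $P_{\{t\in S_0\mid\exists t'\in S_1:\,t\rightsquigarrow_R t'\}}(x)\leftarrow P_{S_0}(x)\wedge R(x,y)\wedge P_{S_1}(y)$ for each role $R$ such that $R$ or $R^-$ occurs in $\mathsf{cl}$; * $P_{S_0\cap S_1}(x)\leftarrow P_{S_0}(x)\wedge P_{S_1}(x)$; * $\mathsf{goal}(x)\leftarrow P_S(x)$ if $C_0\in t$ for all $t\in S$; * $\mathsf{goal}(x)\leftarrow\top(x)\wedge P_\emptyset(y)$; * $\mathsf{goal}(x)\leftarrow\top(x)\wedge R(y,z_1)\wedge R(y,z_2)\wedge z_1\ne z_2$ for each $\mathsf{func}(R)\in\mathcal T$. **Theorem.** Let $\mathcal T$ be an unraveling tolerant $\mathcal{ALCFI}$-TBox. Then: 1. for every $\mathcal{ELI}$-concept $C_0$, the canonical program $\Pi_{\mathcal T,C_0}$ is a monadic Datalog$^{\neq}$ program and a rewriting of $(\mathcal T,C_0(x))$; 2. $\mathcal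 T$ is monadic Datalog$^{\neq}$-rewritable for PEQs: for every PEQ $q(\vec x)$ there is a monadic Datalog$^{\neq}$ program that is a rewriting of $(\mathcal T,q(\vec x))$; 3. PEQ-evaluation w.r.t. $\mathcal T$ is in PTime: for every fixed PEQ $q(\vec x)$, the problem to decide, given an ABox $\mathcal A$ and a tuple $\vec a$ from $\mathsf{Ind}(\mathcal A)$, whether $\mathcal T,\mathcal A\models q(\vec a)$, is solvable by a Turing machine in polynomial time. -/

import Mathlib

namespace DL

/-! ### Syntax of the description logic -/

/-- Concept names, a countably infinite set. -/
abbrev ConceptName := ℕ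

/-- Role names, a countably infinite set. -/
abbrev RoleName := ℕ

/-- Individual names, a countably infinite set. -/
abbrev IndName := ℕ

/-- Variables of queries and of Datalog rules. -/
abbrev Var := ℕ

/-- A role is a role name or the inverse of a role name. -/
inductive Role where
  | name (r : RoleName)
  | inv (r : RoleName)
  deriving DecidableEq

/-- The inverse of a role, with the inverse of `r⁻` being `r`. -/
def Role.inverse : Role → Role
  | .name r => .inv r
  | .inv r => .name r

/-- `ALCI`-concepts. -/
inductive Concept where
  | top
  | bot
  | atom (A : ConceptName)
  | inter (C D : Concept)
  | union (C D : Concept)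
  | neg (C : Concept)
  | ex (R : Role) (C : Concept)
  | all (R : Role) (C : Concept)
  deriving DecidableEq

/-- `ELI`-concepts: built from `⊤`, concept names, conjunction and existential restriction. -/
def Concept.IsELI : Concept → Prop
  | .top => True
  | .atom _ => True
  | .inter C D => C.IsELI ∧ D.IsELI
  | .ex _ C => C.IsELI
  | _ => False

/-- The statements of an `ALCFI`-TBox: concept inclusions `C ⊑ D` and assertions `func(R)`. -/
inductive TBoxAxiom where
  | incl (C D : Concept)
  | func (R : Role)
  deriving DecidableEq

/-- An `ALCFI`-TBox. -/
abbrev TBox := Finset TBoxAxiom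

/-- ABox assertions `A(a)` and `r(a,b)` over a set `N` of individual names. -/
inductive Assertion (N : Type) where
  | concept (A : ConceptName) (a : N)
  | role (r : RoleName) (a b : N)
  deriving DecidableEq

/-- `R(a,b) ∈ A` for a possibly inverse role `R`. -/
def RoleMem {N : Type} (A : Set (Assertion N)) : Role → N → N → Prop
  | .name r, a, b => Assertion.role r a b ∈ A
  | .inv r, a, b => Assertion.role r b a ∈ A

/-- `a` is one of the individual names used in an assertion. -/
def Assertion.Mentions {N : Type} (a : N) : Assertion N → Prop
  | .concept _ b => a = b
  | .role _ b c => a = b ∨ a = c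

/-- The set of individual names used in a set of assertions. -/
def Ind {N : Type} (A : Set (Assertion N)) : Set N :=
  {a | ∃ s ∈ A, s.Mentions a}

/-- An ABox is a non-empty finite set of assertions. -/
def IsABox {N : Type} (A : Set (Assertion N)) : Prop :=
  A.Finite ∧ A.Nonempty

/-! ### Semantics -/

/-- Interpretations. The domain may contain some of the individual names of `N`, as themselves:
`name a = some d` says that the domain element `d` is the individual name `a`. This is a partial
bijection, so distinct individual names are distinct elements, and not every individual name has
to be in the domain. -/
structure Interp (N : Type) where
  Dom : Type
  nonempty : Nonempty Dom
  name : N ≃. Dom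
  conceptExt : ConceptName → Set Dom
  roleExt : RoleName → Dom → Dom → Prop

namespace Interp

variable {N : Type}

/-- The extension of a possibly inverse role. -/
def rel (I : Interp N) : Role → I.Dom → I.Dom → Prop
  | .name r, d, e => I.roleExt r d e
  | .inv r, d, e => I.roleExt r e d

/-- The extension of a concept. -/
def ext (I : Interp N) : Concept → Set I.Dom
  | .top => Set.univ
  | .bot => ∅
  | .atom A => I.conceptExt A
  | .inter C D => I.ext C ∩ I.ext D
  | .union C D => I.ext C ∪ I.ext D
  | .neg C => (I.ext C)ᶜ
  | .ex R C => {d | ∃ e, I.rel R d e ∧ e ∈ I.ext C}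
  | .all R C => {d | ∀ e, I.rel R d e → e ∈ I.ext C}

def SatAxiom (I : Interp N) : TBoxAxiom → Prop
  | .incl C D => I.ext C ⊆ I.ext D
  | .func R => ∀ d e e', I.rel R d e → I.rel R d e' → e = e'

/-- `I` is a model of the TBox `T`. -/
def IsModel (I : Interp N) (T : TBox) : Prop :=
  ∀ s ∈ T, I.SatAxiom s

def SatAssertion (I : Interp N) : Assertion N → Prop
  | .concept A a => ∃ d, I.name a = some d ∧ d ∈ I.conceptExt A
  | .role r a b => ∃ d e, I.name a = some d ∧ I.name b = some e ∧ I.roleExt r d e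

/-- `I` is a model of the (possibly infinite) ABox `A`. In particular, all individual names
used in `A` are in the domain. -/
def IsModelABox (I : Interp N) (A : Set (Assertion N)) : Prop :=
  ∀ s ∈ A, I.SatAssertion s

end Interp

/-! ### Queries and certain answers -/

/-- Positive existential formulas. The atom `⊤(x)` is admitted, so that all queries `C(x)` with
`C` an `ELI`-concept, including `⊤(x)`, are covered. -/
inductive PEFormula where
  | top (x : Var)
  | concept (A : ConceptName) (x : Var)
  | role (r : RoleName) (x y : Var)
  | and (φ ψ : PEFormula)
  | or (φ ψ : PEFormula)
  | ex (x : Var) (φ : PEFormula)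

/-- The free variables of a positive existential formula. -/
def PEFormula.freeVars : PEFormula → Set Var
  | .top x => {x}
  | .concept _ x => {x}
  | .role _ x y => {x, y}
  | .and φ ψ => φ.freeVars ∪ ψ.freeVars
  | .or φ ψ => φ.freeVars ∪ ψ.freeVars
  | .ex x φ => φ.freeVars \ {x}

/-- First-order satisfaction under an assignment. -/
def PEFormula.Sat {N : Type} (I : Interp N) : PEFormula → (Var → I.Dom) → Prop
  | .top _, _ => True
  | .concept A x, π => π x ∈ I.conceptExt A
  | .role r x y, π => I.roleExt r (π x) (π y)
  | .and φ ψ, π => φ.Sat I π ∧ ψ.Sat I π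
  | .or φ ψ, π => φ.Sat I π ∨ ψ.Sat I π
  | .ex x φ, π => ∃ d, φ.Sat I (Function.update π x d)

/-- A positive existential query with `n` answer variables, which are its free variables. -/
structure PEQ (n : ℕ) where
  formula : PEFormula
  ans : Fin n → Var
  ans_injective : Function.Injective ans
  freeVars_eq : formula.freeVars = Set.range ans

/-- `a` is an answer to `q` in `I`. -/
def Interp.Answers {N : Type} (I : Interp N) {n : ℕ} (q : PEQ n) (a : Fin n → N) : Prop :=
  ∃ π : Var → I.Dom, (∀ i, I.name (a i) = some (π (q.ans i))) ∧ q.formula.Sat I π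

/-- `T, A ⊨ q(a)`: the tuple `a` is a certain answer to the PEQ `q`. -/
def CertainPEQ {N : Type} (T : TBox) (A : Set (Assertion N)) {n : ℕ} (q : PEQ n)
    (a : Fin n → N) : Prop :=
  ∀ I : Interp N, I.IsModel T → I.IsModelABox A → I.Answers q a

/-- `T, A ⊨ C(a)`: the individual name `a` is a certain answer to the query `C(x)`. -/
def CertainConcept {N : Type} (T : TBox) (A : Set (Assertion N)) (C : Concept) (a : N) : Prop :=
  ∀ I : Interp N, I.IsModel T → I.IsModelABox A → ∃ d, I.name a = some d ∧ d ∈ I.ext C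

/-! ### Unraveling -/

/-- Sequences `b₀ r₀ b₁ ⋯ rₙ₋₁ bₙ`. -/
inductive Path (N : Type) where
  | single (b : N)
  | snoc (α : Path N) (R : Role) (b : N)

def Path.tail {N : Type} : Path N → N
  | .single b => b
  | .snoc _ _ b => b

/-- Given a last step from `α` via `R` to `b`: the step does not go back along the step that
leads to the end of `α`. -/
def Path.NoBacktrack {N : Type} : Path N → Role → N → Prop
  | .single _, _, _ => True
  | .snoc α' R' _, R, b => (α'.tail, R'.inverse) ≠ (b, R)

/-- The sequences that are the individual names of the unraveling of `A`. -/
def Path.IsPathOf {N : Type} (A : Set (Assertion N)) : Path N → Prop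
  | .single b => b ∈ Ind A
  | .snoc α R b => α.IsPathOf A ∧ RoleMem A R α.tail b ∧ α.NoBacktrack R b

/-- The unraveling of an ABox, a possibly infinite ABox. -/
def unravel {N : Type} (A : Set (Assertion N)) : Set (Assertion (Path N)) :=
  {s | ∃ (C : ConceptName) (α : Path N),
      α.IsPathOf A ∧ Assertion.concept C α.tail ∈ A ∧ s = .concept C α} ∪
  {s | ∃ (r : RoleName) (α : Path N) (b : N),
      (α.snoc (.name r) b).IsPathOf A ∧ s = .role r α (α.snoc (.name r) b)} ∪
  {s | ∃ (r : RoleName) (α : Path N) (b : N),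
      (α.snoc (.inv r) b).IsPathOf A ∧ s = .role r (α.snoc (.inv r) b) α}

/-- Unraveling tolerance. -/
def UnravelingTolerant (T : TBox) : Prop :=
  ∀ A : Set (Assertion IndName), IsABox A → ∀ C : Concept, C.IsELI → ∀ a ∈ Ind A,
    CertainConcept T A C a → CertainConcept T (unravel A) C (.single a)

/-! ### Datalog with inequality -/

/-- Atoms in rule bodies: EDB atoms `A(x)` and `r(x,y)`, the built-in EDB atom `⊤(x)` that holds
for all individual names of the ABox, IDB atoms, and inequalities. The intensional relation
symbols other than the goal relation are the elements of `ι`; they are disjoint from the concept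
and role names. The goal relation does not occur in bodies. -/
inductive BodyAtom {ι : Type} (arity : ι → ℕ) where
  | top (x : Var)
  | concept (A : ConceptName) (x : Var)
  | role (r : RoleName) (x y : Var)
  | idb (P : ι) (args : Fin (arity P) → Var)
  | neq (x y : Var)

/-- Atoms over the intensional relation symbols, including the goal relation of arity `n`, with
arguments from `V`: rule heads if `V` is the set of variables, and derived facts if `V` is the
set of individual names. -/
inductive HeadAtom {ι : Type} (arity : ι → ℕ) (n : ℕ) (V : Type) where
  | goal (args : Fin n → V)
  | idb (P : ι) (args : Fin (arity P) → V)

structure DatalogRule {ι : Type} (arity : ι → ℕ) (n : ℕ) where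
  head : HeadAtom arity n Var
  body : List (BodyAtom arity)

section Datalog

variable {ι : Type} {arity : ι → ℕ} {n : ℕ}

/-- The atom `R(x,y)` for a possibly inverse role `R`. -/
def BodyAtom.ofRole : Role → Var → Var → BodyAtom arity
  | .name r, x, y => .role r x y
  | .inv r, x, y => .role r y x

def HeadAtom.map {V W : Type} (f : V → W) : HeadAtom arity n V → HeadAtom arity n W
  | .goal args => .goal (f ∘ args)
  | .idb P args => .idb P (f ∘ args)

def HeadAtom.vars : HeadAtom arity n Var → Set Var
  | .goal args => Set.range args
  | .idb _ args => Set.range args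

/-- Relational atoms are those that are not inequalities. -/
def BodyAtom.IsRelational : BodyAtom arity → Prop
  | .neq _ _ => False
  | _ => True

def BodyAtom.vars : BodyAtom arity → Set Var
  | .top x => {x}
  | .concept _ x => {x}
  | .role _ x y => {x, y}
  | .idb _ args => Set.range args
  | .neq x y => {x, y}

/-- The body contains a relational atom, and every variable of the rule occurs in a relational
atom of the body. -/
def DatalogRule.Safe (ρ : DatalogRule arity n) : Prop :=
  (∃ b ∈ ρ.body, b.IsRelational) ∧
  (∀ x ∈ ρ.head.vars, ∃ b ∈ ρ.body, b.IsRelational ∧ x ∈ b.vars) ∧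
  (∀ c ∈ ρ.body, ∀ x ∈ c.vars, ∃ b ∈ ρ.body, b.IsRelational ∧ x ∈ b.vars)

/-- Truth of a body atom in the ABox `A` extended with the facts `M`, under the assignment `σ`. -/
def BodyAtom.Holds (A : Set (Assertion IndName)) (M : Set (HeadAtom arity n IndName))
    (σ : Var → IndName) : BodyAtom arity → Prop
  | .top x => σ x ∈ Ind A
  | .concept B x => Assertion.concept B (σ x) ∈ A
  | .role r x y => Assertion.role r (σ x) (σ y) ∈ A
  | .idb P args => HeadAtom.idb P (σ ∘ args) ∈ M
  | .neq x y => σ x ≠ σ y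

end Datalog

/-- Datalog rules with inequality, with intensional relation symbols `IDB` and a goal relation
of arity `n`. The finiteness and safety conditions are in `DatalogProgram.IsProgram`. -/
structure DatalogProgram (n : ℕ) where
  IDB : Type
  arity : IDB → ℕ
  rules : Set (DatalogRule arity n)

namespace DatalogProgram

variable {n : ℕ}

/-- A program is a finite set of safe rules. -/
def IsProgram (P : DatalogProgram n) : Prop :=
  P.rules.Finite ∧ ∀ ρ ∈ P.rules, ρ.Safe

/-- All intensional relation symbols, except possibly the goal relation, are unary. -/
def IsMonadic (P : DatalogProgram n) : Prop :=
  ∀ i, P.arity i = 1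

/-- `M` is closed under all rules, for assignments of individual names of `A` to variables. -/
def IsClosed (P : DatalogProgram n) (A : Set (Assertion IndName))
    (M : Set (HeadAtom P.arity n IndName)) : Prop :=
  ∀ ρ ∈ P.rules, ∀ σ : Var → IndName, (∀ x, σ x ∈ Ind A) →
    (∀ b ∈ ρ.body, b.Holds A M σ) → ρ.head.map σ ∈ M

/-- `P` returns `a` on `A`: `goal(a)` is in the least set of facts closed under the rules. -/
def Returns (P : DatalogProgram n) (A : Set (Assertion IndName)) (a : Fin n → IndName) : Prop :=
  ∀ M, P.IsClosed A M → HeadAtom.goal a ∈ M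

/-- `P` returns exactly the answers given by `Q`, on all ABoxes and tuples of individual names
of the ABox. -/
def IsRewriting (P : DatalogProgram n)
    (Q : Set (Assertion IndName) → (Fin n → IndName) → Prop) : Prop :=
  ∀ A, IsABox A → ∀ a, (∀ i, a i ∈ Ind A) → (Q A a ↔ P.Returns A a)

end DatalogProgram

/-- `T` is monadic Datalog-with-inequality-rewritable for PEQs. -/
def MonadicDatalogNeqRewritablePEQ (T : TBox) : Prop :=
  ∀ (n : ℕ) (q : PEQ n), ∃ P : DatalogProgram n,
    P.IsProgram ∧ P.IsMonadic ∧ P.IsRewriting (fun A a => CertainPEQ T A q a)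

/-! ### Polynomial time query evaluation -/

/-- The inputs of the query evaluation problem for a query of arity `n`: a non-empty list of
assertions (an ABox) and a tuple of individual names of this ABox. -/
def EvalInput (n : ℕ) : Type :=
  {p : List (Assertion IndName) × (Fin n → IndName) //
    p.1 ≠ [] ∧ ∀ i, p.2 i ∈ Ind {s | s ∈ p.1}}

/-- Names are encoded in binary. -/
def encodeName (k : ℕ) : List Computability.Γ' :=
  (Computability.encodeNat k).map Computability.Γ'.bit

def encodeAssertion : Assertion IndName → List Computability.Γ'
  | .concept A a =>
      [.bra] ++ encodeName A ++ [.comma] ++ encodeName a ++ [.ket]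
  | .role r a b =>
      [.bra] ++ encodeName r ++ [.comma] ++ encodeName a ++ [.comma] ++ encodeName b ++ [.ket]

/-- The word for an input: the words of the assertions, followed by the tuple. -/
def encodeInput {n : ℕ} (p : EvalInput n) : List Computability.Γ' :=
  p.1.1.flatMap encodeAssertion ++
    (List.ofFn p.1.2).flatMap (fun a => .comma :: encodeName a)

/-- PEQ-evaluation with respect to `T` is in PTime: for each fixed PEQ, some Turing machine
decides the query evaluation problem in polynomial time. -/
def PEQEvaluationInPTime (T : TBox) : Prop :=
  ∀ (n : ℕ) (q : PEQ n), ∃ f : EvalInput n → Bool,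
    (∀ p, f p = true ↔ CertainPEQ T {s | s ∈ p.1.1} q p.1.2) ∧
    Nonempty (Turing.TM2ComputableInPolyTime encodeInput Computability.encodeBool f)

/-! ### The canonical monadic program of a TBox and an `ELI`-concept -/

/-- The subconcepts of a concept, including the concept itself. -/
def Concept.sub : Concept → Set Concept
  | .top => {.top}
  | .bot => {.bot}
  | .atom A => {.atom A}
  | .inter C D => {.inter C D} ∪ C.sub ∪ D.sub
  | .union C D => {.union C D} ∪ C.sub ∪ D.sub
  | .neg C => {.neg C} ∪ C.sub
  | .ex R C => {.ex R C} ∪ C.sub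
  | .all R C => {.all R C} ∪ C.sub

/-- Single negation: a leading negation is removed, otherwise one is added. -/
def Concept.singleNeg : Concept → Concept
  | .neg C => C
  | C => .neg C

/-- The subconcepts of the concepts in `T` and of `C₀`. -/
def subconcepts (T : TBox) (C₀ : Concept) : Set Concept :=
  C₀.sub ∪ {E | ∃ C D, TBoxAxiom.incl C D ∈ T ∧ (E ∈ C.sub ∨ E ∈ D.sub)}

/-- The closure under single negation of the set of subconcepts of `T` and `C₀`. -/
def cl (T : TBox) (C₀ : Concept) : Set Concept :=
  subconcepts T C₀ ∪ Concept.singleNeg '' subconcepts T C₀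

/-- The type of a domain element. -/
def Interp.typeOf {N : Type} (I : Interp N) (T : TBox) (C₀ : Concept) (d : I.Dom) : Set Concept :=
  {C | C ∈ cl T C₀ ∧ d ∈ I.ext C}

/-- The set of types that are realized in models of `T`. -/
def types (T : TBox) (C₀ : Concept) : Set (Set Concept) :=
  {t | ∃ (I : Interp IndName) (d : I.Dom), I.IsModel T ∧ t = I.typeOf T C₀ d}

/-- `t ⇝_R t'`: some model of `T` has an `R`-edge from an element of type `t` to one of
type `t'`. -/
def TypeEdge (T : TBox) (C₀ : Concept) (R : Role) (t t' : Set Concept) : Prop :=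
  ∃ (I : Interp IndName) (d d' : I.Dom), I.IsModel T ∧ I.typeOf T C₀ d = t ∧
    I.typeOf T C₀ d' = t' ∧ I.rel R d d'

/-- `R` or its inverse occurs in the closure. -/
def RoleOccurs (T : TBox) (C₀ : Concept) (R : Role) : Prop :=
  ∃ R' D, (R' = R ∨ R' = R.inverse) ∧
    (Concept.ex R' D ∈ cl T C₀ ∨ Concept.all R' D ∈ cl T C₀)

/-- The intensional symbols of the canonical program: unary symbols indexed by sets of types. -/
abbrev CanonicalRule := DatalogRule (ι := Set (Set Concept)) (fun _ => 1) 1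

/-- The body atom `P_S(x)`. -/
def typeAtom (S : Set (Set Concept)) (x : Var) :
    BodyAtom (ι := Set (Set Concept)) (fun _ => 1) :=
  .idb S (fun _ => x)

/-- The head atom `P_S(x)`. -/
def typeHead (S : Set (Set Concept)) (x : Var) :
    HeadAtom (ι := Set (Set Concept)) (fun _ => 1) 1 Var :=
  .idb S (fun _ => x)

/-- The head atom `goal(x)`. -/
def goalHead (x : Var) : HeadAtom (ι := Set (Set Concept)) (fun _ => 1) 1 Var :=
  .goal (fun _ => x)

/-- The rules of the canonical monadic program for `T` and `C₀(x)`. -/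
inductive IsCanonicalRule (T : TBox) (C₀ : Concept) : CanonicalRule → Prop
  /-- `P_S(x) ← ⊤(x)` where `S` is the set of all types -/
  | all :
      IsCanonicalRule T C₀ ⟨typeHead (types T C₀) 0, [.top 0]⟩
  /-- `P_S(x) ← A(x)` where `S` is the set of all types that contain `A` -/
  | name (A : ConceptName) : Concept.atom A ∈ cl T C₀ →
      IsCanonicalRule T C₀
        ⟨typeHead {t | t ∈ types T C₀ ∧ Concept.atom A ∈ t} 0, [.concept A 0]⟩
  /-- `P_S(x) ← P_S₀(x) ∧ R(x,y) ∧ P_S₁(y)` where `S = {t ∈ S₀ | ∃ t' ∈ S₁, t ⇝_R t'}` -/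
  | role (R : Role) (S₀ S₁ : Set (Set Concept)) : RoleOccurs T C₀ R →
      S₀ ⊆ types T C₀ → S₁ ⊆ types T C₀ →
      IsCanonicalRule T C₀
        ⟨typeHead {t | t ∈ S₀ ∧ ∃ t' ∈ S₁, TypeEdge T C₀ R t t'} 0,
          [typeAtom S₀ 0, .ofRole R 0 1, typeAtom S₁ 1]⟩
  /-- `P_{S₀ ∩ S₁}(x) ← P_S₀(x) ∧ P_S₁(x)` -/
  | inter (S₀ S₁ : Set (Set Concept)) : S₀ ⊆ types T C₀ → S₁ ⊆ types T C₀ →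
      IsCanonicalRule T C₀ ⟨typeHead (S₀ ∩ S₁) 0, [typeAtom S₀ 0, typeAtom S₁ 0]⟩
  /-- `goal(x) ← P_S(x)` if all types in `S` contain `C₀` -/
  | goal (S : Set (Set Concept)) : S ⊆ types T C₀ → (∀ t ∈ S, C₀ ∈ t) →
      IsCanonicalRule T C₀ ⟨goalHead 0, [typeAtom S 0]⟩
  /-- `goal(x) ← ⊤(x) ∧ P_∅(y)` -/
  | empty :
      IsCanonicalRule T C₀ ⟨goalHead 0, [.top 0, typeAtom ∅ 1]⟩
  /-- `goal(x) ← ⊤(x) ∧ R(y,z₁) ∧ R(y,z₂) ∧ z₁ ≠ z₂` if `func(R)` is in `T` -/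
  | func (R : Role) : TBoxAxiom.func R ∈ T →
      IsCanonicalRule T C₀ ⟨goalHead 0, [.top 0, .ofRole R 1 2, .ofRole R 1 3, .neq 2 3]⟩

/-- The canonical monadic program for `T` and `C₀(x)`. -/
def canonicalProgram (T : TBox) (C₀ : Concept) : DatalogProgram 1 where
  IDB := Set (Set Concept)
  arity := fun _ => 1
  rules := {ρ | IsCanonicalRule T C₀ ρ}

end DL

/-! ### Closure, types, and the construction of forest models. -/

namespace DL

/-! ### Roles, subconcepts and the closure -/

/-! The canonical program is arc consistency for types: each individual keeps the types that survive
propagation along ABox edges. Soundness holds because the facts true in a model of the TBox and ABox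
form a closed set. For completeness, consider the least derived sets `S b`
(`exists_typeAssignment`). A violated functionality assertion or an empty `S b` triggers a goal rule
outright. Otherwise, any `t ∈ S a` extends to a choice of compatible types along all paths of the
unraveling, and the choice is realized by a model of the unraveling with type `t` at `a`
(`TypeAssignment.exists_model`). Tolerance carries certain `ELI`-concepts over to the unraveling, so
a certain concept belongs to every surviving type (`TypeAssignment.mem_of_certain`). Applied to a
concept over a fresh role, the same argument shows that the ABox has a model
(`TypeAssignment.consistent`).

All models come from one construction, `Blueprint.forest`: keep the ABox as a set of roots, assign
to each root an element of a model `U` of the TBox, and hang tree-shaped copies of `U` below the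
roots. If the edges of the ABox are compatible with the types of the assigned elements, every
concept of the closure holds at a node exactly if it holds at the element it copies
(`Blueprint.forest_ext`). The edges of `U` may be exchanged for edges with the same end types, a
freedom needed for queries.

For positive existential queries, tolerance first yields the disjunction property
(`exists_countermodel`): finitely many non-certain `ELI`-concepts can be refuted in one model.
Otherwise an ABox could be built in which one copy of `A` serves several branches of an `ELI`-query,
whereas its unraveling supplies each branch with a separate copy and hence with a separate
countermodel. So there is a model in which, among a given finite set of concepts, only certain ones
hold at individuals (`exists_minimal_model`). Its forest is made shallow: all copied elements lie
within a bounded distance of the individuals (`exists_shallow_relabel`). A match of a certain query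
in this forest uses boundedly many elements, and the neighbourhoods of these are described by
`ELI`-concepts that are forced by certain concepts at individuals. Certain concepts are contained in
all derived types, so boundedly many role atoms together with derived sets of types already imply
the query (`exists_impliesQuery`). The program for the query contains every sound rule of this
bounded shape.

For polynomial time, a monadic program is evaluated naively. Nested loops run through all
assignments of input names to the rule variables; for each assignment a finite automaton scans the
input and the facts derived so far, checks all rules, and adds facts. Extra dummy loops repeat this
more often than there are facts. The procedure is written in a small language of stack programs that
compiles to Turing machines (`Cmd.Run.steps_code`). -/

@[simp] theorem Role.inverse_inverse (R : Role) : R.inverse.inverse = R := by cases R <;> rfl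

theorem Interp.rel_inverse {N : Type} (I : Interp N) (R : Role) (d e : I.Dom) :
    I.rel R.inverse d e ↔ I.rel R e d := by cases R <;> rfl

theorem roleMem_inverse {N : Type} (A : Set (Assertion N)) (R : Role) (a b : N) :
    RoleMem A R.inverse a b ↔ RoleMem A R b a := by cases R <;> rfl

theorem RoleMem.ind_left {N : Type} {A : Set (Assertion N)} {R : Role} {a b : N}
    (h : RoleMem A R a b) : a ∈ Ind A := by
  cases R
  · exact ⟨_, h, Or.inl rfl⟩
  · exact ⟨_, h, Or.inr rfl⟩

theorem RoleMem.ind_right {N : Type} {A : Set (Assertion N)} {R : Role} {a b : N}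
    (h : RoleMem A R a b) : b ∈ Ind A := by
  cases R
  · exact ⟨_, h, Or.inr rfl⟩
  · exact ⟨_, h, Or.inl rfl⟩

theorem ind_nonempty {N : Type} {A : Set (Assertion N)} (h : A.Nonempty) : (Ind A).Nonempty := by
  obtain ⟨s, hs⟩ := h
  cases s with
  | concept B a => exact ⟨a, _, hs, rfl⟩
  | role r a b => exact ⟨a, _, hs, Or.inl rfl⟩

theorem ind_finite {N : Type} {A : Set (Assertion N)} (h : A.Finite) : (Ind A).Finite := by
  have : Ind A = ⋃ s ∈ A, {a | s.Mentions a} := by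
    ext a; simp [Ind]
  rw [this]
  refine h.biUnion fun s _ => ?_
  cases s with
  | concept B a => simp [Assertion.Mentions]
  | role r a b =>
    refine (Set.toFinite {a, b}).subset fun x hx => ?_
    simpa [Assertion.Mentions] using hx

theorem Concept.mem_sub_self (C : Concept) : C ∈ C.sub := by
  cases C <;> simp [Concept.sub]

theorem Concept.sub_subset {C D : Concept} (h : D ∈ C.sub) : D.sub ⊆ C.sub := by
  induction C with
  | top => obtain rfl := h; exact subset_rfl
  | bot => obtain rfl := h; exact subset_rfl
  | atom A => obtain rfl := h; exact subset_rfl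
  | inter C₁ C₂ h₁ h₂ | union C₁ C₂ h₁ h₂ =>
    rcases h with (h | h) | h
    · obtain rfl := h; exact subset_rfl
    · exact (h₁ h).trans fun x hx => Or.inl (Or.inr hx)
    · exact (h₂ h).trans fun x hx => Or.inr hx
  | neg C₁ h₁ | ex R C₁ h₁ | all R C₁ h₁ =>
    rcases h with h | h
    · obtain rfl := h; exact subset_rfl
    · exact (h₁ h).trans fun x hx => Or.inr hx

theorem Concept.sub_finite (C : Concept) : C.sub.Finite := by
  induction C with
  | top | bot | atom A => exact Set.finite_singleton _
  | inter C₁ C₂ h₁ h₂ | union C₁ C₂ h₁ h₂ => exact ((Set.finite_singleton _).union h₁).union h₂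
  | neg C₁ h₁ | ex R C₁ h₁ | all R C₁ h₁ => exact (Set.finite_singleton _).union h₁

theorem sub_subset_subconcepts {T : TBox} {C₀ C : Concept} (h : C ∈ subconcepts T C₀) :
    C.sub ⊆ subconcepts T C₀ := by
  rcases h with h | ⟨D, E, hDE, h | h⟩
  · exact (Concept.sub_subset h).trans fun x hx => Or.inl hx
  · exact fun x hx => Or.inr ⟨D, E, hDE, Or.inl (Concept.sub_subset h hx)⟩
  · exact fun x hx => Or.inr ⟨D, E, hDE, Or.inr (Concept.sub_subset h hx)⟩

/-- Single negation does not damage closure under subconcepts: it either strips a negation, leaving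
a subconcept, or adds one on top of a concept whose subconcepts are already present. -/
theorem sub_subset_cl {T : TBox} {C₀ C : Concept} (h : C ∈ cl T C₀) : C.sub ⊆ cl T C₀ := by
  rcases h with h | ⟨D, hD, rfl⟩
  · exact (sub_subset_subconcepts h).trans fun x hx => Or.inl hx
  · have key : ∀ D : Concept, D ∈ subconcepts T C₀ → D.neg ∈ cl T C₀ → D.neg.sub ⊆ cl T C₀ := by
      intro D hD hn x hx
      rcases hx with hx | hx
      · obtain rfl := hx; exact hn
      · exact Or.inl (sub_subset_subconcepts hD hx)
    have hm : D.singleNeg ∈ cl T C₀ := Or.inr ⟨D, hD, rfl⟩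
    cases D with
    | neg E =>
      exact fun x hx => Or.inl (sub_subset_subconcepts hD (Or.inr hx))
    | top => exact key _ hD hm
    | bot => exact key _ hD hm
    | atom A => exact key _ hD hm
    | inter C₁ C₂ => exact key _ hD hm
    | union C₁ C₂ => exact key _ hD hm
    | ex R C₁ => exact key _ hD hm
    | all R C₁ => exact key _ hD hm

theorem mem_cl_of_incl {T : TBox} {C₀ C D : Concept} (h : TBoxAxiom.incl C D ∈ T) :
    C ∈ cl T C₀ ∧ D ∈ cl T C₀ :=
  ⟨Or.inl (Or.inr ⟨C, D, h, Or.inl C.mem_sub_self⟩), Or.inl (Or.inr ⟨C, D, h, Or.inr D.mem_sub_self⟩)⟩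

theorem sub_subset_cl_self (T : TBox) (C₀ : Concept) : C₀.sub ⊆ cl T C₀ :=
  fun _ h => Or.inl (Or.inl h)

theorem cl_finite (T : TBox) (C₀ : Concept) : (cl T C₀).Finite := by
  have h : (subconcepts T C₀).Finite := by
    refine C₀.sub_finite.union ?_
    refine (T.finite_toSet.biUnion (t := fun s => {E | ∃ C D, s = TBoxAxiom.incl C D ∧
      (E ∈ C.sub ∨ E ∈ D.sub)}) fun s _ => ?_).subset ?_
    · cases s with
      | incl C D =>
        refine (C.sub_finite.union D.sub_finite).subset ?_
        rintro E ⟨C', D', h, hE⟩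
        cases h; exact hE
      | func R =>
        refine Set.finite_empty.subset ?_
        rintro E ⟨C', D', h, hE⟩
        cases h
    · rintro E ⟨C, D, hs, hE⟩
      exact Set.mem_biUnion (x := TBoxAxiom.incl C D) hs ⟨C, D, rfl, hE⟩
  exact h.union (h.image _)

theorem RoleOccurs.inverse {T : TBox} {C₀ : Concept} {R : Role} (h : RoleOccurs T C₀ R) :
    RoleOccurs T C₀ R.inverse := by
  obtain ⟨R', D, hR, hD⟩ := h
  refine ⟨R', D, ?_, hD⟩
  rw [Role.inverse_inverse]
  exact hR.symm

theorem roleOccurs_inverse {T : TBox} {C₀ : Concept} {R : Role} :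
    RoleOccurs T C₀ R.inverse ↔ RoleOccurs T C₀ R :=
  ⟨fun h => by simpa using h.inverse, RoleOccurs.inverse⟩

theorem roleOccurs_ex {T : TBox} {C₀ D : Concept} {R : Role} (h : Concept.ex R D ∈ cl T C₀) :
    RoleOccurs T C₀ R := ⟨R, D, Or.inl rfl, Or.inl h⟩

theorem roleOccurs_all {T : TBox} {C₀ D : Concept} {R : Role} (h : Concept.all R D ∈ cl T C₀) :
    RoleOccurs T C₀ R := ⟨R, D, Or.inl rfl, Or.inr h⟩

theorem roleOccurs_finite (T : TBox) (C₀ : Concept) : {R | RoleOccurs T C₀ R}.Finite := by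
  have h : {R | ∃ D, Concept.ex R D ∈ cl T C₀ ∨ Concept.all R D ∈ cl T C₀}.Finite := by
    refine ((cl_finite T C₀).biUnion (t := fun E => {R | ∃ D, E = .ex R D ∨ E = .all R D})
      fun E _ => ?_).subset ?_
    · refine Set.Subsingleton.finite ?_
      rintro R ⟨D, h⟩ R' ⟨D', h'⟩
      rcases h with rfl | rfl <;> rcases h' with h' | h' <;> cases h' <;> rfl
    · rintro R ⟨D, h | h⟩
      · exact Set.mem_biUnion h ⟨D, Or.inl rfl⟩
      · exact Set.mem_biUnion h ⟨D, Or.inr rfl⟩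
  refine (h.union (h.image Role.inverse)).subset ?_
  rintro R ⟨R', D, rfl | rfl, hD⟩
  · exact Or.inl ⟨D, hD⟩
  · exact Or.inr ⟨R.inverse, ⟨D, hD⟩, R.inverse_inverse⟩

/-! ### Types -/

theorem Interp.mem_typeOf {N : Type} {I : Interp N} {T : TBox} {C₀ C : Concept} {d : I.Dom}
    (h : C ∈ cl T C₀) : C ∈ I.typeOf T C₀ d ↔ d ∈ I.ext C :=
  ⟨fun h => h.2, fun h' => ⟨h, h'⟩⟩

theorem Interp.ext_iff_of_typeOf_eq {N N' : Type} {I : Interp N} {J : Interp N'} {T : TBox}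
    {C₀ C : Concept} {d : I.Dom} {e : J.Dom} (h : I.typeOf T C₀ d = J.typeOf T C₀ e)
    (hC : C ∈ cl T C₀) : d ∈ I.ext C ↔ e ∈ J.ext C := by
  rw [← Interp.mem_typeOf hC, ← Interp.mem_typeOf hC, h]

theorem types_finite (T : TBox) (C₀ : Concept) : (types T C₀).Finite := by
  refine (cl_finite T C₀).finite_subsets.subset ?_
  rintro t ⟨I, d, -, rfl⟩ C hC
  exact hC.1

theorem TypeEdge.symm {T : TBox} {C₀ : Concept} {R : Role} {t t' : Set Concept}
    (h : TypeEdge T C₀ R t t') : TypeEdge T C₀ R.inverse t' t := by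
  obtain ⟨I, d, d', hI, h₁, h₂, h₃⟩ := h
  exact ⟨I, d', d, hI, h₂, h₁, (I.rel_inverse R d' d).2 h₃⟩

theorem TypeEdge.ex_mem {T : TBox} {C₀ C : Concept} {R : Role} {t t' : Set Concept}
    (h : TypeEdge T C₀ R t t') (hC : Concept.ex R C ∈ cl T C₀) (hC' : C ∈ t') :
    Concept.ex R C ∈ t := by
  obtain ⟨I, d, d', hI, rfl, rfl, h₃⟩ := h
  exact ⟨hC, d', h₃, hC'.2⟩

theorem TypeEdge.mem_of_all {T : TBox} {C₀ C : Concept} {R : Role} {t t' : Set Concept}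
    (h : TypeEdge T C₀ R t t') (hC : Concept.all R C ∈ t) : C ∈ t' := by
  obtain ⟨I, d, d', hI, rfl, rfl, h₃⟩ := h
  exact ⟨sub_subset_cl hC.1 (Or.inr C.mem_sub_self), hC.2 d' h₃⟩

/-- With `R` functional, the target of the edge is the only possible witness. This is why a single
ABox successor can stand in for all `R`-successors in `U`. -/
theorem TypeEdge.mem_of_ex {T : TBox} {C₀ C : Concept} {R : Role} {t t' : Set Concept}
    (h : TypeEdge T C₀ R t t') (hf : TBoxAxiom.func R ∈ T) (hC : Concept.ex R C ∈ t) : C ∈ t' := by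
  obtain ⟨I, d, d', hI, rfl, rfl, h₃⟩ := h
  obtain ⟨hC, e, he, heC⟩ := hC
  obtain rfl := hI _ hf d d' e h₃ he
  exact ⟨sub_subset_cl hC (Or.inr C.mem_sub_self), heC⟩

theorem TypeEdge.all_mem {T : TBox} {C₀ C : Concept} {R : Role} {t t' : Set Concept}
    (h : TypeEdge T C₀ R t t') (hf : TBoxAxiom.func R ∈ T) (hC : Concept.all R C ∈ cl T C₀)
    (hC' : C ∈ t') : Concept.all R C ∈ t := by
  obtain ⟨I, d, d', hI, rfl, rfl, h₃⟩ := h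
  refine ⟨hC, fun e he => ?_⟩
  obtain rfl := hI _ hf d d' e h₃ he
  exact hC'.2

/-! ### Disjoint unions of interpretations -/

/-- The disjoint union of a family of interpretations, without named elements. -/
def Interp.sigma {ι : Type} [Nonempty ι] (I : ι → Interp ℕ) : Interp ℕ where
  Dom := Σ i, (I i).Dom
  nonempty := let ⟨i⟩ := ‹Nonempty ι›; let ⟨d⟩ := (I i).nonempty; ⟨⟨i, d⟩⟩
  name := ⊥
  conceptExt A := {x | x.2 ∈ (I x.1).conceptExt A}
  roleExt r x y := ∃ i d e, (I i).roleExt r d e ∧ x = ⟨i, d⟩ ∧ y = ⟨i, e⟩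

section sigma

variable {ι : Type} [Nonempty ι] (I : ι → Interp ℕ)

theorem Interp.sigma_rel {R : Role} {x y : (Interp.sigma I).Dom} :
    (Interp.sigma I).rel R x y ↔ ∃ i d e, (I i).rel R d e ∧ x = ⟨i, d⟩ ∧ y = ⟨i, e⟩ := by
  cases R with
  | name r => exact Iff.rfl
  | inv r =>
    constructor
    · rintro ⟨i, d, e, h, rfl, rfl⟩; exact ⟨i, e, d, h, rfl, rfl⟩
    · rintro ⟨i, d, e, h, rfl, rfl⟩; exact ⟨i, e, d, h, rfl, rfl⟩

theorem Interp.sigma_rel_mk {R : Role} {i : ι} {d : (I i).Dom} {y : (Interp.sigma I).Dom} :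
    (Interp.sigma I).rel R ⟨i, d⟩ y ↔ ∃ e, (I i).rel R d e ∧ y = ⟨i, e⟩ := by
  refine (Interp.sigma_rel I).trans ⟨?_, ?_⟩
  · rintro ⟨i, d, e, h, h', rfl⟩; cases h'; exact ⟨e, h, rfl⟩
  · rintro ⟨e, h, rfl⟩; exact ⟨i, d, e, h, rfl, rfl⟩

/-- Edges, also inverse ones, never leave a component. -/
theorem Interp.sigma_ext (C : Concept) (i : ι) (d : (I i).Dom) :
    (⟨i, d⟩ : (Interp.sigma I).Dom) ∈ (Interp.sigma I).ext C ↔ d ∈ (I i).ext C := by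
  induction C generalizing d with
  | top => exact ⟨fun _ => trivial, fun _ => trivial⟩
  | bot => exact ⟨fun h => h.elim, fun h => h.elim⟩
  | atom A => exact Iff.rfl
  | inter C D hC hD => exact and_congr (hC d) (hD d)
  | union C D hC hD => exact or_congr (hC d) (hD d)
  | neg C hC => exact not_congr (hC d)
  | ex R C hC =>
    constructor
    · rintro ⟨y, hy, hyC⟩
      obtain ⟨e, he, rfl⟩ := (Interp.sigma_rel_mk I).1 hy
      exact ⟨e, he, (hC e).1 hyC⟩
    · rintro ⟨e, he, heC⟩
      exact ⟨⟨i, e⟩, (Interp.sigma_rel_mk I).2 ⟨e, he, rfl⟩, (hC e).2 heC⟩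
  | all R C hC =>
    constructor
    · intro h e he
      exact (hC e).1 (h ⟨i, e⟩ ((Interp.sigma_rel_mk I).2 ⟨e, he, rfl⟩))
    · intro h y hy
      obtain ⟨e, he, rfl⟩ := (Interp.sigma_rel_mk I).1 hy
      exact (hC e).2 (h e he)

theorem Interp.sigma_typeOf (T : TBox) (C₀ : Concept) (i : ι) (d : (I i).Dom) :
    (Interp.sigma I).typeOf T C₀ ⟨i, d⟩ = (I i).typeOf T C₀ d := by
  ext C
  exact and_congr Iff.rfl (Interp.sigma_ext I C i d)

theorem Interp.sigma_isModel {T : TBox} (h : ∀ i, (I i).IsModel T) :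
    (Interp.sigma I).IsModel T := by
  intro s hs
  cases s with
  | incl C D =>
    rintro ⟨i, d⟩ hd
    exact (Interp.sigma_ext I D i d).2 (h i _ hs ((Interp.sigma_ext I C i d).1 hd))
  | func R =>
    rintro ⟨i, d⟩ e e' he he'
    obtain ⟨e₁, he₁, rfl⟩ := (Interp.sigma_rel_mk I).1 he
    obtain ⟨e₂, he₂, rfl⟩ := (Interp.sigma_rel_mk I).1 he'
    rw [h i _ hs d e₁ e₂ he₁ he₂]

end sigma

/-! ### Forest models -/

/-- Nodes of a forest: the roots are individual names, and a child of a node is given by a role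
and an element of some domain `D`. -/
inductive Node (N D : Type) where
  | root (a : N)
  | child (x : Node N D) (R : Role) (e : D)

/-- The data from which a forest model of a TBox and an ABox is built: a model `U` of the TBox,
an element of `U` for every individual name, and a replacement of the edges of `U` by edges with
the same types at both ends. -/
structure Blueprint (T : TBox) (C₀ : Concept) (N : Type) where
  base : Set (Assertion N)
  U : Interp ℕ
  pt : N → U.Dom
  relabel : U.Dom → Role → U.Dom → U.Dom × U.Dom
  isModel : U.IsModel T
  base_nonempty : base.Nonempty
  concept_mem : ∀ A a, Assertion.concept A a ∈ base → Concept.atom A ∈ cl T C₀ →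
    pt a ∈ U.conceptExt A
  edge : ∀ R a b, RoleMem base R a b → RoleOccurs T C₀ R →
    TypeEdge T C₀ R (U.typeOf T C₀ (pt a)) (U.typeOf T C₀ (pt b))
  func : ∀ R a b c, TBoxAxiom.func R ∈ T → RoleMem base R a b → RoleMem base R a c → b = c
  relabel_rel : ∀ d R e, U.rel R d e → U.rel R (relabel d R e).1 (relabel d R e).2
  relabel_fst : ∀ d R e, U.rel R d e → U.typeOf T C₀ (relabel d R e).1 = U.typeOf T C₀ d
  relabel_snd : ∀ d R e, U.rel R d e → U.typeOf T C₀ (relabel d R e).2 = U.typeOf T C₀ e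

namespace Blueprint

variable {T : TBox} {C₀ : Concept} {N : Type} (B : Blueprint T C₀ N)

/-- The element of `U` that a node is a copy of. -/
def label : Node N B.U.Dom → B.U.Dom
  | .root a => B.pt a
  | .child x R e => (B.relabel (label x) R e).2

/-- The edge to `e` is not the one that is already provided by the parent, or by the ABox. -/
def Allowed : Node N B.U.Dom → Role → B.U.Dom → Prop
  | .root a, R, _ => ¬ (TBoxAxiom.func R ∈ T ∧ ∃ b, RoleMem B.base R a b)
  | .child y S e₀, R, e => ¬ (R = S.inverse ∧ e = (B.relabel (B.label y) S e₀).1)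

/-- Children exist only for roles of the closure. All other roles have exactly the edges of the
base, so a fresh role is empty or fully under control. -/
def Valid : Node N B.U.Dom → Prop
  | .root a => a ∈ Ind B.base
  | .child x R e => Valid x ∧ RoleOccurs T C₀ R ∧ B.U.rel R (B.label x) e ∧ B.Allowed x R e

theorem valid_root {a : N} (h : a ∈ Ind B.base) : B.Valid (.root a) := h

open Classical in
/-- The names of the roots. -/
noncomputable def forestName : N ≃. {x // B.Valid x} where
  toFun a := if h : a ∈ Ind B.base then some ⟨.root a, B.valid_root h⟩ else none
  invFun x := match x.1 with
    | .root a => some a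
    | .child _ _ _ => none
  inv := by
    rintro a ⟨x, hx⟩
    cases x with
    | root b =>
      have hb : b ∈ Ind B.base := hx
      by_cases ha : a ∈ Ind B.base
      · simp [ha, eq_comm]
      · simp only [Option.some.injEq, ha, dite_false, reduceCtorEq, iff_false]
        rintro rfl
        exact ha hb
    | child y R e =>
      by_cases ha : a ∈ Ind B.base <;> simp [ha]

open Classical in
theorem forestName_eq_some {a : N} {x : {x // B.Valid x}} :
    B.forestName a = some x ↔ x.1 = .root a := by
  obtain ⟨x, hx⟩ := x
  change (if h : a ∈ Ind B.base then some (⟨.root a, B.valid_root h⟩ : {x // B.Valid x}) else none) =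
    some ⟨x, hx⟩ ↔ _
  constructor
  · intro h
    split_ifs at h
    simpa using h.symm
  · intro h
    obtain rfl : x = .root a := h
    exact dif_pos hx

/-- The forest model. -/
noncomputable def forest : Interp N where
  Dom := {x // B.Valid x}
  nonempty := let ⟨a, ha⟩ := ind_nonempty B.base_nonempty; ⟨⟨.root a, ha⟩⟩
  name := B.forestName
  conceptExt A := {x | B.label x.1 ∈ B.U.conceptExt A ∨
    ∃ a, x.1 = .root a ∧ Assertion.concept A a ∈ B.base}
  roleExt r x y := (∃ a b, x.1 = .root a ∧ y.1 = .root b ∧ Assertion.role r a b ∈ B.base) ∨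
    (∃ e, y.1 = .child x.1 (.name r) e) ∨ (∃ e, x.1 = .child y.1 (.inv r) e)

theorem forest_name {a : N} {x : B.forest.Dom} :
    B.forest.name a = some x ↔ x.1 = .root a := B.forestName_eq_some

theorem forest_rel {R : Role} {x y : B.forest.Dom} :
    B.forest.rel R x y ↔ (∃ a b, x.1 = .root a ∧ y.1 = .root b ∧ RoleMem B.base R a b) ∨
      (∃ e, y.1 = .child x.1 R e) ∨ (∃ e, x.1 = .child y.1 R.inverse e) := by
  cases R with
  | name r => exact Iff.rfl
  | inv r =>
    constructor
    · rintro (⟨a, b, h₁, h₂, h₃⟩ | h | h)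
      · exact Or.inl ⟨b, a, h₂, h₁, h₃⟩
      · exact Or.inr (Or.inr h)
      · exact Or.inr (Or.inl h)
    · rintro (⟨a, b, h₁, h₂, h₃⟩ | h | h)
      · exact Or.inl ⟨b, a, h₂, h₁, h₃⟩
      · exact Or.inr (Or.inr h)
      · exact Or.inr (Or.inl h)

/-- The type that a node is meant to have. -/
abbrev ltype (x : Node N B.U.Dom) : Set Concept := B.U.typeOf T C₀ (B.label x)

theorem ltype_child {x : Node N B.U.Dom} {R : Role} {e : B.U.Dom} (h : B.Valid (.child x R e)) :
    B.ltype (.child x R e) = B.U.typeOf T C₀ e :=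
  B.relabel_snd _ _ _ h.2.2.1

theorem typeEdge_of_rel {U : Interp ℕ} (hU : U.IsModel T) {R : Role} {d e : U.Dom}
    (h : U.rel R d e) : TypeEdge T C₀ R (U.typeOf T C₀ d) (U.typeOf T C₀ e) :=
  ⟨U, d, e, hU, rfl, rfl, h⟩

theorem typeEdge_child {x : Node N B.U.Dom} {R : Role} {e : B.U.Dom}
    (h : B.Valid (.child x R e)) : TypeEdge T C₀ R (B.ltype x) (B.ltype (.child x R e)) := by
  rw [B.ltype_child h]
  exact typeEdge_of_rel B.isModel h.2.2.1

theorem typeEdge_forest {R : Role} {x y : B.forest.Dom} (hR : RoleOccurs T C₀ R)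
    (h : B.forest.rel R x y) : TypeEdge T C₀ R (B.ltype x.1) (B.ltype y.1) := by
  obtain ⟨x, hx⟩ := x
  obtain ⟨y, hy⟩ := y
  rcases B.forest_rel.1 h with ⟨a, b, h₁, h₂, h₃⟩ | ⟨e, h⟩ | ⟨e, h⟩
  · obtain rfl : x = .root a := h₁
    obtain rfl : y = .root b := h₂
    exact B.edge R a b h₃ hR
  · obtain rfl : y = .child x R e := h
    exact B.typeEdge_child hy
  · obtain rfl : x = .child y R.inverse e := h
    simpa using (B.typeEdge_child hx).symm

/-- Every edge of `U` at the label of a node has a counterpart in the forest. -/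
theorem exists_forest_rel {R : Role} (hR : RoleOccurs T C₀ R) (x : B.forest.Dom) {e : B.U.Dom}
    (h : B.U.rel R (B.label x.1) e) :
    ∃ y : B.forest.Dom, B.forest.rel R x y ∧
      (B.ltype y.1 = B.U.typeOf T C₀ e ∨ TBoxAxiom.func R ∈ T) := by
  by_cases hA : B.Allowed x.1 R e
  · have hv : B.Valid (.child x.1 R e) := ⟨x.2, hR, h, hA⟩
    exact ⟨⟨_, hv⟩, B.forest_rel.2 (Or.inr (Or.inl ⟨e, rfl⟩)), Or.inl (B.ltype_child hv)⟩
  · obtain ⟨x, hx⟩ := x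
    cases x with
    | root a =>
      -- The edge was suppressed because the ABox supplies a successor for a functional role. Its
      -- type may be a different one, hence the second alternative of the conclusion.
      obtain ⟨hf, b, hb⟩ := not_not.1 hA
      exact ⟨⟨.root b, hb.ind_right⟩, B.forest_rel.2 (Or.inl ⟨a, b, rfl, rfl, hb⟩), Or.inr hf⟩
    | child y S e₀ =>
      -- The suppressed edge leads back to the source of the relabelled edge; the parent has the
      -- same type as that source and serves instead.
      obtain ⟨rfl, rfl⟩ := not_not.1 hA
      refine ⟨⟨y, hx.1⟩, B.forest_rel.2 (Or.inr (Or.inr ⟨e₀, by simp⟩)), Or.inl ?_⟩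
      exact (B.relabel_fst _ _ _ hx.2.2.1).symm

/-- Edges of the forest join compatible types, which transfers universal restrictions into the
forest and existential ones out of it. Conversely every edge of `U` has a counterpart with the same
target type, except where a functional role is served by the ABox; there compatibility alone forces
the target to contain what is needed. -/
theorem forest_ext {C : Concept} (hC : C ∈ cl T C₀) (x : B.forest.Dom) :
    x ∈ B.forest.ext C ↔ B.label x.1 ∈ B.U.ext C := by
  induction C generalizing x with
  | top => exact ⟨fun _ => trivial, fun _ => trivial⟩
  | bot => exact ⟨fun h => h.elim, fun h => h.elim⟩
  | atom A =>
    refine ⟨?_, Or.inl⟩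
    rintro (h | ⟨a, ha, h⟩)
    · exact h
    · change B.U.conceptExt A (B.label x.1)
      rw [ha]
      exact B.concept_mem A a h hC
  | inter C D hC' hD' =>
    have h := sub_subset_cl hC
    exact and_congr (hC' (h (Or.inl (Or.inr C.mem_sub_self))) x)
      (hD' (h (Or.inr D.mem_sub_self)) x)
  | union C D hC' hD' =>
    have h := sub_subset_cl hC
    exact or_congr (hC' (h (Or.inl (Or.inr C.mem_sub_self))) x)
      (hD' (h (Or.inr D.mem_sub_self)) x)
  | neg C hC' => exact not_congr (hC' (sub_subset_cl hC (Or.inr C.mem_sub_self)) x)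
  | ex R C hC' =>
    have hD : C ∈ cl T C₀ := sub_subset_cl hC (Or.inr C.mem_sub_self)
    have hR := roleOccurs_ex hC
    constructor
    · rintro ⟨y, hy, hyC⟩
      exact ((B.typeEdge_forest hR hy).ex_mem hC ⟨hD, (hC' hD y).1 hyC⟩).2
    · rintro ⟨e, he, heC⟩
      obtain ⟨y, hy, h | h⟩ := B.exists_forest_rel hR x he
      · exact ⟨y, hy, (hC' hD y).2 ((Interp.ext_iff_of_typeOf_eq h hD).2 heC)⟩
      · exact ⟨y, hy, (hC' hD y).2 ((B.typeEdge_forest hR hy).mem_of_ex h ⟨hC, e, he, heC⟩).2⟩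
  | all R C hC' =>
    have hD : C ∈ cl T C₀ := sub_subset_cl hC (Or.inr C.mem_sub_self)
    have hR := roleOccurs_all hC
    constructor
    · intro hx e he
      obtain ⟨y, hy, h | h⟩ := B.exists_forest_rel hR x he
      · exact (Interp.ext_iff_of_typeOf_eq h hD).1 ((hC' hD y).1 (hx y hy))
      · exact ((B.typeEdge_forest hR hy).all_mem h hC ⟨hD, (hC' hD y).1 (hx y hy)⟩).2 e he
    · intro hx y hy
      exact (hC' hD y).2 ((B.typeEdge_forest hR hy).mem_of_all ⟨hC, hx⟩).2

theorem forest_typeOf (x : B.forest.Dom) :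
    B.forest.typeOf T C₀ x = B.U.typeOf T C₀ (B.label x.1) := by
  ext C
  exact and_congr_right fun hC => B.forest_ext hC x

/-- Two base edges agree by the field `func`, two children by functionality of `U`. A root has no
child for a functional role that the ABox already serves. A child parallel to the edge to the parent
is excluded by `Allowed`: the relabelled source is an `R`-successor of the label of the node, so
functionality of `U` makes it the element that the child would copy. -/
theorem forest_func {R : Role} (hf : TBoxAxiom.func R ∈ T) {x y y' : B.forest.Dom}
    (h : B.forest.rel R x y) (h' : B.forest.rel R x y') : y = y' := by
  obtain ⟨x, hx⟩ := x
  obtain ⟨y, hy⟩ := y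
  obtain ⟨y', hy'⟩ := y'
  have hU := B.isModel _ hf
  apply Subtype.ext
  change y = y'
  have h₀ := B.forest_rel.1 h
  have h₀' := B.forest_rel.1 h'
  clear h h'
  rcases h₀ with ⟨a, b, h₁, h₂, h₃⟩ | ⟨e, h⟩ | ⟨e, h⟩ <;>
    rcases h₀' with ⟨a', b', h₁', h₂', h₃'⟩ | ⟨e', h'⟩ | ⟨e', h'⟩ <;>
    dsimp only at * <;> subst_vars
  · cases h₁'
    rw [B.func R a b b' hf h₃ h₃']
  · exact (hy'.2.2.2 ⟨hf, b, h₃⟩).elim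
  · cases h'
  · exact (hy.2.2.2 ⟨hf, b', h₃'⟩).elim
  · rw [hU _ _ _ hy.2.2.1 hy'.2.2.1]
  · refine (hy.2.2.2 ⟨by simp, ?_⟩).elim
    have h₁ := (B.U.rel_inverse _ _ _).1 (B.relabel_rel _ _ _ hx.2.2.1)
    exact hU _ _ _ hy.2.2.1 h₁
  · cases h₁'
  · refine (hy'.2.2.2 ⟨by simp, ?_⟩).elim
    have h₁ := (B.U.rel_inverse _ _ _).1 (B.relabel_rel _ _ _ hx.2.2.1)
    exact hU _ _ _ hy'.2.2.1 h₁
  · cases h'; rfl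

theorem forest_isModel : B.forest.IsModel T := by
  intro s hs
  cases s with
  | incl C D =>
    intro x hx
    obtain ⟨hC, hD⟩ := mem_cl_of_incl (C₀ := C₀) hs
    exact (B.forest_ext hD x).2 (B.isModel _ hs ((B.forest_ext hC x).1 hx))
  | func R => exact fun x y y' h h' => B.forest_func hs h h'

theorem forest_isModelABox : B.forest.IsModelABox B.base := by
  intro s hs
  cases s with
  | concept A a =>
    exact ⟨⟨.root a, _, hs, rfl⟩, B.forest_name.2 rfl, Or.inr ⟨a, rfl, hs⟩⟩
  | role r a b =>
    exact ⟨⟨.root a, _, hs, Or.inl rfl⟩, ⟨.root b, _, hs, Or.inr rfl⟩, B.forest_name.2 rfl,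
      B.forest_name.2 rfl, Or.inl ⟨a, b, rfl, rfl, hs⟩⟩

end Blueprint

end DL
-- Models of unravelings and the correctness of the canonical program.
namespace DL

theorem forall_mem_pair {α : Type*} {p : α → Prop} {a b : α} :
    (∀ x ∈ [a, b], p x) ↔ p a ∧ p b := by simp

/-! ### Unravelings -/

theorem roleMem_unravel {N : Type} {A : Set (Assertion N)} {R : Role} {α β : Path N} :
    RoleMem (unravel A) R α β ↔ (∃ b, β = α.snoc R b ∧ (α.snoc R b).IsPathOf A) ∨
      (∃ b, α = β.snoc R.inverse b ∧ (β.snoc R.inverse b).IsPathOf A) := by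
  have key : ∀ (r : RoleName) (α β : Path N), Assertion.role r α β ∈ unravel A ↔
      (∃ b, β = α.snoc (.name r) b ∧ (α.snoc (.name r) b).IsPathOf A) ∨
      (∃ b, α = β.snoc (.inv r) b ∧ (β.snoc (.inv r) b).IsPathOf A) := by
    intro r α β
    constructor
    · rintro ((⟨C, γ, -, -, h⟩ | ⟨r', γ, b, hp, h⟩) | ⟨r', γ, b, hp, h⟩)
      · cases h
      · cases h; exact Or.inl ⟨b, rfl, hp⟩
      · cases h; exact Or.inr ⟨b, rfl, hp⟩
    · rintro (⟨b, rfl, hp⟩ | ⟨b, rfl, hp⟩)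
      · exact Or.inl (Or.inr ⟨r, α, b, hp, rfl⟩)
      · exact Or.inr ⟨r, β, b, hp, rfl⟩
  cases R with
  | name r => exact key r α β
  | inv r => exact (key r β α).trans or_comm

theorem concept_mem_unravel {N : Type} {A : Set (Assertion N)} {B : ConceptName} {α : Path N} :
    Assertion.concept B α ∈ unravel A ↔ α.IsPathOf A ∧ Assertion.concept B α.tail ∈ A := by
  constructor
  · rintro ((⟨C, γ, hp, hm, h⟩ | ⟨r', γ, b, hp, h⟩) | ⟨r', γ, b, hp, h⟩)
    · cases h; exact ⟨hp, hm⟩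
    · cases h
    · cases h
  · rintro ⟨hp, hm⟩
    exact Or.inl (Or.inl ⟨B, α, hp, hm, rfl⟩)

theorem single_mem_ind_unravel {N : Type} {A : Set (Assertion N)} {a : N} (ha : a ∈ Ind A) :
    Path.single a ∈ Ind (unravel A) := by
  obtain ⟨s, hs, hm⟩ := ha
  cases s with
  | concept B b =>
    obtain rfl : a = b := hm
    have hp : (Path.single a).IsPathOf A := show a ∈ Ind A from ⟨_, hs, rfl⟩
    exact ⟨_, concept_mem_unravel.2 ⟨hp, hs⟩, rfl⟩
  | role r b c =>
    rcases hm with rfl | rfl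
    · have h : RoleMem (unravel A) (.name r) (.single a) ((Path.single a).snoc (.name r) c) :=
        roleMem_unravel.2 (Or.inl ⟨c, rfl, ⟨_, hs, Or.inl rfl⟩, hs, trivial⟩)
      exact h.ind_left
    · have h : RoleMem (unravel A) (.inv r) (.single a) ((Path.single a).snoc (.inv r) b) :=
        roleMem_unravel.2 (Or.inl ⟨b, rfl, ⟨_, hs, Or.inr rfl⟩, hs, trivial⟩)
      exact h.ind_left

/-- `A` satisfies the functionality assertions of `T`. -/
def RespectsFunc {N : Type} (T : TBox) (A : Set (Assertion N)) : Prop :=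
  ∀ R a b c, TBoxAxiom.func R ∈ T → RoleMem A R a b → RoleMem A R a c → b = c

/-- The condition against backtracking is exactly what is needed: if the predecessor of a path and
an extension of it are both `R`-successors, functionality in `A` makes the extension step back to
where the path came from. -/
theorem RespectsFunc.unravel {N : Type} {T : TBox} {A : Set (Assertion N)}
    (hA : RespectsFunc T A) : RespectsFunc T (unravel A) := by
  intro R α β γ hf h₁ h₂
  rcases roleMem_unravel.1 h₁ with ⟨b, rfl, hb⟩ | ⟨b, rfl, hb⟩ <;>
    rcases roleMem_unravel.1 h₂ with ⟨c, rfl, hc⟩ | ⟨c, h, hc⟩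
  · rw [hA R _ _ _ hf hb.2.1 hc.2.1]
  · subst h
    have h := hA R _ _ _ hf hb.2.1 ((roleMem_inverse _ _ _ _).1 hc.2.1)
    refine (hb.2.2 ?_).elim
    simp [h]
  · have h := hA R _ _ _ hf hc.2.1 ((roleMem_inverse _ _ _ _).1 hb.2.1)
    refine (hc.2.2 ?_).elim
    simp [h]
  · cases h; rfl

theorem Interp.IsModelABox.exists_rel {N : Type} {I : Interp N} {A : Set (Assertion N)}
    (hA : I.IsModelABox A) {R : Role} {a b : N} (h : RoleMem A R a b) :
    ∃ d e, I.name a = some d ∧ I.name b = some e ∧ I.rel R d e := by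
  cases R with
  | name r => exact hA _ h
  | inv r =>
    obtain ⟨d, e, hd, he, hr⟩ := hA _ h
    exact ⟨e, d, he, hd, hr⟩

theorem Interp.IsModelABox.exists_name {N : Type} {I : Interp N} {A : Set (Assertion N)}
    (hA : I.IsModelABox A) {a : N} (h : a ∈ Ind A) : ∃ d, I.name a = some d := by
  obtain ⟨s, hs, hm⟩ := h
  have := hA s hs
  cases s with
  | concept B b =>
    obtain rfl : a = b := hm
    obtain ⟨d, hd, -⟩ := this
    exact ⟨d, hd⟩
  | role r b c =>
    obtain ⟨d, e, hd, he, -⟩ := this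
    rcases hm with rfl | rfl
    · exact ⟨d, hd⟩
    · exact ⟨e, he⟩

theorem Interp.name_injective {N : Type} (I : Interp N) {a b : N} {d : I.Dom}
    (ha : I.name a = some d) (hb : I.name b = some d) : a = b :=
  I.name.inj ha hb

/-- Standard names are essential: equal elements must carry equal names. -/
theorem respectsFunc_of_model {N : Type} {T : TBox} {I : Interp N} {A : Set (Assertion N)}
    (hT : I.IsModel T) (hA : I.IsModelABox A) : RespectsFunc T A := by
  intro R a b c hf h₁ h₂
  obtain ⟨d, e, hd, he, hr⟩ := hA.exists_rel h₁
  obtain ⟨d', e', hd', he', hr'⟩ := hA.exists_rel h₂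
  obtain rfl : d = d' := Option.some.inj (hd.symm.trans hd')
  obtain rfl := hT _ hf _ _ _ hr hr'
  exact I.name_injective he he'

/-! ### Assignments of sets of types to individual names -/

/-- `S b` is a set of candidate types for every individual name `b` of `A`; it is closed under
the propagation of the canonical program. -/
structure TypeAssignment (T : TBox) (C₀ : Concept) (A : Set (Assertion IndName))
    (S : IndName → Set (Set Concept)) : Prop where
  subset : ∀ b, S b ⊆ types T C₀
  concept : ∀ B b, Assertion.concept B b ∈ A → Concept.atom B ∈ cl T C₀ → ∀ t ∈ S b,
    Concept.atom B ∈ t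
  role : ∀ R b c, RoleMem A R b c → RoleOccurs T C₀ R → ∀ t ∈ S b, ∃ t' ∈ S c,
    TypeEdge T C₀ R t t'

/-- Take the disjoint union of one model for each type; a forest over it can then start with any
type at any root. -/
theorem exists_universal_model {T : TBox} {C₀ : Concept} (h : (types T C₀).Nonempty) :
    ∃ U : Interp ℕ, U.IsModel T ∧ ∃ el : Set Concept → U.Dom,
      ∀ t ∈ types T C₀, U.typeOf T C₀ (el t) = t := by
  classical
  have h' : ∀ t : types T C₀, ∃ (I : Interp ℕ) (d : I.Dom), I.IsModel T ∧
      t.1 = I.typeOf T C₀ d := fun t => t.2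
  choose I d hI hd using h'
  have : Nonempty (types T C₀) := h.to_subtype
  have hel : ∀ t, ∃ x : (Interp.sigma I).Dom, t ∈ types T C₀ →
      (Interp.sigma I).typeOf T C₀ x = t := by
    intro t
    by_cases ht : t ∈ types T C₀
    · exact ⟨⟨⟨t, ht⟩, d _⟩, fun _ => (Interp.sigma_typeOf I T C₀ _ _).trans (hd ⟨t, ht⟩).symm⟩
    · obtain ⟨x⟩ := (Interp.sigma I).nonempty
      exact ⟨x, fun h => (ht h).elim⟩
  choose el hel using hel
  exact ⟨Interp.sigma I, Interp.sigma_isModel I hI, el, hel⟩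

section assignment

variable {T : TBox} {C₀ : Concept} {A : Set (Assertion IndName)}
  {S : IndName → Set (Set Concept)}

open Classical in
/-- A choice of types for the individual names of the unraveling. -/
noncomputable def pathType (T : TBox) (C₀ : Concept) (S : IndName → Set (Set Concept))
    (a : IndName) (t : Set Concept) : Path IndName → Set Concept
  | .single b => if b = a then t else Classical.epsilon (· ∈ S b)
  | .snoc α R b =>
    if RoleOccurs T C₀ R then
      Classical.epsilon fun t' => t' ∈ S b ∧ TypeEdge T C₀ R (pathType T C₀ S a t α) t'
    else Classical.epsilon (· ∈ S b)

/-- Arc consistency means that the stepwise choice of types along a path never gets stuck. -/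
theorem pathType_mem (hS : TypeAssignment T C₀ A S) (hne : ∀ b ∈ Ind A, (S b).Nonempty)
    {a : IndName} {t : Set Concept} (ht : t ∈ S a) {α : Path IndName} (hα : α.IsPathOf A) :
    pathType T C₀ S a t α ∈ S α.tail := by
  induction α with
  | single b =>
    rw [pathType]
    split_ifs with h
    · subst h; exact ht
    · exact Classical.epsilon_spec (hne b hα)
  | snoc α R b ih =>
    rw [pathType]
    split_ifs with h
    · obtain ⟨t', h₁, h₂⟩ := hS.role R _ _ hα.2.1 h _ (ih hα.1)
      exact (Classical.epsilon_spec
        (p := fun t' => t' ∈ S b ∧ TypeEdge T C₀ R (pathType T C₀ S a t α) t') ⟨t', h₁, h₂⟩).1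
    · exact Classical.epsilon_spec (hne b hα.2.1.ind_right)

theorem pathType_edge (hS : TypeAssignment T C₀ A S) (hne : ∀ b ∈ Ind A, (S b).Nonempty)
    {a : IndName} {t : Set Concept} (ht : t ∈ S a) {α : Path IndName} {R : Role} {b : IndName}
    (hR : RoleOccurs T C₀ R) (hα : (α.snoc R b).IsPathOf A) :
    TypeEdge T C₀ R (pathType T C₀ S a t α) (pathType T C₀ S a t (α.snoc R b)) := by
  rw [pathType, if_pos hR]
  obtain ⟨t', h₁, h₂⟩ := hS.role R _ _ hα.2.1 hR _ (pathType_mem hS hne ht hα.1)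
  exact (Classical.epsilon_spec
    (p := fun t' => t' ∈ S b ∧ TypeEdge T C₀ R (pathType T C₀ S a t α) t') ⟨t', h₁, h₂⟩).2

/-- Every candidate type of `a` is realized at `a` in a model of the unraveling. -/
theorem TypeAssignment.exists_model (hS : TypeAssignment T C₀ A S)
    (hne : ∀ b ∈ Ind A, (S b).Nonempty) (hf : RespectsFunc T A) {a : IndName} (ha : a ∈ Ind A)
    {t : Set Concept} (ht : t ∈ S a) :
    ∃ K : Interp (Path IndName), K.IsModel T ∧ K.IsModelABox (unravel A) ∧
      (∃ d, K.name (.single a) = some d ∧ K.typeOf T C₀ d = t) ∧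
      ∀ R, ¬ RoleOccurs T C₀ R → (∀ b c, ¬ RoleMem A R b c) → ∀ d e, ¬ K.rel R d e := by
  obtain ⟨U, hU, el, hel⟩ := exists_universal_model ⟨t, hS.subset a ht⟩
  have hel' : ∀ α : Path IndName, α.IsPathOf A →
      U.typeOf T C₀ (el (pathType T C₀ S a t α)) = pathType T C₀ S a t α := fun α hα =>
    hel _ (hS.subset _ (pathType_mem hS hne ht hα))
  let B : Blueprint T C₀ (Path IndName) :=
    { base := unravel A
      U := U
      pt := fun α => el (pathType T C₀ S a t α)
      relabel := fun d _ e => (d, e)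
      isModel := hU
      base_nonempty := let ⟨s, hs, _⟩ := single_mem_ind_unravel ha; ⟨s, hs⟩
      concept_mem := by
        intro X α h hX
        obtain ⟨hp, hm⟩ := concept_mem_unravel.1 h
        have := hS.concept X _ hm hX _ (pathType_mem hS hne ht hp)
        rw [← hel' α hp] at this
        exact this.2
      edge := by
        intro R α β h hR
        rcases roleMem_unravel.1 h with ⟨b, rfl, hb⟩ | ⟨b, rfl, hb⟩
        · rw [hel' _ hb, hel' _ hb.1]
          exact pathType_edge hS hne ht hR hb
        · rw [hel' _ hb, hel' _ hb.1]
          simpa using (pathType_edge hS hne ht hR.inverse hb).symm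
      func := hf.unravel
      relabel_rel := fun _ _ _ h => h
      relabel_fst := fun _ _ _ _ => rfl
      relabel_snd := fun _ _ _ _ => rfl }
  refine ⟨B.forest, B.forest_isModel, B.forest_isModelABox,
    ⟨⟨.root (.single a), single_mem_ind_unravel ha⟩, B.forest_name.2 rfl, ?_⟩, ?_⟩
  · refine (B.forest_typeOf _).trans ?_
    change U.typeOf T C₀ (el (pathType T C₀ S a t (.single a))) = t
    have hp : (Path.single a).IsPathOf A := ha
    rw [hel' _ hp, pathType, if_pos rfl]
  -- A role outside the closure creates no children, and a role absent from `A` has no edges in the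
  -- unraveling.
  · intro R hR hA d e h
    have hA' : ∀ α b, ¬ (Path.snoc α R b).IsPathOf A := fun α b h => hA _ _ h.2.1
    have hA'' : ∀ α b, ¬ (Path.snoc α R.inverse b).IsPathOf A := fun α b h =>
      hA _ _ ((roleMem_inverse _ _ _ _).1 h.2.1)
    rcases B.forest_rel.1 h with ⟨α, β, -, -, h⟩ | ⟨e', h⟩ | ⟨e', h⟩
    · rcases roleMem_unravel.1 h with ⟨b, rfl, hb⟩ | ⟨b, rfl, hb⟩
      · exact hA' _ _ hb
      · exact hA'' _ _ hb
    · have := e.2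
      rw [h] at this
      exact hR this.2.1
    · have := d.2
      rw [h] at this
      exact hR (roleOccurs_inverse.1 this.2.1)

/-- For an unraveling tolerant TBox, certain `ELI`-concepts are in all candidate types. -/
theorem TypeAssignment.mem_of_certain (hT : UnravelingTolerant T) (hA : IsABox A)
    (hS : TypeAssignment T C₀ A S) (hne : ∀ b ∈ Ind A, (S b).Nonempty) (hf : RespectsFunc T A)
    {C : Concept} (hC : C.IsELI) (hcl : C ∈ cl T C₀) {a : IndName} (ha : a ∈ Ind A)
    (h : CertainConcept T A C a) {t : Set Concept} (ht : t ∈ S a) : C ∈ t := by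
  obtain ⟨K, hK, hKA, ⟨d, hd, rfl⟩, -⟩ := hS.exists_model hne hf ha ht
  obtain ⟨d', hd', hdC⟩ := hT A hA C hC a ha h K hK hKA
  obtain rfl : d = d' := Option.some.inj (hd.symm.trans hd')
  exact ⟨hcl, hdC⟩

/-- Only finitely many role names are used, so all names from some point on are fresh. A whole
sequence of them is needed for the disjunction property. -/
theorem exists_fresh_role (T : TBox) (C₀ : Concept) {A : Set (Assertion IndName)}
    (hA : A.Finite) : ∃ s : RoleName, ∀ r ≥ s, ¬ RoleOccurs T C₀ (.name r) ∧
      TBoxAxiom.func (.name r) ∉ T ∧ TBoxAxiom.func (.inv r) ∉ T ∧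
      ∀ b c, ¬ RoleMem A (.name r) b c := by
  have h : {r | RoleOccurs T C₀ (.name r) ∨ TBoxAxiom.func (.name r) ∈ T ∨
      TBoxAxiom.func (.inv r) ∈ T ∨ ∃ b c, RoleMem A (.name r) b c}.Finite := by
    have inj : Function.Injective Role.name := fun _ _ h => by cases h; rfl
    refine ((roleOccurs_finite T C₀).preimage inj.injOn).union
      ((T.finite_toSet.preimage (f := fun r => TBoxAxiom.func (.name r)) ?_).union
      ((T.finite_toSet.preimage (f := fun r => TBoxAxiom.func (.inv r)) ?_).union ?_))
    · intro _ _ _ _ h; cases h; rfl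
    · intro _ _ _ _ h; cases h; rfl
    · refine (hA.image fun s => match s with
        | Assertion.concept _ _ => 0
        | Assertion.role r _ _ => r).subset ?_
      rintro r ⟨b, c, h⟩
      exact ⟨_, h, rfl⟩
  obtain ⟨s, hs⟩ := h.bddAbove
  refine ⟨s + 1, fun r hr => ?_⟩
  have : r ∉ {r | RoleOccurs T C₀ (.name r) ∨ TBoxAxiom.func (.name r) ∈ T ∨
      TBoxAxiom.func (.inv r) ∈ T ∨ ∃ b c, RoleMem A (.name r) b c} := fun h => by
    exact absurd (hs h) (Nat.not_le.2 hr)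
  simpa only [Set.mem_ofPred_eq, not_or, not_exists] using this

/-- For an unraveling tolerant TBox, an ABox with candidate types for all individual names
has a model. -/
theorem TypeAssignment.consistent (hT : UnravelingTolerant T) (hA : IsABox A)
    (hS : TypeAssignment T C₀ A S) (hne : ∀ b ∈ Ind A, (S b).Nonempty) (hf : RespectsFunc T A) :
    ∃ I : Interp IndName, I.IsModel T ∧ I.IsModelABox A := by
  by_contra hcon
  push Not at hcon
  obtain ⟨s, hs⟩ := exists_fresh_role T C₀ hA.1
  obtain ⟨a, ha⟩ := ind_nonempty hA.2
  obtain ⟨t, ht⟩ := hne a ha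
  obtain ⟨K, hK, hKA, -, hrel⟩ := hS.exists_model hne hf ha ht
  -- Without models every concept is certain, so tolerance would force an edge of a fresh role in
  -- `K`, where this role is empty.
  obtain ⟨d, -, e, he, -⟩ := hT A hA (.ex (.name s) .top) trivial a ha
    (fun I hI hIA => (hcon I hI hIA).elim) K hK hKA
  exact hrel _ (hs s le_rfl).1 (hs s le_rfl).2.2.2 d e he

end assignment

/-! ### Programs that compute sets of types -/

/-- A program over the intensional symbols of the canonical program. -/
def typeProgram {n : ℕ} (rules : Set (DatalogRule (ι := Set (Set Concept)) (fun _ => 1) n)) :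
    DatalogProgram n where
  IDB := Set (Set Concept)
  arity := fun _ => 1
  rules := rules

/-- The rules of the canonical program for the intensional symbols, with an arbitrary arity of
the goal relation. -/
inductive IsTypeRule (T : TBox) (C₀ : Concept) (n : ℕ) :
    DatalogRule (ι := Set (Set Concept)) (fun _ => 1) n → Prop
  | all :
      IsTypeRule T C₀ n ⟨.idb (types T C₀) fun _ => 0, [.top 0]⟩
  | name (A : ConceptName) : Concept.atom A ∈ cl T C₀ →
      IsTypeRule T C₀ n
        ⟨.idb {t | t ∈ types T C₀ ∧ Concept.atom A ∈ t} fun _ => 0, [.concept A 0]⟩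
  | role (R : Role) (S₀ S₁ : Set (Set Concept)) : RoleOccurs T C₀ R →
      S₀ ⊆ types T C₀ → S₁ ⊆ types T C₀ →
      IsTypeRule T C₀ n
        ⟨.idb {t | t ∈ S₀ ∧ ∃ t' ∈ S₁, TypeEdge T C₀ R t t'} fun _ => 0,
          [typeAtom S₀ 0, .ofRole R 0 1, typeAtom S₁ 1]⟩
  | inter (S₀ S₁ : Set (Set Concept)) : S₀ ⊆ types T C₀ → S₁ ⊆ types T C₀ →
      IsTypeRule T C₀ n ⟨.idb (S₀ ∩ S₁) fun _ => 0, [typeAtom S₀ 0, typeAtom S₁ 0]⟩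

theorem ofRole_holds {ι : Type} {arity : ι → ℕ} {n : ℕ} {A : Set (Assertion IndName)}
    {M : Set (HeadAtom arity n IndName)} {σ : Var → IndName} {R : Role} {x y : Var} :
    (BodyAtom.ofRole R x y : BodyAtom arity).Holds A M σ ↔ RoleMem A R (σ x) (σ y) := by
  cases R <;> rfl

theorem ofRole_isRelational {ι : Type} {arity : ι → ℕ} {R : Role} {x y : Var} :
    (BodyAtom.ofRole R x y : BodyAtom arity).IsRelational := by
  cases R <;> trivial

theorem mem_vars_ofRole {ι : Type} {arity : ι → ℕ} {R : Role} {x y z : Var} :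
    z ∈ (BodyAtom.ofRole R x y : BodyAtom arity).vars ↔ z = x ∨ z = y := by
  cases R
  · exact Iff.rfl
  · exact or_comm

section typeProgram

variable {T : TBox} {C₀ : Concept} {n : ℕ}

theorem isTypeRule_finite (T : TBox) (C₀ : Concept) (n : ℕ) :
    {ρ | IsTypeRule T C₀ n ρ}.Finite := by
  have hS : {S | S ⊆ types T C₀}.Finite := (types_finite T C₀).finite_subsets
  have hN : {A | Concept.atom A ∈ cl T C₀}.Finite :=
    (cl_finite T C₀).preimage fun _ _ _ _ h => by cases h; rfl
  let f₁ : ConceptName → DatalogRule (ι := Set (Set Concept)) (fun _ => 1) n := fun A =>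
    ⟨.idb {t | t ∈ types T C₀ ∧ Concept.atom A ∈ t} fun _ => 0, [.concept A 0]⟩
  let f₂ : Role × Set (Set Concept) × Set (Set Concept) →
      DatalogRule (ι := Set (Set Concept)) (fun _ => 1) n := fun p =>
    ⟨.idb {t | t ∈ p.2.1 ∧ ∃ t' ∈ p.2.2, TypeEdge T C₀ p.1 t t'} fun _ => 0,
      [typeAtom p.2.1 0, .ofRole p.1 0 1, typeAtom p.2.2 1]⟩
  let f₃ : Set (Set Concept) × Set (Set Concept) →
      DatalogRule (ι := Set (Set Concept)) (fun _ => 1) n := fun p =>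
    ⟨.idb (p.1 ∩ p.2) fun _ => 0, [typeAtom p.1 0, typeAtom p.2 0]⟩
  refine ((Set.finite_singleton ⟨.idb (types T C₀) fun _ => 0, [.top 0]⟩).union
    ((hN.image f₁).union ((((roleOccurs_finite T C₀).prod (hS.prod hS)).image f₂).union
    ((hS.prod hS).image f₃)))).subset ?_
  rintro ρ (_ | ⟨A, hA⟩ | ⟨R, S₀, S₁, hR, h₀, h₁⟩ | ⟨S₀, S₁, h₀, h₁⟩)
  · exact Or.inl rfl
  · exact Or.inr (Or.inl ⟨A, hA, rfl⟩)
  · exact Or.inr (Or.inr (Or.inl ⟨(R, S₀, S₁), ⟨hR, h₀, h₁⟩, rfl⟩))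
  · exact Or.inr (Or.inr (Or.inr ⟨(S₀, S₁), ⟨h₀, h₁⟩, rfl⟩))

theorem IsTypeRule.safe {ρ : DatalogRule (ι := Set (Set Concept)) (fun _ => 1) n}
    (h : IsTypeRule T C₀ n ρ) : ρ.Safe := by
  cases h with
  | all =>
    simp [DatalogRule.Safe, HeadAtom.vars, BodyAtom.IsRelational, BodyAtom.vars]
  | name A hA =>
    simp [DatalogRule.Safe, HeadAtom.vars, BodyAtom.IsRelational, BodyAtom.vars]
  | role R S₀ S₁ hR h₀ h₁ =>
    have key : ∀ c ∈ [typeAtom S₀ 0, .ofRole R 0 1, typeAtom S₁ 1],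
        ∀ x ∈ c.vars, x = 0 ∨ x = 1 :=
      List.forall_mem_cons.2 ⟨fun x ⟨_, h⟩ => Or.inl h.symm, List.forall_mem_cons.2
        ⟨fun x h => mem_vars_ofRole.1 h, List.forall_mem_cons.2
        ⟨fun x ⟨_, h⟩ => Or.inr h.symm, List.forall_mem_nil _⟩⟩⟩
    refine ⟨⟨_, List.mem_cons_self, trivial⟩, fun x ⟨_, hx⟩ => ?_, fun c hc x hx => ?_⟩
    · exact ⟨_, List.mem_cons_self, trivial, 0, hx⟩
    · exact ⟨.ofRole R 0 1, List.mem_cons_of_mem _ List.mem_cons_self, ofRole_isRelational,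
        mem_vars_ofRole.2 (key c hc x hx)⟩
  | inter S₀ S₁ h₀ h₁ =>
    simp [DatalogRule.Safe, HeadAtom.vars, BodyAtom.IsRelational, BodyAtom.vars, typeAtom]

/-- The facts that hold in a model, together with some goal facts. -/
def modelFacts (T : TBox) (C₀ : Concept) (I : Interp IndName) (Q : Set (Fin n → IndName)) :
    Set (HeadAtom (ι := Set (Set Concept)) (fun _ => 1) n IndName)
  | .idb S args => ∃ d, I.name (args 0) = some d ∧ I.typeOf T C₀ d ∈ S
  | .goal args => args ∈ Q

/-- Goal facts never occur in bodies, so `Q` may be arbitrary. This lets the canonical program and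
the query programs share the lemma. -/
theorem IsTypeRule.sound {ρ : DatalogRule (ι := Set (Set Concept)) (fun _ => 1) n}
    (h : IsTypeRule T C₀ n ρ) {A : Set (Assertion IndName)} {I : Interp IndName}
    (hT : I.IsModel T) (hA : I.IsModelABox A) {Q : Set (Fin n → IndName)} {σ : Var → IndName}
    (hb : ∀ b ∈ ρ.body, b.Holds A (modelFacts T C₀ I Q) σ) :
    ρ.head.map σ ∈ modelFacts T C₀ I Q := by
  cases h with
  | all =>
    have h : σ 0 ∈ Ind A := hb (.top 0) (by simp)
    obtain ⟨d, hd⟩ := hA.exists_name h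
    exact ⟨d, hd, I, d, hT, rfl⟩
  | name B hB =>
    have h : Assertion.concept B (σ 0) ∈ A := hb (.concept B 0) (by simp)
    obtain ⟨d, hd, hdB⟩ := hA _ h
    exact ⟨d, hd, ⟨I, d, hT, rfl⟩, hB, hdB⟩
  | role R S₀ S₁ hR h₀ h₁ =>
    obtain ⟨d₀, hd₀, ht₀⟩ : ∃ d, I.name (σ 0) = some d ∧ I.typeOf T C₀ d ∈ S₀ :=
      hb (typeAtom S₀ 0) (by simp)
    obtain ⟨d₁, hd₁, ht₁⟩ : ∃ d, I.name (σ 1) = some d ∧ I.typeOf T C₀ d ∈ S₁ :=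
      hb (typeAtom S₁ 1) (by simp)
    have h : RoleMem A R (σ 0) (σ 1) := ofRole_holds.1 (hb (.ofRole R 0 1) (by simp))
    obtain ⟨d, e, hd, he, hr⟩ := hA.exists_rel h
    obtain rfl : d₀ = d := Option.some.inj (hd₀.symm.trans hd)
    obtain rfl : d₁ = e := Option.some.inj (hd₁.symm.trans he)
    exact ⟨d₀, hd₀, ht₀, _, ht₁, I, d₀, d₁, hT, rfl, rfl, hr⟩
  | inter S₀ S₁ h₀ h₁ =>
    obtain ⟨d₀, hd₀, ht₀⟩ : ∃ d, I.name (σ 0) = some d ∧ I.typeOf T C₀ d ∈ S₀ :=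
      hb (typeAtom S₀ 0) (by simp)
    obtain ⟨d₁, hd₁, ht₁⟩ : ∃ d, I.name (σ 0) = some d ∧ I.typeOf T C₀ d ∈ S₁ :=
      hb (typeAtom S₁ 0) (by simp)
    obtain rfl : d₀ = d₁ := Option.some.inj (hd₀.symm.trans hd₁)
    exact ⟨d₀, hd₀, ht₀, ht₁⟩

/-- Derivability is expressed as membership in all closed sets; one rule application preserves it.
-/
theorem DatalogProgram.holds_of_derived {P : DatalogProgram n} {A : Set (Assertion IndName)}
    {σ : Var → IndName} {ρ : DatalogRule P.arity n} (hρ : ρ ∈ P.rules) (hσ : ∀ x, σ x ∈ Ind A)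
    (hb : ∀ M, P.IsClosed A M → ∀ b ∈ ρ.body, b.Holds A M σ) :
    ∀ M, P.IsClosed A M → ρ.head.map σ ∈ M :=
  fun M hM => hM ρ hρ σ hσ (hb M hM)

/-- The least sets of types that are derived for the individual names. -/
theorem exists_typeAssignment
    {rules : Set (DatalogRule (ι := Set (Set Concept)) (fun _ => 1) n)}
    (hr : ∀ ρ, IsTypeRule T C₀ n ρ → ρ ∈ rules) (A : Set (Assertion IndName)) :
    ∃ S : IndName → Set (Set Concept), TypeAssignment T C₀ A S ∧ ∀ b ∈ Ind A,
      ∀ M, (typeProgram rules).IsClosed A M → HeadAtom.idb (S b) (fun _ => b) ∈ M := by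
  classical
  let D : IndName → Set (Set (Set Concept)) := fun b => {S | S ⊆ types T C₀ ∧
    ∀ M, (typeProgram rules).IsClosed A M → HeadAtom.idb S (fun _ => b) ∈ M}
  have hall : ∀ b ∈ Ind A, types T C₀ ∈ D b := fun b hb => ⟨subset_rfl,
    DatalogProgram.holds_of_derived (P := typeProgram rules) (σ := fun _ => b) (hr _ .all)
      (fun _ => hb) fun M _ => List.forall_mem_singleton.2 hb⟩
  have hmin : ∀ b, ∃ S : Set (Set Concept), (b ∈ Ind A → S ∈ D b) ∧ S ⊆ types T C₀ ∧
      ∀ S' ∈ D b, S ⊆ S' := by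
    intro b
    by_cases hb : b ∈ Ind A
    · have hfin : (D b).Finite := (types_finite T C₀).finite_subsets.subset fun S hS => hS.1
      obtain ⟨S, hS⟩ := hfin.exists_minimal ⟨_, hall b hb⟩
      refine ⟨S, fun _ => hS.1, hS.1.1, fun S' hS' => ?_⟩
      -- The intersection rule makes a minimal derived set the least one.
      have : S ∩ S' ∈ D b := ⟨Set.inter_subset_left.trans hS.1.1,
        DatalogProgram.holds_of_derived (P := typeProgram rules) (σ := fun _ => b)
          (hr _ (.inter S S' hS.1.1 hS'.1)) (fun _ => hb) fun M hM =>
            forall_mem_pair.2 ⟨hS.1.2 M hM, hS'.2 M hM⟩⟩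
      exact (hS.2 this Set.inter_subset_left).trans Set.inter_subset_right
    · exact ⟨∅, fun h => (hb h).elim, Set.empty_subset _, fun _ _ => Set.empty_subset _⟩
  choose S hSD hST hSmin using hmin
  refine ⟨S, ⟨hST, ?_, ?_⟩, fun b hb => (hSD b hb).2⟩
  · intro B b hB hcl t ht
    have hb : b ∈ Ind A := ⟨_, hB, rfl⟩
    have : {t | t ∈ types T C₀ ∧ Concept.atom B ∈ t} ∈ D b := ⟨fun _ h => h.1,
      DatalogProgram.holds_of_derived (P := typeProgram rules) (σ := fun _ => b)
        (hr _ (.name B hcl)) (fun _ => hb) fun M hM => List.forall_mem_singleton.2 hB⟩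
    exact (hSmin b _ this ht).2
  · intro R b c hR hocc t ht
    have hb := hR.ind_left
    have hc := hR.ind_right
    -- The role rule applied to the least sets derives a subset of `S b`, which by leastness is all
    -- of `S b`. Hence every type in `S b` has a partner in `S c`.
    have : {t | t ∈ S b ∧ ∃ t' ∈ S c, TypeEdge T C₀ R t t'} ∈ D b :=
      ⟨fun _ h => hST b h.1,
      DatalogProgram.holds_of_derived (P := typeProgram rules) (σ := fun x => if x = 0 then b else c)
        (hr _ (.role R (S b) (S c) hocc (hST b) (hST c)))
        (fun x => by split_ifs <;> assumption) fun M hM =>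
          List.forall_mem_cons.2 ⟨(hSD b hb).2 M hM, forall_mem_pair.2
            ⟨ofRole_holds.2 hR, (hSD c hc).2 M hM⟩⟩⟩
    exact (hSmin b _ this ht).2

end typeProgram

/-! ### The canonical program -/

theorem IsTypeRule.isCanonicalRule {T : TBox} {C₀ : Concept} {ρ : CanonicalRule}
    (h : IsTypeRule T C₀ 1 ρ) : IsCanonicalRule T C₀ ρ := by
  cases h with
  | all => exact .all
  | name A hA => exact .name A hA
  | role R S₀ S₁ hR h₀ h₁ => exact .role R S₀ S₁ hR h₀ h₁
  | inter S₀ S₁ h₀ h₁ => exact .inter S₀ S₁ h₀ h₁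

theorem canonicalProgram_isProgram (T : TBox) (C₀ : Concept) :
    (canonicalProgram T C₀).IsProgram := by
  constructor
  · have hS : {S | S ⊆ types T C₀}.Finite := (types_finite T C₀).finite_subsets
    have hF : {R | TBoxAxiom.func R ∈ T}.Finite :=
      T.finite_toSet.preimage fun _ _ _ _ h => by cases h; rfl
    let f₁ : Set (Set Concept) → CanonicalRule := fun S => ⟨goalHead 0, [typeAtom S 0]⟩
    let f₂ : Role → CanonicalRule := fun R =>
      ⟨goalHead 0, [.top 0, .ofRole R 1 2, .ofRole R 1 3, .neq 2 3]⟩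
    refine ((isTypeRule_finite T C₀ 1).union ((hS.image f₁).union
      ((Set.finite_singleton ⟨goalHead 0, [.top 0, typeAtom ∅ 1]⟩).union
      (hF.image f₂)))).subset ?_
    rintro ρ (_ | ⟨A, hA⟩ | ⟨R, S₀, S₁, hR, h₀, h₁⟩ | ⟨S₀, S₁, h₀, h₁⟩ | ⟨S, hS, hC⟩ | _ | ⟨R, hR⟩)
    · exact Or.inl .all
    · exact Or.inl (.name A hA)
    · exact Or.inl (.role R S₀ S₁ hR h₀ h₁)
    · exact Or.inl (.inter S₀ S₁ h₀ h₁)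
    · exact Or.inr (Or.inl ⟨S, hS, rfl⟩)
    · exact Or.inr (Or.inr (Or.inl rfl))
    · exact Or.inr (Or.inr (Or.inr ⟨R, hR, rfl⟩))
  · rintro ρ (_ | ⟨A, hA⟩ | ⟨R, S₀, S₁, hR, h₀, h₁⟩ | ⟨S₀, S₁, h₀, h₁⟩ | ⟨S, hS, hC⟩ | _ | ⟨R, hR⟩)
    · exact (IsTypeRule.all (T := T) (C₀ := C₀) (n := 1)).safe
    · exact (IsTypeRule.name (n := 1) A hA).safe
    · exact (IsTypeRule.role (n := 1) R S₀ S₁ hR h₀ h₁).safe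
    · exact (IsTypeRule.inter (n := 1) S₀ S₁ h₀ h₁).safe
    · refine ⟨⟨_, List.mem_cons_self, trivial⟩, fun x ⟨_, hx⟩ => ?_, ?_⟩
      · exact ⟨_, List.mem_cons_self, trivial, (0 : Fin 1), hx⟩
      · exact List.forall_mem_singleton.2 fun x hx => ⟨_, List.mem_cons_self, trivial, hx⟩
    · refine ⟨⟨_, List.mem_cons_self, trivial⟩, fun x ⟨_, hx⟩ => ?_, ?_⟩
      · exact ⟨_, List.mem_cons_self, trivial, hx.symm⟩
      · exact forall_mem_pair.2 ⟨fun x hx => ⟨_, List.mem_cons_self, trivial, hx⟩,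
          fun x hx => ⟨_, List.mem_cons_of_mem _ List.mem_cons_self, trivial, hx⟩⟩
    · refine ⟨⟨_, List.mem_cons_self, trivial⟩, fun x ⟨_, hx⟩ => ?_, ?_⟩
      · exact ⟨_, List.mem_cons_self, trivial, hx.symm⟩
      · have h₁ : BodyAtom.ofRole R 1 2 ∈ [BodyAtom.top 0, .ofRole R 1 2, .ofRole R 1 3,
            (.neq 2 3 : BodyAtom (ι := Set (Set Concept)) (fun _ => 1))] :=
          List.mem_cons_of_mem _ List.mem_cons_self
        have h₂ : BodyAtom.ofRole R 1 3 ∈ [BodyAtom.top 0, .ofRole R 1 2, .ofRole R 1 3,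
            (.neq 2 3 : BodyAtom (ι := Set (Set Concept)) (fun _ => 1))] :=
          List.mem_cons_of_mem _ (List.mem_cons_of_mem _ List.mem_cons_self)
        refine List.forall_mem_cons.2 ⟨fun x hx => ⟨_, List.mem_cons_self, trivial, hx⟩,
          List.forall_mem_cons.2 ⟨fun x hx => ⟨_, h₁, ofRole_isRelational, hx⟩,
          forall_mem_pair.2 ⟨fun x hx => ⟨_, h₂, ofRole_isRelational, hx⟩, ?_⟩⟩⟩
        rintro x (hx | hx)
        · exact ⟨_, h₁, ofRole_isRelational, mem_vars_ofRole.2 (Or.inr hx)⟩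
        · exact ⟨_, h₂, ofRole_isRelational, mem_vars_ofRole.2 (Or.inr hx)⟩

/-- Fix a model. The facts `P_S(b)` for which the type of `b` lies in `S`, with the answers of this
model as goal facts, are closed under all rules. The last two rules cannot fire, as no type lies in
`∅` and the model respects functionality. -/
theorem canonicalProgram_sound {T : TBox} {C₀ : Concept}
    {A : Set (Assertion IndName)} {a : Fin 1 → IndName}
    (h : (canonicalProgram T C₀).Returns A a) : CertainConcept T A C₀ (a 0) := by
  intro I hI hA
  have hcl : C₀ ∈ cl T C₀ := sub_subset_cl_self T C₀ C₀.mem_sub_self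
  let Q : Set (Fin 1 → IndName) := {a | ∃ d, I.name (a 0) = some d ∧ d ∈ I.ext C₀}
  refine h (modelFacts T C₀ I Q) ?_
  intro ρ hρ σ hσ hb
  rcases hρ with _ | ⟨A, hA⟩ | ⟨R, S₀, S₁, hR, h₀, h₁⟩ | ⟨S₀, S₁, h₀, h₁⟩ | ⟨S, hS, hC⟩ | _ | ⟨R, hR⟩
  · exact (IsTypeRule.all (T := T) (C₀ := C₀) (n := 1)).sound hI hA hb
  · exact (IsTypeRule.name (n := 1) A hA).sound hI ‹_› hb
  · exact (IsTypeRule.role (n := 1) R S₀ S₁ hR h₀ h₁).sound hI hA hb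
  · exact (IsTypeRule.inter (n := 1) S₀ S₁ h₀ h₁).sound hI hA hb
  · obtain ⟨d, hd, ht⟩ : ∃ d, I.name (σ 0) = some d ∧ I.typeOf T C₀ d ∈ S :=
      hb (typeAtom S 0) (List.mem_singleton.2 rfl)
    exact ⟨d, hd, (hC _ ht).2⟩
  · obtain ⟨d, hd, ht⟩ : ∃ d, I.name (σ 1) = some d ∧ I.typeOf T C₀ d ∈ (∅ : Set (Set Concept)) :=
      hb (typeAtom ∅ 1) (List.mem_cons_of_mem _ (List.mem_singleton.2 rfl))
    exact ht.elim
  · have h₁ : RoleMem A R (σ 1) (σ 2) := ofRole_holds.1 (hb (.ofRole R 1 2)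
      (List.mem_cons_of_mem _ List.mem_cons_self))
    have h₂ : RoleMem A R (σ 1) (σ 3) := ofRole_holds.1 (hb (.ofRole R 1 3)
      (List.mem_cons_of_mem _ (List.mem_cons_of_mem _ List.mem_cons_self)))
    have h₃ : σ 2 ≠ σ 3 := hb (.neq 2 3) (List.mem_cons_of_mem _ (List.mem_cons_of_mem _
      (List.mem_cons_of_mem _ List.mem_cons_self)))
    exact (h₃ (respectsFunc_of_model hI hA R _ _ _ hR h₁ h₂)).elim

/-- The three kinds of goal rule match the three possible situations: a functionality violation, an
empty least set, or else a type assignment with non-empty sets, all of whose types at the individual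
contain the certain concept. -/
theorem canonicalProgram_complete {T : TBox} (hT : UnravelingTolerant T) {C₀ : Concept}
    (hC₀ : C₀.IsELI) {A : Set (Assertion IndName)} (hA : IsABox A) {a : Fin 1 → IndName}
    (ha : ∀ i, a i ∈ Ind A) (h : CertainConcept T A C₀ (a 0)) :
    (canonicalProgram T C₀).Returns A a := by
  have hcl : C₀ ∈ cl T C₀ := sub_subset_cl_self T C₀ C₀.mem_sub_self
  obtain ⟨S, hS, hD⟩ := exists_typeAssignment (T := T) (C₀ := C₀) (n := 1)
    (rules := {ρ | IsCanonicalRule T C₀ ρ}) (fun ρ h => h.isCanonicalRule) A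
  intro M hM
  obtain ⟨a₀, rfl⟩ : ∃ a₀, a = fun _ => a₀ :=
    ⟨a 0, funext fun i => by rw [Subsingleton.elim i 0]⟩
  by_cases hf : RespectsFunc T A
  · by_cases hne : ∀ b ∈ Ind A, (S b).Nonempty
    · refine hM _ (.goal (S a₀) (hS.subset _) fun t ht =>
        hS.mem_of_certain hT hA hne hf hC₀ hcl (ha 0) h ht) (fun _ => a₀) (fun _ => ha 0)
        (List.forall_mem_singleton.2 (hD a₀ (ha 0) M hM))
    · push Not at hne
      obtain ⟨b, hb, hSb⟩ := hne
      refine hM _ .empty (fun x => if x = 0 then a₀ else b)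
        (fun x => by split_ifs <;> [exact ha 0; exact hb])
        (forall_mem_pair.2 ⟨ha 0, ?_⟩)
      have := hD b hb M hM
      rwa [hSb] at this
  · unfold RespectsFunc at hf
    push Not at hf
    obtain ⟨R, y, z₁, z₂, hR, h₁, h₂, hz⟩ := hf
    refine hM _ (.func R hR) (fun x => if x = 0 then a₀ else if x = 1 then y else
      if x = 2 then z₁ else z₂) (fun x => ?_)
      (List.forall_mem_cons.2 ⟨ha 0, List.forall_mem_cons.2 ⟨ofRole_holds.2 h₁,
        forall_mem_pair.2 ⟨ofRole_holds.2 h₂, hz⟩⟩⟩)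
    · split_ifs
      · exact ha 0
      · exact h₁.ind_left
      · exact h₁.ind_right
      · exact h₂.ind_right

theorem canonicalProgram_isRewriting {T : TBox} (hT : UnravelingTolerant T) {C₀ : Concept}
    (hC₀ : C₀.IsELI) :
    (canonicalProgram T C₀).IsRewriting (fun A a => CertainConcept T A C₀ (a 0)) :=
  fun _ hA _ ha => ⟨canonicalProgram_complete hT hC₀ hA ha, canonicalProgram_sound⟩

end DL
-- The disjunction property and minimal models.
namespace DL

/-! ### Conjunctions -/

/-- The conjunction of a list of concepts. -/
def conj (l : List Concept) : Concept := l.foldr .inter .top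

theorem ext_conj {N : Type} (I : Interp N) (l : List Concept) (d : I.Dom) :
    d ∈ I.ext (conj l) ↔ ∀ C ∈ l, d ∈ I.ext C := by
  induction l with
  | nil => exact ⟨fun _ _ h => by simp at h, fun _ => trivial⟩
  | cons C l ih =>
    rw [List.forall_mem_cons, ← ih]
    exact Iff.rfl

theorem isELI_conj {l : List Concept} (h : ∀ C ∈ l, C.IsELI) : (conj l).IsELI := by
  induction l with
  | nil => trivial
  | cons C l ih => exact ⟨h C (by simp), ih fun D hD => h D (by simp [hD])⟩

theorem mem_sub_conj {l : List Concept} {C : Concept} (h : C ∈ l) : C ∈ (conj l).sub := by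
  induction l with
  | nil => simp at h
  | cons D l ih =>
    rcases List.mem_cons.1 h with rfl | h
    · exact Or.inl (Or.inr C.mem_sub_self)
    · exact Or.inr (ih h)

/-! ### Renaming of individual names -/

/-- The interpretation in which `a` is the name of the element that was named `f a`. -/
noncomputable def Interp.rename {M N : Type} (I : Interp N) (f : M → N) (hf : f.Injective) :
    Interp M where
  Dom := I.Dom
  nonempty := I.nonempty
  name := (PEquiv.trans
    { toFun := fun a => some (f a)
      invFun := fun b => Function.partialInv f b
      inv := fun a b => by
        simpa [eq_comm] using hf.isPartialInv a b } I.name)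
  conceptExt := I.conceptExt
  roleExt := I.roleExt

section rename

variable {M N : Type} (I : Interp N) (f : M → N) (hf : f.Injective)

theorem Interp.rename_rel {R : Role} {d e : I.Dom} :
    (I.rename f hf).rel R d e ↔ I.rel R d e := by
  cases R <;> rfl

theorem Interp.rename_ext (C : Concept) (d : I.Dom) : d ∈ (I.rename f hf).ext C ↔ d ∈ I.ext C := by
  induction C generalizing d with
  | top => exact Iff.rfl
  | bot => exact Iff.rfl
  | atom A => exact Iff.rfl
  | inter C D hC hD => exact and_congr (hC d) (hD d)
  | union C D hC hD => exact or_congr (hC d) (hD d)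
  | neg C hC => exact not_congr (hC d)
  | ex R C hC => exact exists_congr fun e => and_congr (I.rename_rel f hf) (hC e)
  | all R C hC => exact forall_congr' fun e => imp_congr (I.rename_rel f hf) (hC e)

theorem Interp.rename_isModel {T : TBox} (h : I.IsModel T) : (I.rename f hf).IsModel T := by
  intro s hs
  cases s with
  | incl C D =>
    exact fun d hd => (I.rename_ext f hf D d).2 (h _ hs ((I.rename_ext f hf C d).1 hd))
  | func R =>
    exact fun d e e' he he' => h _ hs d e e' ((I.rename_rel f hf).1 he) ((I.rename_rel f hf).1 he')

end rename

/-- Apply a function to the individual names of an assertion. -/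
def Assertion.map {M N : Type} (f : M → N) : Assertion M → Assertion N
  | .concept A a => .concept A (f a)
  | .role r a b => .role r (f a) (f b)

/-- The truth of an assertion if `a` stands for `g a`. -/
def Assertion.SatUnder {M N : Type} (K : Interp N) (g : M → K.Dom) : Assertion M → Prop
  | .concept A a => g a ∈ K.conceptExt A
  | .role r a b => K.roleExt r (g a) (g b)

theorem Assertion.satUnder_map {M M' N : Type} {K : Interp N} {f : M → M'} {g : M' → K.Dom}
    {s : Assertion M} : (s.map f).SatUnder K g ↔ s.SatUnder K (g ∘ f) := by
  cases s <;> rfl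

theorem Interp.rel_of_satUnder {M N : Type} {K : Interp N} {g : M → K.Dom} {B : Set (Assertion M)}
    (h : ∀ s ∈ B, s.SatUnder K g) {R : Role} {a b : M} (hR : RoleMem B R a b) :
    K.rel R (g a) (g b) := by
  cases R
  · exact h _ hR
  · exact h _ hR

theorem Assertion.mentions_map {M N : Type} {f : M → N} {s : Assertion M} {b : N} :
    (s.map f).Mentions b ↔ ∃ a, s.Mentions a ∧ f a = b := by
  cases s with
  | concept A a => simp [Assertion.map, Assertion.Mentions, eq_comm]
  | role r a c =>
    simp only [Assertion.map, Assertion.Mentions]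
    constructor
    · rintro (rfl | rfl)
      · exact ⟨a, Or.inl rfl, rfl⟩
      · exact ⟨c, Or.inr rfl, rfl⟩
    · rintro ⟨d, rfl | rfl, rfl⟩
      · exact Or.inl rfl
      · exact Or.inr rfl

/-- A finite part of an interpretation witnesses that an element satisfies an `ELI`-concept. -/
theorem Concept.IsELI.exists_finite_part {N : Type} {C : Concept} (hC : C.IsELI) (I : Interp N)
    {d : I.Dom} (hd : d ∈ I.ext C) :
    ∃ B : Set (Assertion I.Dom), B.Finite ∧ (∀ s ∈ B, s.SatUnder I id) ∧
      ∀ (K : Interp ℕ) (g : I.Dom → K.Dom), (∀ s ∈ B, s.SatUnder K g) → g d ∈ K.ext C := by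
  induction C generalizing d with
  | top => exact ⟨∅, Set.finite_empty, fun s hs => hs.elim, fun K g _ => trivial⟩
  | atom A =>
    refine ⟨{.concept A d}, Set.finite_singleton _, ?_, fun K g h => h (.concept A d) rfl⟩
    rintro s rfl
    exact hd
  | inter C D ihC ihD =>
    obtain ⟨B₁, hB₁, hs₁, h₁⟩ := ihC hC.1 hd.1
    obtain ⟨B₂, hB₂, hs₂, h₂⟩ := ihD hC.2 hd.2
    refine ⟨B₁ ∪ B₂, hB₁.union hB₂, ?_, fun K g h =>
      ⟨h₁ K g fun s hs => h s (Or.inl hs), h₂ K g fun s hs => h s (Or.inr hs)⟩⟩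
    rintro s (hs | hs)
    · exact hs₁ s hs
    · exact hs₂ s hs
  | ex R C ihC =>
    obtain ⟨e, he, heC⟩ := hd
    obtain ⟨B, hB, hs, h⟩ := ihC hC heC
    refine ⟨insert (match R with
      | .name r => .role r d e
      | .inv r => .role r e d) B, hB.insert _, ?_, fun K g hK =>
        ⟨g e, ?_, h K g fun s hs => hK s (Or.inr hs)⟩⟩
    · rintro s (rfl | hs')
      · cases R <;> exact he
      · exact hs s hs'
    · have := hK _ (Or.inl rfl)
      cases R <;> exact this
  | bot | union C D | neg C | all R C => exact hC.elim

/-- The finite part of the model is renamed by numbers. Distinct names denote distinct elements of a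
model, so the resulting ABox inherits functionality. -/
theorem Concept.IsELI.exists_witness_abox {N : Type} {C : Concept} (hC : C.IsELI) (I : Interp N)
    {d : I.Dom} (hd : d ∈ I.ext C) :
    ∃ (B : Set (Assertion ℕ)) (g : ℕ → I.Dom) (w : ℕ), B.Finite ∧ (∀ s ∈ B, s.SatUnder I g) ∧
      Set.InjOn g (Ind B) ∧
      ∀ (K : Interp ℕ) (g : ℕ → K.Dom), (∀ s ∈ B, s.SatUnder K g) → g w ∈ K.ext C := by
  obtain ⟨B, hB, hs, h⟩ := hC.exists_finite_part I hd
  obtain ⟨f, hf⟩ := Set.countable_iff_exists_injOn.1 ((ind_finite hB).countable)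
  have := I.nonempty
  have hinv : ∀ x ∈ Ind B, Function.invFunOn f (Ind B) (f x) = x := fun x hx =>
    hf.leftInvOn_invFunOn hx
  refine ⟨Assertion.map f '' B, Function.invFunOn f (Ind B), f d, hB.image _, ?_, ?_, ?_⟩
  · rintro _ ⟨s, hsB, rfl⟩
    have := hs s hsB
    cases s with
    | concept A a =>
      have ha : a ∈ Ind B := ⟨_, hsB, rfl⟩
      change Function.invFunOn f (Ind B) (f a) ∈ I.conceptExt A
      rw [hinv a ha]
      exact this
    | role r a b =>
      have ha : a ∈ Ind B := ⟨_, hsB, Or.inl rfl⟩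
      have hb : b ∈ Ind B := ⟨_, hsB, Or.inr rfl⟩
      change I.roleExt r (Function.invFunOn f (Ind B) (f a)) (Function.invFunOn f (Ind B) (f b))
      rw [hinv a ha, hinv b hb]
      exact this
  · have hmem : ∀ n ∈ Ind (Assertion.map f '' B), ∃ x ∈ Ind B, f x = n := by
      rintro n ⟨_, ⟨s, hsB, rfl⟩, hm⟩
      obtain ⟨a, ha, rfl⟩ := Assertion.mentions_map.1 hm
      exact ⟨a, ⟨s, hsB, ha⟩, rfl⟩
    intro n hn m hm hnm
    obtain ⟨x, hx, rfl⟩ := hmem n hn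
    obtain ⟨y, hy, rfl⟩ := hmem m hm
    rw [hinv x hx, hinv y hy] at hnm
    rw [hnm]
  · intro K g hK
    exact h K (g ∘ f) fun s hs => Assertion.satUnder_map.1 (hK _ ⟨s, hs, rfl⟩)

/-! ### The disjunction property -/

/-- An ABox that refutes the unraveling tolerance of a TBox without the disjunction property. It
consists of a copy of `A`, of ABoxes `B j` that make the `j`-th disjunct true at `w j`, and of
individuals for a query whose branches can only be satisfied by using the copy of `A`. -/
inductive Combined (A : Set (Assertion ℕ)) (k s : ℕ) (a : ℕ → ℕ) (B : ℕ → Set (Assertion ℕ))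
    (w : ℕ → ℕ) : Assertion ℕ → Prop
  | orig (t) : t ∈ A → Combined A k s a B w (t.map (Nat.pair 0))
  | top (i) : i < k → Combined A k s a B w (.role s (Nat.pair 1 0) (Nat.pair 2 i))
  | mid (i) : i < k →
      Combined A k s a B w (.role (s + 1 + i) (Nat.pair 2 i) (Nat.pair 0 (a i)))
  | wit (i j) : i < k → j < k → i ≠ j →
      Combined A k s a B w (.role (s + 1 + j) (Nat.pair 2 i) (Nat.pair (3 + j) (w j)))
  | data (j t) : j < k → t ∈ B j → Combined A k s a B w (t.map (Nat.pair (3 + j)))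

section combined

variable {A : Set (Assertion ℕ)} {k s : ℕ} {a : ℕ → ℕ} {B : ℕ → Set (Assertion ℕ)} {w : ℕ → ℕ}

theorem combined_finite (hA : A.Finite) (hB : ∀ j, (B j).Finite) :
    {t | Combined A k s a B w t}.Finite := by
  refine ((hA.image (Assertion.map (Nat.pair 0))).union
    (((Set.finite_Iio k).image fun i => Assertion.role s (Nat.pair 1 0) (Nat.pair 2 i)).union
    (((Set.finite_Iio k).image
      fun i => Assertion.role (s + 1 + i) (Nat.pair 2 i) (Nat.pair 0 (a i))).union
    ((((Set.finite_Iio k).prod (Set.finite_Iio k)).image fun p : ℕ × ℕ =>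
      Assertion.role (s + 1 + p.2) (Nat.pair 2 p.1) (Nat.pair (3 + p.2) (w p.2))).union
    ((Set.finite_Iio k).biUnion (t := fun j => Assertion.map (Nat.pair (3 + j)) '' B j)
      fun j _ => (hB j).image _))))).subset ?_
  rintro t (⟨t, ht⟩ | ⟨i, hi⟩ | ⟨i, hi⟩ | ⟨i, j, hi, hj, hij⟩ | ⟨j, t, hj, ht⟩)
  · exact Or.inl ⟨t, ht, rfl⟩
  · exact Or.inr (Or.inl ⟨i, hi, rfl⟩)
  · exact Or.inr (Or.inr (Or.inl ⟨i, hi, rfl⟩))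
  · exact Or.inr (Or.inr (Or.inr (Or.inl ⟨(i, j), ⟨hi, hj⟩, rfl⟩)))
  · exact Or.inr (Or.inr (Or.inr (Or.inr (Set.mem_biUnion (x := j) hj ⟨t, ht, rfl⟩))))

theorem combined_concept {X x : ℕ} (h : Combined A k s a B w (.concept X x)) :
    (∃ y, x = Nat.pair 0 y ∧ Assertion.concept X y ∈ A) ∨
    (∃ j y, x = Nat.pair (3 + j) y ∧ Assertion.concept X y ∈ B j) := by
  generalize ht : Assertion.concept X x = t at h
  cases h with
  | orig t h =>
    cases t with
    | concept Y y => cases ht; exact Or.inl ⟨y, rfl, h⟩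
    | role r y z => cases ht
  | data j t hj h =>
    cases t with
    | concept Y y => cases ht; exact Or.inr ⟨j, y, rfl, h⟩
    | role r y z => cases ht
  | top i hi => cases ht
  | mid i hi => cases ht
  | wit i j hi hj hij => cases ht

theorem combined_role {r x y : ℕ} (h : Combined A k s a B w (.role r x y)) :
    (∃ x' y', x = Nat.pair 0 x' ∧ y = Nat.pair 0 y' ∧ Assertion.role r x' y' ∈ A) ∨
    (∃ j x' y', x = Nat.pair (3 + j) x' ∧ y = Nat.pair (3 + j) y' ∧
      Assertion.role r x' y' ∈ B j) ∨
    (r = s ∧ x = Nat.pair 1 0 ∧ ∃ i, i < k ∧ y = Nat.pair 2 i) ∨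
    (∃ i, r = s + 1 + i ∧ x = Nat.pair 2 i ∧ y = Nat.pair 0 (a i)) ∨
    (∃ i j, i ≠ j ∧ r = s + 1 + j ∧ x = Nat.pair 2 i) := by
  generalize ht : Assertion.role r x y = t at h
  cases h with
  | orig t h =>
    cases t with
    | concept Y y => cases ht
    | role r' x' y' => cases ht; exact Or.inl ⟨x', y', rfl, rfl, h⟩
  | data j t hj h =>
    cases t with
    | concept Y y => cases ht
    | role r' x' y' => cases ht; exact Or.inr (Or.inl ⟨j, x', y', rfl, rfl, h⟩)
  | top i hi => cases ht; exact Or.inr (Or.inr (Or.inl ⟨rfl, rfl, i, hi, rfl⟩))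
  | mid i hi => cases ht; exact Or.inr (Or.inr (Or.inr (Or.inl ⟨i, rfl, rfl, rfl⟩)))
  | wit i j hi hj hij => cases ht; exact Or.inr (Or.inr (Or.inr (Or.inr ⟨i, j, hij, rfl, rfl⟩)))

/-- Roles that are not fresh stay inside the copy of `A` or inside one `B j`, so functionality and
labelling can be treated separately for each piece. -/
theorem combined_roleMem {R : Role} (hR : ∀ r ≥ s, R ≠ .name r ∧ R ≠ .inv r) {x y : ℕ}
    (h : RoleMem {t | Combined A k s a B w t} R x y) :
    (∃ x' y', x = Nat.pair 0 x' ∧ y = Nat.pair 0 y' ∧ RoleMem A R x' y') ∨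
    (∃ j x' y', x = Nat.pair (3 + j) x' ∧ y = Nat.pair (3 + j) y' ∧ RoleMem (B j) R x' y') := by
  cases R with
  | name r =>
    rcases combined_role h with h | h | ⟨rfl, -⟩ | ⟨i, rfl, -⟩ | ⟨i, j, -, rfl, -⟩
    · exact Or.inl h
    · exact Or.inr h
    · exact ((hR _ le_rfl).1 rfl).elim
    · exact ((hR _ (by omega)).1 rfl).elim
    · exact ((hR _ (by omega)).1 rfl).elim
  | inv r =>
    rcases combined_role h with ⟨x', y', h₁, h₂, h₃⟩ | ⟨j, x', y', h₁, h₂, h₃⟩ | ⟨rfl, -⟩ |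
      ⟨i, rfl, -⟩ | ⟨i, j, -, rfl, -⟩
    · exact Or.inl ⟨y', x', h₂, h₁, h₃⟩
    · exact Or.inr ⟨j, y', x', h₂, h₁, h₃⟩
    · exact ((hR _ le_rfl).2 rfl).elim
    · exact ((hR _ (by omega)).2 rfl).elim
    · exact ((hR _ (by omega)).2 rfl).elim

theorem combined_respectsFunc {T : TBox} (hA : RespectsFunc T A) (hB : ∀ j, RespectsFunc T (B j))
    (hs : ∀ r ≥ s, TBoxAxiom.func (.name r) ∉ T ∧ TBoxAxiom.func (.inv r) ∉ T) :
    RespectsFunc T {t | Combined A k s a B w t} := by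
  intro R x y z hf hy hz
  have hR : ∀ r ≥ s, R ≠ .name r ∧ R ≠ .inv r := fun r hr =>
    ⟨by rintro rfl; exact (hs r hr).1 hf, by rintro rfl; exact (hs r hr).2 hf⟩
  rcases combined_roleMem hR hy with ⟨x', y', h₁, h₂, h₃⟩ | ⟨j, x', y', h₁, h₂, h₃⟩ <;>
    rcases combined_roleMem hR hz with ⟨u', z', k₁, k₂, k₃⟩ | ⟨j', u', z', k₁, k₂, k₃⟩ <;>
    rw [h₁] at k₁ <;> obtain ⟨hj, rfl⟩ := Nat.pair_eq_pair.1 k₁ <;> subst h₂ k₂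
  · rw [hA R _ _ _ hf h₃ k₃]
  · omega
  · omega
  · obtain rfl : j = j' := by omega
    rw [hB j R _ _ _ hf h₃ k₃]

/-- The query of `Combined` is certain if the disjunction is. -/
theorem combined_certain {T : TBox} {C : ℕ → Concept}
    (hB : ∀ j, ∀ (K : Interp ℕ) (g : ℕ → K.Dom), (∀ t ∈ B j, t.SatUnder K g) →
      g (w j) ∈ K.ext (C j))
    (h : ∀ I : Interp ℕ, I.IsModel T → I.IsModelABox A →
      ∃ i < k, ∃ d, I.name (a i) = some d ∧ d ∈ I.ext (C i)) :
    CertainConcept T {t | Combined A k s a B w t}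
      (.ex (.name s) (conj ((List.range k).map fun i => .ex (.name (s + 1 + i)) (C i))))
      (Nat.pair 1 0) := by
  intro I hI hIA
  have hinj : (Nat.pair 0).Injective := fun x y h => (Nat.pair_eq_pair.1 h).2
  -- Reading the names `pair 0 x` as `x` turns a model of the combined ABox into a model of `A`,
  -- where some disjunct `i` holds; the branch through the `i`-th middle individual will satisfy the
  -- query.
  obtain ⟨i, hi, d, hd, hdC⟩ := h (I.rename _ hinj) (I.rename_isModel _ hinj hI) (by
    intro t ht
    have := hIA _ (Combined.orig t ht)
    cases t <;> exact this)
  obtain ⟨x, m, hx, hm, hxm⟩ := hIA _ (Combined.top i hi)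
  refine ⟨x, hx, m, hxm, (ext_conj I _ m).2 fun D hD => ?_⟩
  obtain ⟨j, hj, rfl⟩ := List.mem_map.1 hD
  have hj : j < k := List.mem_range.1 hj
  -- On this branch, conjunct `i` is witnessed in the copy of `A` and every other conjunct `j` by
  -- the ABox `B j`.
  by_cases hij : i = j
  · subst hij
    obtain ⟨m', e, hm', he, hr⟩ := hIA _ (Combined.mid i hi)
    obtain rfl : m = m' := Option.some.inj (hm.symm.trans hm')
    obtain rfl : d = e := Option.some.inj (hd.symm.trans he)
    exact ⟨d, hr, (I.rename_ext _ hinj _ _).1 hdC⟩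
  · obtain ⟨m', e, hm', he, hr⟩ := hIA _ (Combined.wit i j hi hj hij)
    obtain rfl : m = m' := Option.some.inj (hm.symm.trans hm')
    -- The default `m` is harmless: the names in the assertions of `B j` and `w j` all belong to the
    -- combined ABox and are interpreted.
    have hsat := hB j I (fun n => (I.name (Nat.pair (3 + j) n)).getD m) (by
      intro t ht
      have := hIA _ (Combined.data j t hj ht)
      cases t with
      | concept X x =>
        obtain ⟨d, hd, hX⟩ := this
        change (I.name (Nat.pair (3 + j) x)).getD m ∈ I.conceptExt X
        rw [hd]
        exact hX
      | role r x y =>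
        obtain ⟨d, d', hd, hd', hr⟩ := this
        change I.roleExt r ((I.name (Nat.pair (3 + j) x)).getD m)
          ((I.name (Nat.pair (3 + j) y)).getD m)
        rw [hd, hd']
        exact hr)
    rw [he] at hsat
    exact ⟨e, hr, hsat⟩

/-- The index of the individual `mid i` that was visited last. -/
def lastMid : Path ℕ → ℕ
  | .single _ => 0
  | .snoc α _ _ => if α.tail.unpair.1 = 2 then α.tail.unpair.2 else lastMid α

end combined

/-- The disjunction property: there is a model that refutes finitely many `ELI`-concepts at
individual names at once if each of them is refuted by some model. -/
theorem exists_countermodel {T : TBox} (hT : UnravelingTolerant T) {A : Set (Assertion IndName)}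
    (hA : IsABox A) {k : ℕ} (hk : 0 < k) (a : ℕ → IndName) (C : ℕ → Concept)
    (hC : ∀ i, (C i).IsELI) (ha : ∀ i, a i ∈ Ind A)
    (hsat : ∀ i, ∃ (J : Interp ℕ) (d : J.Dom), J.IsModel T ∧ d ∈ J.ext (C i))
    (hnot : ∀ i, ¬ CertainConcept T A (C i) (a i)) :
    ∃ I : Interp IndName, I.IsModel T ∧ I.IsModelABox A ∧
      ∀ i < k, ∀ d, I.name (a i) = some d → d ∉ I.ext (C i) := by
  by_contra hcon
  have hcert : ∀ I : Interp ℕ, I.IsModel T → I.IsModelABox A →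
      ∃ i < k, ∃ d, I.name (a i) = some d ∧ d ∈ I.ext (C i) := by
    intro I hI hIA
    by_contra h
    exact hcon ⟨I, hI, hIA, fun i hi d hd hdC => h ⟨i, hi, d, hd, hdC⟩⟩
  have hnot' : ∀ i, ∃ I : Interp ℕ, I.IsModel T ∧ I.IsModelABox A ∧
      ∀ d, I.name (a i) = some d → d ∉ I.ext (C i) := by
    intro i
    by_contra h
    exact hnot i fun I hI hIA => by
      by_contra h'
      exact h ⟨I, hI, hIA, fun d hd hdC => h' ⟨d, hd, hdC⟩⟩
  choose I hI hIA hIC using hnot'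
  choose J e hJ he using hsat
  have hw := fun j => (hC j).exists_witness_abox (J j) (he j)
  choose B g w hBfin hBsat hginj hBC using hw
  have hnm : ∀ i b, ∃ d, b ∈ Ind A → (I i).name b = some d := by
    intro i b
    by_cases hb : b ∈ Ind A
    · obtain ⟨d, hd⟩ := (hIA i).exists_name hb
      exact ⟨d, fun _ => hd⟩
    · obtain ⟨d⟩ := (I i).nonempty
      exact ⟨d, fun h => (hb h).elim⟩
  choose nm hnm using hnm
  have hIsat : ∀ i, ∀ t ∈ A, t.SatUnder (I i) (nm i) := by
    intro i t ht
    have h := hIA i t ht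
    cases t with
    | concept X x =>
      obtain ⟨d, hd, hX⟩ := h
      obtain rfl : nm i x = d := Option.some.inj ((hnm i x ⟨_, ht, rfl⟩).symm.trans hd)
      exact hX
    | role r x y =>
      obtain ⟨d, d', hd, hd', hr⟩ := h
      obtain rfl : nm i x = d := Option.some.inj ((hnm i x ⟨_, ht, Or.inl rfl⟩).symm.trans hd)
      obtain rfl : nm i y = d' := Option.some.inj ((hnm i y ⟨_, ht, Or.inr rfl⟩).symm.trans hd')
      exact hr
  let C₁ := conj ((List.range k).map C)
  have hcl : ∀ i < k, C i ∈ cl T C₁ := fun i hi =>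
    sub_subset_cl_self T C₁ (mem_sub_conj (List.mem_map.2 ⟨i, List.mem_range.2 hi, rfl⟩))
  obtain ⟨s, hs⟩ := exists_fresh_role T C₁ hA.1
  have hfresh : ∀ R, RoleOccurs T C₁ R → ∀ r ≥ s, R ≠ .name r ∧ R ≠ .inv r := by
    refine fun R hR r hr => ⟨?_, ?_⟩
    · rintro rfl; exact (hs r hr).1 hR
    · rintro rfl; exact (hs r hr).1 hR.inverse
  let A' : Set (Assertion ℕ) := {t | Combined A k s a B w t}
  have hA' : IsABox A' := ⟨combined_finite hA.1 hBfin, _, Combined.top 0 hk⟩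
  have hAf : RespectsFunc T A := respectsFunc_of_model (hI 0) (hIA 0)
  have hBf : ∀ j, RespectsFunc T (B j) := fun j R x y z hf hy hz =>
    hginj j hy.ind_right hz.ind_right (hJ j _ hf _ _ _
      (Interp.rel_of_satUnder (hBsat j) hy) (Interp.rel_of_satUnder (hBsat j) hz))
  have hA'f : RespectsFunc T A' := combined_respectsFunc hAf hBf fun r hr =>
    ⟨(hs r hr).2.1, (hs r hr).2.2.1⟩
  let U : Interp ℕ := Interp.sigma (Sum.elim I J)
  have hU : U.IsModel T := Interp.sigma_isModel _ (by rintro (i | i) <;> [exact hI i; exact hJ i])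
  -- Paths ending in the copy of `A` are labelled in the countermodel `I i` of the branch through
  -- which they entered, paths ending in `B j` in `J j`. Other paths get arbitrary labels, as their
  -- edges use only fresh roles. If no middle individual was visited before the end, index `0` is
  -- used; any model of `A` would do.
  have hpt : ∀ α : Path ℕ, ∃ x : U.Dom,
      (∀ y, α.tail = Nat.pair 0 y → x = ⟨.inl (lastMid α), nm (lastMid α) y⟩) ∧
      (∀ j y, α.tail = Nat.pair (3 + j) y → x = ⟨.inr j, g j y⟩) := by
    intro α
    by_cases h₀ : ∃ y, α.tail = Nat.pair 0 y
    · obtain ⟨y, hy⟩ := h₀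
      refine ⟨⟨.inl (lastMid α), nm (lastMid α) y⟩, fun y' hy' => ?_, fun j y' hy' => ?_⟩
      · rw [hy] at hy'
        rw [(Nat.pair_eq_pair.1 hy').2]
      · rw [hy] at hy'
        have := (Nat.pair_eq_pair.1 hy').1
        omega
    · by_cases h₁ : ∃ j y, α.tail = Nat.pair (3 + j) y
      · obtain ⟨j, y, hy⟩ := h₁
        refine ⟨⟨.inr j, g j y⟩, fun y' hy' => (h₀ ⟨y', hy'⟩).elim, fun j' y' hy' => ?_⟩
        rw [hy] at hy'
        obtain ⟨hj, rfl⟩ := Nat.pair_eq_pair.1 hy'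
        obtain rfl : j = j' := by omega
        rfl
      · obtain ⟨x⟩ := U.nonempty
        exact ⟨x, fun y hy => (h₀ ⟨y, hy⟩).elim, fun j y hy => (h₁ ⟨j, y, hy⟩).elim⟩
  choose pt hpt₀ hpt₁ using hpt
  have hedge : ∀ α R b, RoleOccurs T C₁ R → RoleMem A' R α.tail b →
      U.rel R (pt α) (pt (α.snoc R b)) := by
    intro α R b hR h
    rcases combined_roleMem (hfresh R hR) h with ⟨x, y, hx, hy, h⟩ | ⟨j, x, y, hx, hy, h⟩
    -- A step inside the copy of `A` does not start at a middle individual, so the countermodel in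
    -- use does not change.
    · have hm : lastMid (α.snoc R b) = lastMid α := by
        rw [lastMid, hx, Nat.unpair_pair, if_neg (by simp)]
      rw [hpt₀ α x hx, hpt₀ (α.snoc R b) y hy, hm]
      exact (Interp.sigma_rel_mk _).2 ⟨_, Interp.rel_of_satUnder (hIsat _) h, rfl⟩
    · rw [hpt₁ α j x hx, hpt₁ (α.snoc R b) j y hy]
      exact (Interp.sigma_rel_mk (Sum.elim I J) (i := .inr j)).2
        ⟨_, Interp.rel_of_satUnder (hBsat j) h, rfl⟩
  have htop : Nat.pair 1 0 ∈ Ind A' := ⟨_, Combined.top 0 hk, Or.inl rfl⟩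
  let F : Blueprint T C₁ (Path ℕ) :=
    { base := unravel A'
      U := U
      pt := pt
      relabel := fun d _ e => (d, e)
      isModel := hU
      base_nonempty := let ⟨s, hs, _⟩ := single_mem_ind_unravel htop; ⟨s, hs⟩
      concept_mem := by
        intro X α h _
        obtain ⟨-, hm⟩ := concept_mem_unravel.1 h
        rcases combined_concept hm with ⟨y, hy, h⟩ | ⟨j, y, hy, h⟩
        · rw [hpt₀ α y hy]
          exact hIsat _ _ h
        · rw [hpt₁ α j y hy]
          exact hBsat j _ h
      edge := by
        intro R α β h hR
        rcases roleMem_unravel.1 h with ⟨b, rfl, hb⟩ | ⟨b, rfl, hb⟩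
        · exact Blueprint.typeEdge_of_rel hU (hedge _ _ _ hR hb.2.1)
        · simpa using (Blueprint.typeEdge_of_rel (C₀ := C₁) hU
            (hedge _ _ _ hR.inverse hb.2.1)).symm
      func := hA'f.unravel
      relabel_rel := fun _ _ _ h => h
      relabel_fst := fun _ _ _ _ => rfl
      relabel_snd := fun _ _ _ _ => rfl }
  -- Fresh roles create no children, so the query can only be matched along edges of the unraveling.
  have hbase : ∀ r ≥ s, ∀ x y : F.forest.Dom, F.forest.rel (.name r) x y →
      ∃ α β, x.1 = .root α ∧ y.1 = .root β ∧ RoleMem (unravel A') (.name r) α β := by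
    intro r hr x y h
    have hocc := (hs r hr).1
    rcases F.forest_rel.1 h with h | ⟨e, h⟩ | ⟨e, h⟩
    · exact h
    · have := y.2
      rw [h] at this
      exact (hocc this.2.1).elim
    · have := x.2
      rw [h] at this
      exact (hocc (roleOccurs_inverse.1 this.2.1)).elim
  have hQ : (conj ((List.range k).map fun i => .ex (.name (s + 1 + i)) (C i))).IsELI :=
    isELI_conj fun D hD => by
      obtain ⟨i, -, rfl⟩ := List.mem_map.1 hD
      exact hC i
  -- The query is certain for the combined ABox, so tolerance forces a match in the forest over its
  -- unraveling. The rest of the proof follows the match: it passes through some middle individual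
  -- `i` and, for conjunct `i`, on to the copy of `a i`.
  obtain ⟨x, hx, y, hxy, hyC⟩ := hT A' hA' (.ex (.name s) _) hQ _ htop (combined_certain (s := s) hBC hcert) F.forest F.forest_isModel
    F.forest_isModelABox
  have hx := F.forest_name.1 hx
  obtain ⟨α, β, hα, hβ, h⟩ := hbase s le_rfl x y hxy
  rw [hx] at hα
  cases hα
  rcases roleMem_unravel.1 h with ⟨b, rfl, hb⟩ | ⟨b, hb, -⟩
  swap
  · cases hb
  obtain ⟨i, hi, rfl⟩ : ∃ i, i < k ∧ b = Nat.pair 2 i := by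
    have hb : Combined A k s a B w (.role s (Nat.pair 1 0) b) := hb.2.1
    rcases combined_role hb with ⟨x', y', h₁, -⟩ | ⟨j, x', y', h₁, -⟩ | ⟨-, -, h⟩ |
      ⟨i, h₁, -⟩ | ⟨i, j, -, h₁, -⟩
    · have := (Nat.pair_eq_pair.1 h₁).1
      omega
    · have := (Nat.pair_eq_pair.1 h₁).1
      omega
    · exact h
    · omega
    · omega
  obtain ⟨z, hyz, hzC⟩ := (ext_conj _ _ y).1 hyC _ (List.mem_map.2 ⟨i, List.mem_range.2 hi, rfl⟩)
  obtain ⟨β, γ, hβ', hγ, h'⟩ := hbase (s + 1 + i)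
    (Nat.le_add_right_of_le (Nat.le_succ s)) y z hyz
  rw [hβ] at hβ'
  cases hβ'
  rcases roleMem_unravel.1 h' with ⟨c, rfl, hc⟩ | ⟨c, hc, -⟩
  swap
  · cases hc
  obtain rfl : c = Nat.pair 0 (a i) := by
    have hc : Combined A k s a B w (.role (s + 1 + i) (Nat.pair 2 i) c) := hc.2.1
    rcases combined_role hc with ⟨x', y', h₁, -⟩ | ⟨j, x', y', h₁, -⟩ | ⟨h₁, -⟩ |
      ⟨i', h₁, -, h₂⟩ | ⟨i', j, hij, h₁, h₂⟩
    · have := (Nat.pair_eq_pair.1 h₁).1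
      omega
    · have := (Nat.pair_eq_pair.1 h₁).1
      omega
    · omega
    · obtain rfl : i = i' := by omega
      exact h₂
    · have := (Nat.pair_eq_pair.1 h₂).2
      omega
  -- The copy of `A` entered through branch `i` is labelled by `I i`, where `C i` fails at `a i`.
  have hz := (F.forest_ext (hcl i hi) z).1 hzC
  rw [hγ] at hz
  change pt _ ∈ U.ext (C i) at hz
  rw [hpt₀ _ (a i) rfl, lastMid, Path.tail, Nat.unpair_pair, if_pos rfl] at hz
  have hz := (Interp.sigma_ext (Sum.elim I J) _ (.inl i) _).1 hz
  exact hIC i _ (hnm i _ (ha i)) hz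

/-- There is a model that satisfies only certain `ELI`-concepts from a finite set at the
individual names. -/
theorem exists_minimal_model {T : TBox} (hT : UnravelingTolerant T) {A : Set (Assertion IndName)}
    (hA : IsABox A) (hcon : ∃ I : Interp IndName, I.IsModel T ∧ I.IsModelABox A)
    {S : Set Concept} (hS : S.Finite) (hELI : ∀ C ∈ S, C.IsELI) :
    ∃ I : Interp IndName, I.IsModel T ∧ I.IsModelABox A ∧ ∀ b ∈ Ind A, ∀ C ∈ S, ∀ d,
      I.name b = some d → d ∈ I.ext C → CertainConcept T A C b := by
  -- Concepts without a model are left out: they hold nowhere, but `exists_countermodel` needs a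
  -- witness for each concept.
  let F : Set (IndName × Concept) := {p | p.1 ∈ Ind A ∧ p.2 ∈ S ∧
    ¬ CertainConcept T A p.2 p.1 ∧ ∃ (J : Interp ℕ) (d : J.Dom), J.IsModel T ∧ d ∈ J.ext p.2}
  have hF : F.Finite := ((ind_finite hA.1).prod hS).subset fun p hp => ⟨hp.1, hp.2.1⟩
  rcases F.eq_empty_or_nonempty with hemp | hne
  · obtain ⟨I, hI, hIA⟩ := hcon
    refine ⟨I, hI, hIA, fun b hb C hC d hd hdC => ?_⟩
    by_contra h
    have : (b, C) ∈ F := ⟨hb, hC, h, I, d, hI, hdC⟩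
    rw [hemp] at this
    exact this
  · obtain ⟨p₀, hp₀⟩ := hne
    obtain ⟨l, hl⟩ : ∃ l : List (IndName × Concept), ∀ p, p ∈ l ↔ p ∈ F :=
      ⟨hF.toFinset.toList, fun p => by simp⟩
    -- The default `p₀` extends the list to a family over all of `ℕ` within `F`.
    have hget : ∀ i, l.getD i p₀ ∈ F := by
      intro i
      by_cases hi : i < l.length
      · rw [List.getD_eq_getElem _ _ hi]
        exact (hl _).1 (List.getElem_mem hi)
      · rw [List.getD_eq_default _ _ (by omega)]
        exact hp₀
    obtain ⟨I, hI, hIA, h⟩ := exists_countermodel hT hA (k := l.length)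
      (List.length_pos_of_mem ((hl p₀).2 hp₀)) (fun i => (l.getD i p₀).1)
      (fun i => (l.getD i p₀).2) (fun i => hELI _ (hget i).2.1) (fun i => (hget i).1)
      (fun i => (hget i).2.2.2) (fun i => (hget i).2.2.1)
    refine ⟨I, hI, hIA, fun b hb C hC d hd hdC => ?_⟩
    by_contra hcert
    have hm : (b, C) ∈ l := (hl _).2 ⟨hb, hC, hcert, I, d, hI, hdC⟩
    obtain ⟨i, hi, hget⟩ := List.getElem_of_mem hm
    refine h i hi d ?_ ?_
    · rw [List.getD_eq_getElem _ _ hi, hget]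
      exact hd
    · rw [List.getD_eq_getElem _ _ hi, hget]
      exact hdC

end DL
-- Characteristic concepts, shallow relabelling, and the rules for a query.
namespace DL

/-! ### Characteristic concepts -/

/-- The roles over a list of role names. -/
def rolesOver (Rn : List RoleName) : List Role := Rn.map .name ++ Rn.map .inv

theorem name_mem_rolesOver {Rn : List RoleName} {r : RoleName} (h : r ∈ Rn) :
    Role.name r ∈ rolesOver Rn := List.mem_append_left _ (List.mem_map_of_mem h)

theorem inv_mem_rolesOver {Rn : List RoleName} {r : RoleName} (h : r ∈ Rn) :
    Role.inv r ∈ rolesOver Rn := List.mem_append_right _ (List.mem_map_of_mem h)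

/-- The conjuncts of the `ELI`-concepts of depth `k` over a signature. -/
def conjuncts (An : List ConceptName) (Rn : List RoleName) : ℕ → List Concept
  | 0 => An.map .atom
  | k + 1 => An.map .atom ++ (rolesOver Rn).flatMap fun R =>
      (conjuncts An Rn k).sublists.map fun l => .ex R (conj l)

theorem isELI_of_mem_conjuncts {An : List ConceptName} {Rn : List RoleName} {k : ℕ} {C : Concept}
    (h : C ∈ conjuncts An Rn k) : C.IsELI := by
  induction k generalizing C with
  | zero =>
    obtain ⟨A, -, rfl⟩ := List.mem_map.1 h
    trivial
  | succ k ih =>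
    rcases List.mem_append.1 h with h | h
    · obtain ⟨A, -, rfl⟩ := List.mem_map.1 h
      trivial
    · obtain ⟨R, -, h⟩ := List.mem_flatMap.1 h
      obtain ⟨l, hl, rfl⟩ := List.mem_map.1 h
      exact isELI_conj fun D hD => ih ((List.mem_sublists.1 hl).subset hD)

open Classical in
/-- The `ELI`-concept of depth `k` that describes an element. -/
noncomputable def charConcept {N : Type} (An : List ConceptName) (Rn : List RoleName) (k : ℕ)
    (I : Interp N) (d : I.Dom) : Concept :=
  conj ((conjuncts An Rn k).filter fun C => d ∈ I.ext C)

/-- All `ELI`-concepts of depth `k` over a signature, up to equivalence. -/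
def charConcepts (An : List ConceptName) (Rn : List RoleName) (k : ℕ) : List Concept :=
  (conjuncts An Rn k).sublists.map conj

section charConcept

variable {N N' : Type} {An : List ConceptName} {Rn : List RoleName} {k : ℕ} {I : Interp N}
  {J : Interp N'} {d : I.Dom}

theorem charConcept_mem : charConcept An Rn k I d ∈ charConcepts An Rn k :=
  List.mem_map_of_mem (List.mem_sublists.2 List.filter_sublist)

theorem isELI_of_mem_charConcepts {C : Concept} (h : C ∈ charConcepts An Rn k) : C.IsELI := by
  obtain ⟨l, hl, rfl⟩ := List.mem_map.1 h
  exact isELI_conj fun D hD => isELI_of_mem_conjuncts ((List.mem_sublists.1 hl).subset hD)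

theorem mem_ext_charConcept : d ∈ I.ext (charConcept An Rn k I d) :=
  (ext_conj I _ d).2 fun C hC => by simpa using (List.mem_filter.1 hC).2

open Classical in
theorem conceptExt_of_charConcept {e : J.Dom} (he : e ∈ J.ext (charConcept An Rn k I d))
    {A : ConceptName} (hA : A ∈ An) (hd : d ∈ I.conceptExt A) : e ∈ J.conceptExt A := by
  refine (ext_conj J _ e).1 he (.atom A) (List.mem_filter.2 ⟨?_, decide_eq_true (p := d ∈ I.ext (.atom A)) hd⟩)
  cases k with
  | zero => exact List.mem_map_of_mem hA
  | succ k => exact List.mem_append_left _ (List.mem_map_of_mem hA)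

-- The concept of depth `k` of the successor, under an existential restriction, is itself a conjunct
-- of the concept of depth `k + 1`. Each step along an edge thus costs one level of depth.
open Classical in
theorem rel_of_charConcept {e : J.Dom} (he : e ∈ J.ext (charConcept An Rn (k + 1) I d))
    {R : Role} (hR : R ∈ rolesOver Rn) {d' : I.Dom} (hd : I.rel R d d') :
    ∃ e', J.rel R e e' ∧ e' ∈ J.ext (charConcept An Rn k I d') := by
  refine (ext_conj J _ e).1 he (.ex R (charConcept An Rn k I d')) (List.mem_filter.2 ⟨?_, ?_⟩)
  · exact List.mem_append_right _ (List.mem_flatMap.2 ⟨R, hR,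
      List.mem_map.2 ⟨_, List.mem_sublists.2 List.filter_sublist, rfl⟩⟩)
  · exact decide_eq_true (p := d ∈ I.ext (.ex R _)) ⟨d', hd, mem_ext_charConcept⟩

end charConcept

/-- Concepts from `l` prefixed with at most `j` existential restrictions. -/
def reachConcepts (occ : List Role) (l : List Concept) : ℕ → List Concept
  | 0 => l
  | j + 1 => reachConcepts occ l j ++
      occ.flatMap fun R => (reachConcepts occ l j).map fun C => .ex R C

theorem reachConcepts_mono {occ : List Role} {l : List Concept} {i j : ℕ} (h : i ≤ j)
    {C : Concept} (hC : C ∈ reachConcepts occ l i) : C ∈ reachConcepts occ l j := by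
  induction h with
  | refl => exact hC
  | step _ ih => exact List.mem_append_left _ ih

theorem isELI_of_mem_reachConcepts {occ : List Role} {l : List Concept} (hl : ∀ C ∈ l, C.IsELI)
    {j : ℕ} {C : Concept} (hC : C ∈ reachConcepts occ l j) : C.IsELI := by
  induction j generalizing C with
  | zero => exact hl C hC
  | succ j ih =>
    rcases List.mem_append.1 hC with h | h
    · exact ih h
    · obtain ⟨R, -, h⟩ := List.mem_flatMap.1 h
      obtain ⟨D, hD, rfl⟩ := List.mem_map.1 h
      exact ih (C := D) hD

/-- The elements that are reached from `X` in `j` steps along roles from `occ`. -/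
def Interp.reachFrom {N : Type} (I : Interp N) (occ : List Role) (X : Set I.Dom) : ℕ → Set I.Dom
  | 0 => X
  | j + 1 => {e | ∃ d ∈ I.reachFrom occ X j, ∃ R ∈ occ, I.rel R d e}

/-- Prefix `C` with the roles on the way from `X` to the element. The last clause forgets where `C`
is realized: anonymous parts of a match only need some realization. -/
theorem Interp.exists_reachConcept {N : Type} {I : Interp N} {occ : List Role} {X : Set I.Dom}
    {l : List Concept} {i j : ℕ} {e : I.Dom} (he : e ∈ I.reachFrom occ X j) {C : Concept}
    (hC : C ∈ reachConcepts occ l i) (heC : e ∈ I.ext C) :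
    ∃ x ∈ X, ∃ D ∈ reachConcepts occ l (i + j), x ∈ I.ext D ∧
      ∀ (V : Interp ℕ) (y : V.Dom), y ∈ V.ext D → ∃ y', y' ∈ V.ext C := by
  induction j generalizing i e C with
  | zero => exact ⟨e, he, C, hC, heC, fun V y hy => ⟨y, hy⟩⟩
  | succ j ih =>
    obtain ⟨d, hd, R, hR, hde⟩ := he
    obtain ⟨x, hx, D, hD, hxD, h⟩ := ih (i := i + 1) (C := .ex R C) hd
      (List.mem_append_right _ (List.mem_flatMap.2 ⟨R, hR, List.mem_map_of_mem hC⟩))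
      ⟨e, hde, heC⟩
    refine ⟨x, hx, D, by rwa [show i + (j + 1) = i + 1 + j by omega], hxD, fun V y hy => ?_⟩
    obtain ⟨y', z, -, hz⟩ := h V y hy
    exact ⟨z, hz⟩

/-! ### Shallow forest models -/

section shallow

variable {T : TBox} {C₁ : Concept}

/-- Replace edges by edges with the same types that are closest to `X`. All elements that are
copied when the edges are followed from `X` are then at a bounded distance from `X`. -/
theorem exists_shallow_relabel {I : Interp ℕ} {occ : List Role} (X : Set I.Dom) {N : ℕ}
    (hI : I.IsModel T) (hocc : ∀ R, R ∈ occ ↔ RoleOccurs T C₁ R)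
    (hN : (types T C₁ ×ˢ {R | RoleOccurs T C₁ R} ×ˢ types T C₁).ncard ≤ N) :
    ∃ f : I.Dom → Role → I.Dom → I.Dom × I.Dom, ∃ k₀ ≤ N,
      (∀ d R e, I.rel R d e → I.rel R (f d R e).1 (f d R e).2 ∧
        I.typeOf T C₁ (f d R e).1 = I.typeOf T C₁ d ∧
        I.typeOf T C₁ (f d R e).2 = I.typeOf T C₁ e) ∧
      ∀ d R e, R ∈ occ → I.rel R d e → (∃ j ≤ k₀, d ∈ I.reachFrom occ X j) →
        ∃ j ≤ k₀, (f d R e).2 ∈ I.reachFrom occ X j := by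
  classical
  let Rz : Set Concept × Role × Set Concept → ℕ → Prop := fun s j =>
    ∃ d ∈ I.reachFrom occ X j, ∃ e, I.rel s.2.1 d e ∧ s.2.1 ∈ occ ∧ I.typeOf T C₁ d = s.1 ∧
      I.typeOf T C₁ e = s.2.2
  -- The rank of an edge type is the least distance from `X` at which the source of such an edge is
  -- found.
  let rk : Set Concept × Role × Set Concept → ℕ := fun s => sInf {j | Rz s j}
  have hrk : ∀ s j, Rz s j → Rz s (rk s) ∧ rk s ≤ j := fun s j h =>
    ⟨Nat.sInf_mem (s := {j | Rz s j}) ⟨j, h⟩, Nat.sInf_le h⟩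
  have hfin : (types T C₁ ×ˢ {R | RoleOccurs T C₁ R} ×ˢ types T C₁).Finite :=
    (types_finite T C₁).prod ((roleOccurs_finite T C₁).prod (types_finite T C₁))
  -- Pigeonhole: at most `N` edge types have at most `N` ranks, so one of the `N + 1` numbers up to
  -- `N` is not a rank.
  obtain ⟨k₀, hk₀, hgap⟩ : ∃ k₀ ≤ N, ∀ s, (∃ j, Rz s j) → rk s ≠ k₀ := by
    by_contra hcon
    push Not at hcon
    have : Nonempty (Set Concept × Role × Set Concept) := ⟨(∅, .name 0, ∅)⟩
    choose! s hs using hcon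
    have hsub : (Finset.range (N + 1) : Set ℕ) ⊆
        rk '' (types T C₁ ×ˢ {R | RoleOccurs T C₁ R} ×ˢ types T C₁) := by
      intro k hk
      obtain ⟨⟨j, d, -, e, -, hR, h₁, h₂⟩, hk'⟩ := hs k (by simpa [Nat.lt_succ_iff] using hk)
      refine ⟨s k, ⟨?_, (hocc _).1 hR, ?_⟩, hk'⟩
      · rw [← h₁]; exact ⟨I, d, hI, rfl⟩
      · rw [← h₂]; exact ⟨I, e, hI, rfl⟩
    have := Set.ncard_le_ncard hsub (hfin.image _)
    have := Set.ncard_image_le (f := rk) hfin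
    rw [Set.ncard_coe_finset, Finset.card_range] at *
    omega
  have hf : ∀ d R e, ∃ p : I.Dom × I.Dom, I.rel R d e → I.rel R p.1 p.2 ∧
      I.typeOf T C₁ p.1 = I.typeOf T C₁ d ∧ I.typeOf T C₁ p.2 = I.typeOf T C₁ e ∧
      ((∃ j, Rz (I.typeOf T C₁ d, R, I.typeOf T C₁ e) j) →
        p.1 ∈ I.reachFrom occ X (rk (I.typeOf T C₁ d, R, I.typeOf T C₁ e))) := by
    intro d R e
    by_cases h : ∃ j, Rz (I.typeOf T C₁ d, R, I.typeOf T C₁ e) j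
    · obtain ⟨j, hj⟩ := h
      obtain ⟨d', hd', e', hr, -, h₁, h₂⟩ := (hrk _ j hj).1
      exact ⟨(d', e'), fun _ => ⟨hr, h₁, h₂, fun _ => hd'⟩⟩
    · exact ⟨(d, e), fun hr => ⟨hr, rfl, rfl, fun h' => (h h').elim⟩⟩
  choose f hf using hf
  refine ⟨f, k₀, hk₀, fun d R e hr => ⟨(hf d R e hr).1, (hf d R e hr).2.1, (hf d R e hr).2.2.1⟩, ?_⟩
  rintro d R e hR hr ⟨j, hj, hd⟩
  have hz : Rz (I.typeOf T C₁ d, R, I.typeOf T C₁ e) j := ⟨d, hd, e, hr, hR, rfl, rfl⟩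
  have h₁ := (hrk _ j hz).2
  have h₂ := hgap _ ⟨j, hz⟩
  -- The rank is at most `j ≤ k₀` but not `k₀`, so the target of the replacing edge, one step beyond
  -- its source, is still within distance `k₀`.
  have h₃ : (f d R e).2 ∈ I.reachFrom occ X (rk (I.typeOf T C₁ d, R, I.typeOf T C₁ e) + 1) :=
    ⟨_, (hf d R e hr).2.2.2 ⟨j, hz⟩, R, hR, (hf d R e hr).1⟩
  exact ⟨_, by omega, h₃⟩

end shallow

/-! ### Positive existential formulas -/

namespace PEFormula

def conceptNames : PEFormula → List ConceptName
  | .top _ => []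
  | .concept A _ => [A]
  | .role _ _ _ => []
  | .and φ ψ => φ.conceptNames ++ ψ.conceptNames
  | .or φ ψ => φ.conceptNames ++ ψ.conceptNames
  | .ex _ φ => φ.conceptNames

def roleNames : PEFormula → List RoleName
  | .top _ => []
  | .concept _ _ => []
  | .role r _ _ => [r]
  | .and φ ψ => φ.roleNames ++ ψ.roleNames
  | .or φ ψ => φ.roleNames ++ ψ.roleNames
  | .ex _ φ => φ.roleNames

/-- A bound on the number of elements that are used in a match of the formula. -/
def matchSize : PEFormula → ℕ
  | .top _ => 0
  | .concept _ _ => 1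
  | .role _ _ _ => 2
  | .and φ ψ => φ.matchSize + ψ.matchSize
  | .or φ ψ => φ.matchSize + ψ.matchSize
  | .ex _ φ => φ.matchSize

/-- `h` preserves the atoms over a signature that hold between elements of `W`. -/
def HomOn {N N' : Type} (I : Interp N) (J : Interp N') (An : List ConceptName)
    (Rn : List RoleName) (W : Finset I.Dom) (h : I.Dom → J.Dom) : Prop :=
  (∀ A ∈ An, ∀ x ∈ W, x ∈ I.conceptExt A → h x ∈ J.conceptExt A) ∧
  ∀ r ∈ Rn, ∀ x ∈ W, ∀ y ∈ W, I.roleExt r x y → J.roleExt r (h x) (h y)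

theorem HomOn.mono {N N' : Type} {I : Interp N} {J : Interp N'} {An An' : List ConceptName}
    {Rn Rn' : List RoleName} {W W' : Finset I.Dom} {h : I.Dom → J.Dom}
    (hh : HomOn I J An Rn W h) (hA : An' ⊆ An) (hR : Rn' ⊆ Rn) (hW : W' ⊆ W) :
    HomOn I J An' Rn' W' h :=
  ⟨fun A hA' x hx => hh.1 A (hA hA') x (hW hx),
    fun r hr x hx y hy => hh.2 r (hR hr) x (hW hx) y (hW hy)⟩

open Classical in
/-- A formula that is true is true because of few elements. -/
theorem exists_support {N : Type} (φ : PEFormula) (I : Interp N) {π : Var → I.Dom}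
    (hφ : φ.Sat I π) : ∃ W : Finset I.Dom, W.card ≤ φ.matchSize ∧
      ∀ (J : Interp ℕ) (h : I.Dom → J.Dom), HomOn I J φ.conceptNames φ.roleNames W h →
        φ.Sat J (h ∘ π) := by
  induction φ generalizing π with
  | top x => exact ⟨∅, le_rfl, fun J h _ => trivial⟩
  | concept A x =>
    exact ⟨{π x}, by simp [matchSize], fun J h hh =>
      hh.1 A (by simp [conceptNames]) (π x) (by simp) hφ⟩
  | role r x y =>
    exact ⟨{π x, π y}, Finset.card_le_two, fun J h hh =>
      hh.2 r (by simp [roleNames]) (π x) (by simp) (π y) (by simp) hφ⟩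
  | and φ ψ ihφ ihψ =>
    obtain ⟨W₁, hW₁, h₁⟩ := ihφ hφ.1
    obtain ⟨W₂, hW₂, h₂⟩ := ihψ hφ.2
    refine ⟨W₁ ∪ W₂, (Finset.card_union_le _ _).trans (add_le_add hW₁ hW₂), fun J h hh =>
      ⟨h₁ J h (hh.mono (List.subset_append_left _ _) (List.subset_append_left _ _)
        Finset.subset_union_left),
      h₂ J h (hh.mono (List.subset_append_right _ _) (List.subset_append_right _ _)
        Finset.subset_union_right)⟩⟩
  | or φ ψ ihφ ihψ =>
    rcases hφ with hφ | hψ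
    · obtain ⟨W, hW, h⟩ := ihφ hφ
      exact ⟨W, hW.trans (Nat.le_add_right _ _), fun J g hh => Or.inl (h J g (hh.mono
        (List.subset_append_left _ _) (List.subset_append_left _ _) subset_rfl))⟩
    · obtain ⟨W, hW, h⟩ := ihψ hψ
      exact ⟨W, hW.trans (Nat.le_add_left _ _), fun J g hh => Or.inr (h J g (hh.mono
        (List.subset_append_right _ _) (List.subset_append_right _ _) subset_rfl))⟩
  | ex x φ ih =>
    obtain ⟨d, hd⟩ := hφ
    obtain ⟨W, hW, h⟩ := ih hd
    refine ⟨W, hW, fun J g hh => ⟨g d, ?_⟩⟩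
    rw [← Function.comp_update]
    exact h J g hh

end PEFormula

/-! ### The program for a positive existential query -/

/-- The role atoms and inequalities over the first `K` variables. -/
def coreAtoms {ι : Type} {arity : ι → ℕ} (K : ℕ) (Rn : List RoleName) : List (BodyAtom arity) :=
  (Rn.flatMap fun r => (List.range K).flatMap fun x => (List.range K).map fun y => .role r x y) ++
    (List.range K).flatMap fun x => (List.range K).map fun y => .neq x y

theorem role_mem_coreAtoms {ι : Type} {arity : ι → ℕ} {K : ℕ} {Rn : List RoleName} {r : RoleName}
    {x y : Var} (hr : r ∈ Rn) (hx : x < K) (hy : y < K) :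
    (.role r x y : BodyAtom arity) ∈ coreAtoms K Rn :=
  List.mem_append_left _ (List.mem_flatMap.2 ⟨r, hr, List.mem_flatMap.2 ⟨x, List.mem_range.2 hx,
    List.mem_map_of_mem (List.mem_range.2 hy)⟩⟩)

theorem neq_mem_coreAtoms {ι : Type} {arity : ι → ℕ} {K : ℕ} {Rn : List RoleName}
    {x y : Var} (hx : x < K) (hy : y < K) :
    (.neq x y : BodyAtom arity) ∈ coreAtoms K Rn :=
  List.mem_append_right _ (List.mem_flatMap.2 ⟨x, List.mem_range.2 hx,
    List.mem_map_of_mem (List.mem_range.2 hy)⟩)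

theorem lt_of_mem_coreAtoms {ι : Type} {arity : ι → ℕ} {K : ℕ} {Rn : List RoleName}
    {c : BodyAtom arity} (hc : c ∈ coreAtoms K Rn) {x : Var} (hx : x ∈ c.vars) : x < K := by
  rcases List.mem_append.1 hc with h | h
  · obtain ⟨r, -, h⟩ := List.mem_flatMap.1 h
    obtain ⟨y, hy, h⟩ := List.mem_flatMap.1 h
    obtain ⟨z, hz, rfl⟩ := List.mem_map.1 h
    rcases hx with rfl | rfl
    · exact List.mem_range.1 hy
    · exact List.mem_range.1 hz
  · obtain ⟨y, hy, h⟩ := List.mem_flatMap.1 h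
    obtain ⟨z, hz, rfl⟩ := List.mem_map.1 h
    rcases hx with rfl | rfl
    · exact List.mem_range.1 hy
    · exact List.mem_range.1 hz

/-- The truth of role atoms and inequalities in an interpretation. -/
def BodyAtom.CoreHolds {ι : Type} {arity : ι → ℕ} (V : Interp ℕ) (σ : Var → V.Dom) :
    BodyAtom arity → Prop
  | .role r x y => V.roleExt r (σ x) (σ y)
  | .neq x y => σ x ≠ σ y
  | _ => True

/-- In all models of `T`, the answer `ρ` to `q` follows from some role atoms and inequalities
and from the possible types of the values of the variables. -/
def ImpliesQuery {n : ℕ} (T : TBox) (C₀ : Concept) (q : PEQ n) (K : ℕ)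
    (L : List (BodyAtom (ι := Set (Set Concept)) (fun _ => 1)))
    (S : Fin K → Set (Set Concept)) (ρ : Fin n → Fin K) : Prop :=
  ∀ (V : Interp ℕ) (σ : Var → V.Dom), V.IsModel T → (∀ c ∈ L, c.CoreHolds V σ) →
    (∀ v, V.typeOf T C₀ (σ v) ∈ S v) →
    ∃ π : Var → V.Dom, (∀ i, π (q.ans i) = σ (ρ i)) ∧ q.formula.Sat V π

/-- The rule with goal `ρ` for a core and sets of types. -/
def queryRule {n K : ℕ} (L : List (BodyAtom (ι := Set (Set Concept)) (fun _ => 1)))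
    (S : Fin K → Set (Set Concept)) (ρ : Fin n → Fin K) :
    DatalogRule (ι := Set (Set Concept)) (fun _ => 1) n :=
  ⟨.goal fun i => ρ i, L ++ List.ofFn fun v => typeAtom (S v) v⟩

/-- Every semantically sound rule of bounded shape is included, so soundness is built in; finiteness
comes from the bounds on variables, role names and sets of types. Concept atoms are not needed in
the core since the types account for them. -/
inductive IsQueryProgramRule {n : ℕ} (T : TBox) (C₀ : Concept) (q : PEQ n) (K : ℕ)
    (Rn : List RoleName) : DatalogRule (ι := Set (Set Concept)) (fun _ => 1) n → Prop
  | type (ρ) : IsTypeRule T C₀ n ρ → IsQueryProgramRule T C₀ q K Rn ρ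
  | query (L) (S : Fin K → Set (Set Concept)) (ρ : Fin n → Fin K) :
      L ∈ (coreAtoms K Rn).sublists → (∀ v, S v ⊆ types T C₀) →
      ImpliesQuery T C₀ q K L S ρ → IsQueryProgramRule T C₀ q K Rn (queryRule L S ρ)

/-- The program for a positive existential query. -/
def queryProgram {n : ℕ} (T : TBox) (C₀ : Concept) (q : PEQ n) (K : ℕ) (Rn : List RoleName) :
    DatalogProgram n :=
  typeProgram {ρ | IsQueryProgramRule T C₀ q K Rn ρ}

section queryProgram

variable {n : ℕ} {T : TBox} {C₀ : Concept} {q : PEQ n} {K : ℕ} {Rn : List RoleName}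

theorem queryProgram_isProgram (hK : 0 < K) : (queryProgram T C₀ q K Rn).IsProgram := by
  constructor
  · have hS : {S : Fin K → Set (Set Concept) | ∀ v, S v ⊆ types T C₀}.Finite :=
      Set.Finite.pi' fun _ => (types_finite T C₀).finite_subsets
    refine ((isTypeRule_finite T C₀ n).union ((((List.finite_toSet
      (coreAtoms K Rn).sublists).prod (hS.prod (Set.finite_univ (α := Fin n → Fin K)))).image
      fun p => queryRule p.1 p.2.1 p.2.2))).subset ?_
    rintro ρ (⟨ρ, h⟩ | ⟨L, S, ρ, hL, hS, h⟩)
    · exact Or.inl h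
    · exact Or.inr ⟨(L, S, ρ), ⟨hL, hS, trivial⟩, rfl⟩
  · rintro ρ (⟨ρ, h⟩ | ⟨L, S, ρ, hL, hS, h⟩)
    · exact h.safe
    · have hv : ∀ v < K, ∃ b ∈ (queryRule L S ρ).body, b.IsRelational ∧ v ∈ b.vars := fun v hv =>
        ⟨typeAtom (S ⟨v, hv⟩) v, List.mem_append_right _ (List.mem_ofFn.2 ⟨⟨v, hv⟩, rfl⟩), trivial,
          (0 : Fin 1), rfl⟩
      refine ⟨?_, ?_, ?_⟩
      · obtain ⟨b, hb, h, -⟩ := hv 0 hK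
        exact ⟨b, hb, h⟩
      · rintro x ⟨i, rfl⟩
        exact hv _ (ρ i).2
      · intro c hc x hx
        rcases List.mem_append.1 hc with hc | hc
        · exact hv x (lt_of_mem_coreAtoms ((List.mem_sublists.1 hL).subset hc) hx)
        · obtain ⟨v, rfl⟩ := List.mem_ofFn.1 hc
          obtain ⟨-, rfl⟩ := hx
          exact hv _ v.2

/-- The elements named by the values of the variables satisfy the core in any model. Inequalities
survive because names are injective. -/
theorem queryProgram_sound {A : Set (Assertion IndName)} {a : Fin n → IndName}
    (h : (queryProgram T C₀ q K Rn).Returns A a) : CertainPEQ T A q a := by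
  intro I hI hA
  refine h (modelFacts T C₀ I {a | I.Answers q a}) ?_
  rintro ρ (⟨ρ, h⟩ | ⟨L, S, ρ, hL, hS, h⟩) σ hσ hb
  · exact h.sound hI hA hb
  · choose g hg using fun x => hA.exists_name (hσ x)
    obtain ⟨π, hπ, hsat⟩ := h I g hI (fun c hc => by
      have := hb c (List.mem_append_left _ hc)
      cases c with
      | role r x y =>
        obtain ⟨d, e, hd, he, hr⟩ := hA _ this
        obtain rfl : g x = d := Option.some.inj ((hg x).symm.trans hd)
        obtain rfl : g y = e := Option.some.inj ((hg y).symm.trans he)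
        exact hr
      | neq x y =>
        intro hxy
        refine this (I.name_injective (hg x) ?_)
        rw [hxy]
        exact hg y
      | top x => trivial
      | concept A x => trivial
      | idb P args => trivial) (fun v => by
      obtain ⟨d, hd, ht⟩ : ∃ d, I.name (σ v) = some d ∧ I.typeOf T C₀ d ∈ S v :=
        hb (typeAtom (S v) v) (List.mem_append_right _ (List.mem_ofFn.2 ⟨v, rfl⟩))
      obtain rfl : g v = d := Option.some.inj ((hg v).symm.trans hd)
      exact ht)
    refine ⟨π, fun i => ?_, hsat⟩
    rw [hπ]
    exact hg _

open Classical in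
/-- The role atoms and inequalities that hold in an ABox. -/
noncomputable def coreOf (A : Set (Assertion IndName)) (K : ℕ) (Rn : List RoleName)
    (z : Var → IndName) : List (BodyAtom (ι := Set (Set Concept)) (fun _ => 1)) :=
  (coreAtoms K Rn).filter fun c => c.Holds (n := 0) A ∅ z

open Classical in
theorem queryProgram_derives {A : Set (Assertion IndName)}
    {M : Set (HeadAtom (queryProgram T C₀ q K Rn).arity n IndName)}
    (hM : (queryProgram T C₀ q K Rn).IsClosed A M) {S : IndName → Set (Set Concept)}
    (hS : TypeAssignment T C₀ A S) (hD : ∀ b ∈ Ind A, HeadAtom.idb (S b) (fun _ => b) ∈ M)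
    {z : Var → IndName} (hz : ∀ v, z v ∈ Ind A) {ρ : Fin n → Fin K}
    (h : ImpliesQuery T C₀ q K (coreOf A K Rn z) (fun v => S (z v)) ρ) :
    HeadAtom.goal (fun i => z (ρ i)) ∈ M := by
  refine hM _ (.query _ _ ρ (List.mem_sublists.2 List.filter_sublist)
    (fun v => hS.subset _) h) z hz ?_
  intro c hc
  rcases List.mem_append.1 hc with hc | hc
  · obtain ⟨hc, hh⟩ := List.mem_filter.1 hc
    have hh := of_decide_eq_true hh
    cases c with
    | idb P args => exact hh.elim
    | top x => exact hh
    | concept A x => exact hh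
    | role r x y => exact hh
    | neq x y => exact hh
  · obtain ⟨v, rfl⟩ := List.mem_ofFn.1 hc
    exact hD _ (hz v)

open Classical in
theorem role_mem_coreOf {A : Set (Assertion IndName)} {z : Var → IndName} {r : RoleName}
    {x y : Var} (hr : r ∈ Rn) (hx : x < K) (hy : y < K) (h : .role r (z x) (z y) ∈ A) :
    .role r x y ∈ coreOf A K Rn z :=
  List.mem_filter.2 ⟨role_mem_coreAtoms hr hx hy, decide_eq_true (p := BodyAtom.Holds A ∅ z (.role r x y)) h⟩

end queryProgram

/-- A sequence of individual names that starts with `a` and contains the elements of `l`. -/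
theorem exists_enumeration {n K : ℕ} {X : Set IndName} (hX : X.Nonempty) (a : Fin n → IndName)
    (ha : ∀ i, a i ∈ X) (l : List IndName) (hl : ∀ b ∈ l, b ∈ X) (hK : n + l.length ≤ K) :
    ∃ z : Var → IndName, (∀ v, z v ∈ X) ∧ (∀ i, ∃ v < K, z v = a i) ∧ ∀ b ∈ l, ∃ v < K, z v = b := by
  obtain ⟨x₀, hx₀⟩ := hX
  refine ⟨fun v => (List.ofFn a ++ l).getD v x₀, fun v => ?_, ?_⟩
  · change (List.ofFn a ++ l).getD v x₀ ∈ X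
    by_cases hv : v < (List.ofFn a ++ l).length
    · have := List.getElem_mem hv
      rw [List.getD_eq_getElem _ _ hv]
      rcases List.mem_append.1 this with h | h
      · obtain ⟨i, hi⟩ := List.mem_ofFn.1 h
        rw [← hi]
        exact ha i
      · exact hl _ h
    · rw [List.getD_eq_default _ _ (Nat.not_lt.1 hv)]
      exact hx₀
  · have key : ∀ b ∈ List.ofFn a ++ l, ∃ v < K, (List.ofFn a ++ l).getD v x₀ = b := by
      intro b hb
      obtain ⟨v, hv, rfl⟩ := List.getElem_of_mem hb
      refine ⟨v, ?_, List.getD_eq_getElem _ _ hv⟩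
      rw [List.length_append, List.length_ofFn] at hv
      omega
    exact ⟨fun i => key _ (List.mem_append_left _ (List.mem_ofFn.2 ⟨i, rfl⟩)),
      fun b hb => key b (List.mem_append_right _ hb)⟩

end DL
-- Completeness of the program for a positive existential query.
namespace DL

/-! ### Completeness of the program for a positive existential query -/

/-- The distance of a node from its root. -/
def Node.height {N D : Type} : Node N D → ℕ
  | .root _ => 0
  | .child x _ _ => x.height + 1

open Classical in
/-- The number of consecutive ancestors in `W` that are linked by roles from `Rs`. -/
noncomputable def Node.chain {N D : Type} (W : Finset (Node N D)) (Rs : List Role) : Node N D → ℕ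
  | .root _ => 0
  | .child x R _ => if x ∈ W ∧ R ∈ Rs then x.chain W Rs + 1 else 0

-- The ancestors counted by `chain` are distinct, as heights strictly decrease on the way to the
-- root.
open Classical in
theorem Node.exists_chain {N D : Type} (W : Finset (Node N D)) (Rs : List Role) (x : Node N D) :
    ∃ s ⊆ W, s.card = x.chain W Rs ∧ ∀ y ∈ s, y.height < x.height := by
  induction x with
  | root a => exact ⟨∅, by simp, rfl, by simp⟩
  | child x R e ih =>
    by_cases h : x ∈ W ∧ R ∈ Rs
    · obtain ⟨s, hs, hc, hlt⟩ := ih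
      have hx : x ∉ s := fun hx => (hlt x hx).false
      refine ⟨insert x s, Finset.insert_subset h.1 hs, ?_, fun y hy => ?_⟩
      · rw [Finset.card_insert_of_notMem hx, hc, Node.chain, if_pos h]
      · rcases Finset.mem_insert.1 hy with rfl | hy
        · exact Nat.lt_succ_self _
        · exact (hlt y hy).trans (Nat.lt_succ_self _)
    · exact ⟨∅, by simp, by rw [Node.chain, if_neg h]; rfl, by simp⟩

/-- The ancestors on the chain and the node itself are different elements of `W`. Depth `|W|`
therefore suffices for characteristic concepts. -/
theorem Node.chain_lt {N D : Type} {W : Finset (Node N D)} (Rs : List Role) {x : Node N D}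
    (hx : x ∈ W) : x.chain W Rs < W.card := by
  classical
  obtain ⟨s, hs, hc, hlt⟩ := x.exists_chain W Rs
  have hxs : x ∉ s := fun h => (hlt x h).false
  rw [← hc]
  exact Finset.card_lt_card ⟨hs, fun h => hxs (h hx)⟩

namespace Blueprint

variable {T : TBox} {C₀ : Concept} {N : Type} (B : Blueprint T C₀ N)

open Classical in
/-- The characteristic concept of a node of the forest. -/
noncomputable def nodeConcept (An : List ConceptName) (Rn : List RoleName) (k : ℕ)
    (x : Node N B.U.Dom) : Concept :=
  if hx : B.Valid x then charConcept An Rn k B.forest ⟨x, hx⟩ else .top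

theorem nodeConcept_eq {An : List ConceptName} {Rn : List RoleName} {k : ℕ}
    (x : B.forest.Dom) : B.nodeConcept An Rn k x.1 = charConcept An Rn k B.forest x :=
  dif_pos x.2

open Classical in
/-- A map from a forest to another interpretation that preserves a part `W` of the forest. -/
noncomputable def homFrom (An : List ConceptName) (Rn : List RoleName) (m : ℕ)
    (W : Finset (Node N B.U.Dom)) (V : Interp ℕ) (g : N → V.Dom) : Node N B.U.Dom → V.Dom
  | .root a => g a
  | .child x R e =>
    haveI := V.nonempty
    Classical.epsilon fun y =>
      (x ∈ W ∧ R ∈ rolesOver Rn → V.rel R (homFrom An Rn m W V g x) y) ∧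
      y ∈ V.ext (B.nodeConcept An Rn (m - Node.chain W (rolesOver Rn) (.child x R e))
        (.child x R e))

/-- The forest is mapped top down. A node whose parent lies in `W` and is linked by a query role
moves to a suitable successor of the parent's image and loses one level of depth; any other non-root
node starts afresh at an arbitrary realization of its concept of full depth `m`. -/
theorem homFrom_spec {An : List ConceptName} {Rn : List RoleName} {m : ℕ}
    {W : Finset (Node N B.U.Dom)} {V : Interp ℕ} {g : N → V.Dom} (hW : W.card ≤ m)
    (hroot : ∀ a, .root a ∈ W → g a ∈ V.ext (B.nodeConcept An Rn m (.root a)))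
    (hex : ∀ x ∈ W, ∃ y, y ∈ V.ext (B.nodeConcept An Rn m x)) (x : Node N B.U.Dom)
    (hx : x ∈ W) (hv : B.Valid x) :
    B.homFrom An Rn m W V g x ∈
      V.ext (B.nodeConcept An Rn (m - x.chain W (rolesOver Rn)) x) ∧
    ∀ y R e, x = .child y R e → y ∈ W → R ∈ rolesOver Rn →
      V.rel R (B.homFrom An Rn m W V g y) (B.homFrom An Rn m W V g x) := by
  induction x with
  | root a => exact ⟨hroot a hx, fun y R e h => by cases h⟩
  | child x R e ih =>
    have hne := V.nonempty
    have key : ∃ y, (x ∈ W ∧ R ∈ rolesOver Rn → V.rel R (B.homFrom An Rn m W V g x) y) ∧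
        y ∈ V.ext (B.nodeConcept An Rn (m - Node.chain W (rolesOver Rn) (.child x R e))
          (.child x R e)) := by
      by_cases h : x ∈ W ∧ R ∈ rolesOver Rn
      · have hc := Node.chain_lt (rolesOver Rn) hx
        -- The depth left at the parent is positive because the chain ending at the child is shorter
        -- than `m`; the truncated subtraction is exact.
        have hm : m - Node.chain W (rolesOver Rn) x =
            m - Node.chain W (rolesOver Rn) (.child x R e) + 1 := by
          rw [Node.chain, if_pos h] at hc ⊢
          omega
        have h₁ := (ih h.1 hv.1).1
        rw [hm, B.nodeConcept_eq ⟨x, hv.1⟩] at h₁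
        obtain ⟨y, hy, hyC⟩ := rel_of_charConcept h₁ h.2 (d' := ⟨.child x R e, hv⟩)
          (B.forest_rel.2 (Or.inr (Or.inl ⟨e, rfl⟩)))
        rw [← B.nodeConcept_eq ⟨.child x R e, hv⟩] at hyC
        exact ⟨y, fun _ => hy, hyC⟩
      · rw [Node.chain, if_neg h]
        obtain ⟨y, hy⟩ := hex _ hx
        exact ⟨y, fun h' => (h h').elim, hy⟩
    have hs := Classical.epsilon_spec key
    refine ⟨by rw [homFrom]; exact hs.2, fun y R' e' h hy hR => ?_⟩
    cases h
    rw [homFrom]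
    exact hs.1 ⟨hy, hR⟩

-- An edge of the forest within `W` is either an edge of the base, handled by `hbase`, or joins a
-- parent to a child, handled by `homFrom_spec` in both directions of the role.
open Classical in
theorem homOn_homFrom {An : List ConceptName} {Rn : List RoleName} {m : ℕ}
    {W : Finset B.forest.Dom} {V : Interp ℕ} {g : N → V.Dom} (hW : W.card ≤ m)
    (hroot : ∀ a (h : B.Valid (.root a)), ⟨.root a, h⟩ ∈ W →
      g a ∈ V.ext (charConcept An Rn m B.forest ⟨.root a, h⟩))
    (hex : ∀ x ∈ W, ∃ y, y ∈ V.ext (charConcept An Rn m B.forest x))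
    (hbase : ∀ r ∈ Rn, ∀ a b (ha : B.Valid (.root a)) (hb : B.Valid (.root b)),
      ⟨.root a, ha⟩ ∈ W → ⟨.root b, hb⟩ ∈ W → .role r a b ∈ B.base → V.roleExt r (g a) (g b)) :
    PEFormula.HomOn B.forest V An Rn W fun x => B.homFrom An Rn m (W.image fun x => x.1) V g x.1 := by
  have hmem : ∀ x : B.forest.Dom, x ∈ W → x.1 ∈ W.image fun x => x.1 := fun x hx =>
    Finset.mem_image_of_mem _ hx
  have hmem' : ∀ x ∈ W.image (fun x => x.1), ∃ hx : B.Valid x, ⟨x, hx⟩ ∈ W := by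
    intro x hx
    obtain ⟨y, hy, rfl⟩ := Finset.mem_image.1 hx
    exact ⟨y.2, hy⟩
  have spec := B.homFrom_spec (An := An) (Rn := Rn) (V := V) (g := g)
    (Finset.card_image_le.trans hW) (fun a ha => by
      obtain ⟨hv, hw⟩ := hmem' _ ha
      rw [B.nodeConcept_eq ⟨_, hv⟩]
      exact hroot a hv hw) (fun x hx => by
      obtain ⟨hv, hw⟩ := hmem' _ hx
      rw [B.nodeConcept_eq ⟨_, hv⟩]
      exact hex _ hw)
  constructor
  · intro A hA x hx hxA
    have h := (spec x.1 (hmem x hx) x.2).1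
    rw [B.nodeConcept_eq] at h
    exact conceptExt_of_charConcept h hA hxA
  · rintro r hr ⟨x, hxv⟩ hx ⟨y, hyv⟩ hy h
    rcases B.forest_rel (R := .name r).1 h with ⟨a, b, h₁, h₂, h₃⟩ | ⟨e, h⟩ | ⟨e, h⟩
    · obtain rfl : x = .root a := h₁
      obtain rfl : y = .root b := h₂
      exact hbase r hr a b hxv hyv hx hy h₃
    · exact (spec y (hmem _ hy) hyv).2 x (.name r) e h (hmem _ hx) (name_mem_rolesOver hr)
    · exact (spec x (hmem _ hx) hxv).2 y (.inv r) e h (hmem _ hy) (inv_mem_rolesOver hr)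

end Blueprint

/-- If `q` is certain, and there are candidate types for all individual names, then the answer
is implied by finitely many atoms of the ABox and by the candidate types. -/
theorem exists_impliesQuery {n : ℕ} {T : TBox} (hT : UnravelingTolerant T) {q : PEQ n}
    {A : Set (Assertion IndName)} (hA : IsABox A) {a : Fin n → IndName} (ha : ∀ i, a i ∈ Ind A)
    (hq : CertainPEQ T A q a) {C₁ C₀ : Concept} {occ : List Role} {m N K : ℕ}
    {Rn : List RoleName} (hRn : q.formula.roleNames ⊆ Rn)
    (hm : m = q.formula.matchSize)
    (hC₁ : C₁ = conj (charConcepts q.formula.conceptNames q.formula.roleNames m))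
    (hocc : ∀ R, R ∈ occ ↔ RoleOccurs T C₁ R)
    (hN : (types T C₁ ×ˢ {R | RoleOccurs T C₁ R} ×ˢ types T C₁).ncard ≤ N)
    (hC₀ : C₀ = conj (reachConcepts occ
      (charConcepts q.formula.conceptNames q.formula.roleNames m) N))
    (hK : n + m ≤ K) {S : IndName → Set (Set Concept)} (hS : TypeAssignment T C₀ A S)
    (hne : ∀ b ∈ Ind A, (S b).Nonempty) (hf : RespectsFunc T A) :
    ∃ (z : Var → IndName) (ρ : Fin n → Fin K), (∀ v, z v ∈ Ind A) ∧ (∀ i, z (ρ i) = a i) ∧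
      ImpliesQuery T C₀ q K (coreOf A K Rn z) (fun v => S (z v)) ρ := by
  classical
  set An := q.formula.conceptNames with hAn
  set Rq := q.formula.roleNames with hRq
  have hELI : ∀ C ∈ reachConcepts occ (charConcepts An Rq m) N, C.IsELI := fun C hC =>
    isELI_of_mem_reachConcepts (fun D hD => isELI_of_mem_charConcepts hD) hC
  -- What holds at individuals in this model is certain, for all concepts that will describe a
  -- match.
  obtain ⟨I, hI, hIA, hmin⟩ := exists_minimal_model hT hA (hS.consistent hT hA hne hf)
    (S := {C | C ∈ reachConcepts occ (charConcepts An Rq m) N}) (List.finite_toSet _) hELI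
  have hnm : ∀ b, ∃ d, b ∈ Ind A → I.name b = some d := by
    intro b
    by_cases hb : b ∈ Ind A
    · obtain ⟨d, hd⟩ := hIA.exists_name hb
      exact ⟨d, fun _ => hd⟩
    · obtain ⟨d⟩ := I.nonempty
      exact ⟨d, fun h => (hb h).elim⟩
  choose nm hnm using hnm
  -- Forest nodes may be arbitrarily deep, but the elements they copy must stay close to the
  -- individuals for finitely many concepts to suffice.
  obtain ⟨f, k₀, hk₀, hf₁, hf₂⟩ := exists_shallow_relabel (nm '' Ind A) hI hocc hN
  have hsub : ∀ C ∈ charConcepts An Rq m, C ∈ cl T C₁ := fun C hC =>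
    sub_subset_cl_self T C₁ (by rw [hC₁]; exact mem_sub_conj hC)
  let B : Blueprint T C₁ IndName :=
    { base := A
      U := I
      pt := nm
      relabel := f
      isModel := hI
      base_nonempty := hA.2
      concept_mem := by
        intro X b h _
        obtain ⟨d, hd, hX⟩ := hIA _ h
        obtain rfl : nm b = d := Option.some.inj ((hnm b ⟨_, h, rfl⟩).symm.trans hd)
        exact hX
      edge := by
        intro R b c h _
        obtain ⟨d, e, hd, he, hr⟩ := hIA.exists_rel h
        obtain rfl : nm b = d := Option.some.inj ((hnm b h.ind_left).symm.trans hd)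
        obtain rfl : nm c = e := Option.some.inj ((hnm c h.ind_right).symm.trans he)
        exact Blueprint.typeEdge_of_rel hI hr
      func := hf
      relabel_rel := fun d R e h => (hf₁ d R e h).1
      relabel_fst := fun d R e h => (hf₁ d R e h).2.1
      relabel_snd := fun d R e h => (hf₁ d R e h).2.2 }
  have hreach : ∀ x, B.Valid x → ∃ j ≤ k₀, B.label x ∈ I.reachFrom occ (nm '' Ind A) j := by
    intro x
    induction x with
    | root b => exact fun hb => ⟨0, Nat.zero_le _, b, hb, rfl⟩
    | child x R e ih => exact fun hv => hf₂ _ R e ((hocc R).2 hv.2.1) hv.2.2.1 (ih hv.1)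
  obtain ⟨π, hπ, hsat⟩ := hq B.forest B.forest_isModel B.forest_isModelABox
  obtain ⟨W, hW, hWhom⟩ := q.formula.exists_support B.forest hsat
  rw [← hm] at hW
  have hlabel : ∀ x : B.forest.Dom,
      B.label x.1 ∈ I.ext (charConcept An Rq m B.forest x) := fun x =>
    (B.forest_ext (hsub _ charConcept_mem) x).1
      mem_ext_charConcept
  -- Each node is charged to an individual and a certain concept there. A root is charged to itself
  -- with its own concept. Another node is charged to an individual from which its label is reached
  -- in at most `N` steps; the concept prefixed by these steps realizes the concept of the node
  -- somewhere.
  have hcert : ∀ x : B.forest.Dom, ∃ b ∈ Ind A, ∃ C ∈ reachConcepts occ (charConcepts An Rq m) N,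
      (∀ c, x.1 = .root c → b = c ∧ C = charConcept An Rq m B.forest x) ∧
      CertainConcept T A C b ∧ ∀ (V : Interp ℕ) (y : V.Dom), y ∈ V.ext C →
        ∃ y', y' ∈ V.ext (charConcept An Rq m B.forest x) := by
    rintro ⟨x, hx⟩
    cases x with
    | root c =>
      have hC : charConcept An Rq m B.forest ⟨.root c, hx⟩ ∈
          reachConcepts occ (charConcepts An Rq m) N :=
        reachConcepts_mono (Nat.zero_le N) (C := charConcept An Rq m B.forest ⟨.root c, hx⟩)
          charConcept_mem
      refine ⟨c, hx, _, hC, ?_, hmin c hx _ hC (nm c) (hnm c hx) (hlabel ⟨.root c, hx⟩),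
        fun V y hy => ⟨y, hy⟩⟩
      intro c' hc'
      cases hc'
      exact ⟨rfl, rfl⟩
    | child x R e =>
      obtain ⟨j, hj, h⟩ := hreach _ hx
      obtain ⟨_, ⟨b, hb, rfl⟩, C, hC, hbC, hV⟩ := Interp.exists_reachConcept (i := 0)
        (l := charConcepts An Rq m) h charConcept_mem (hlabel ⟨.child x R e, hx⟩)
      have hC := reachConcepts_mono (by omega : 0 + j ≤ N) hC
      exact ⟨b, hb, C, hC, (fun c hc => by cases hc), hmin b hb C hC _ (hnm b hb) hbC, hV⟩
  choose bs hbs cs hcs hroot hcertain hV using hcert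
  obtain ⟨z, hz, hza, hzl⟩ := exists_enumeration (K := K) (ind_nonempty hA.2) a ha (W.toList.map bs)
    (fun b hb => by obtain ⟨x, -, rfl⟩ := List.mem_map.1 hb; exact hbs x)
    (by rw [List.length_map, Finset.length_toList]; omega)
  -- The enumeration `z` may repeat individuals, so one variable is fixed for each. Answer variables
  -- and match elements then use the same one.
  have hvar : ∀ b, ∃ v, ((∃ v < K, z v = b) → v < K ∧ z v = b) := by
    intro b
    by_cases h : ∃ v < K, z v = b
    · obtain ⟨v, hv⟩ := h
      exact ⟨v, fun _ => hv⟩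
    · exact ⟨0, fun h' => (h h').elim⟩
  choose var hvar using hvar
  have hbsv : ∀ x ∈ W, var (bs x) < K ∧ z (var (bs x)) = bs x := fun x hx =>
    hvar _ (hzl _ (List.mem_map_of_mem (Finset.mem_toList.2 hx)))
  refine ⟨z, fun i => ⟨var (a i), (hvar _ (hza i)).1⟩, hz, fun i => (hvar _ (hza i)).2, ?_⟩
  intro V σ hVT hcore hty
  -- Certain concepts belong to all candidate types, so they hold in `V`, which is only assumed to
  -- be a model of `T` with these types and the core atoms and need not be a model of `A`.
  have hσ : ∀ x ∈ W, σ (var (bs x)) ∈ V.ext (cs x) := by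
    intro x hx
    have hcl : cs x ∈ cl T C₀ :=
      sub_subset_cl_self T C₀ (by rw [hC₀]; exact mem_sub_conj (hcs x))
    have ht := hty ⟨var (bs x), (hbsv x hx).1⟩
    dsimp only at ht
    rw [(hbsv x hx).2] at ht
    exact (hS.mem_of_certain hT hA hne hf (hELI _ (hcs x)) hcl (hbs x) (hcertain x) ht).2
  have hhom := B.homOn_homFrom (An := An) (Rn := Rq) (V := V) (g := fun b => σ (var b)) hW
    (fun c hc hcW => by
      have := hσ _ hcW
      obtain ⟨h₁, h₂⟩ := hroot ⟨.root c, hc⟩ c rfl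
      rwa [h₁, h₂] at this)
    (fun x hx => hV x V _ (hσ x hx))
    (fun r hr b c hb hc hbW hcW h => by
      have h₁ := hbsv _ hbW
      have h₂ := hbsv _ hcW
      rw [(hroot ⟨.root b, hb⟩ b rfl).1] at h₁
      rw [(hroot ⟨.root c, hc⟩ c rfl).1] at h₂
      refine hcore _ (role_mem_coreOf (hRn hr) h₁.1 h₂.1 ?_)
      rw [h₁.2, h₂.2]
      exact h)
  refine ⟨_, fun i => ?_, hWhom V _ hhom⟩
  have := B.forest_name.1 (hπ i)
  simp only [Function.comp_apply]
  rw [this]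
  rfl

/-- The role names in the functionality assertions of a TBox. -/
noncomputable def funcRoleNames (T : TBox) : List RoleName :=
  T.toList.filterMap fun
    | .func (.name r) => some r
    | .func (.inv r) => some r
    | .incl _ _ => none

theorem name_mem_funcRoleNames {T : TBox} {r : RoleName} (h : TBoxAxiom.func (.name r) ∈ T) :
    r ∈ funcRoleNames T :=
  List.mem_filterMap.2 ⟨_, Finset.mem_toList.2 h, rfl⟩

theorem inv_mem_funcRoleNames {T : TBox} {r : RoleName} (h : TBoxAxiom.func (.inv r) ∈ T) :
    r ∈ funcRoleNames T :=
  List.mem_filterMap.2 ⟨_, Finset.mem_toList.2 h, rfl⟩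

/-- A violated functionality assertion is visible in the core of an ABox. -/
theorem rel_of_coreHolds {T : TBox} {R : Role} (hR : TBoxAxiom.func R ∈ T)
    {A : Set (Assertion IndName)} {K : ℕ} {Rn : List RoleName} (hRn : funcRoleNames T ⊆ Rn)
    {z : Var → IndName} {x y : Var} (hx : x < K) (hy : y < K) (h : RoleMem A R (z x) (z y))
    {V : Interp ℕ} {σ : Var → V.Dom} (hcore : ∀ c ∈ coreOf A K Rn z, c.CoreHolds V σ) :
    V.rel R (σ x) (σ y) := by
  cases R with
  | name r => exact hcore _ (role_mem_coreOf (hRn (name_mem_funcRoleNames hR)) hx hy h)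
  | inv r => exact hcore _ (role_mem_coreOf (hRn (inv_mem_funcRoleNames hR)) hy hx h)

-- Two levels of concepts are used. The closure of `C₁` contains the characteristic concepts and
-- governs the forest; `C₀` adds the prefixed versions, so that the types handled by the program
-- decide all concepts charged to individuals. If functionality is violated or some derived set is
-- empty, the query is implied vacuously, since no model of `T` matches the rule body.
open Classical in
theorem monadicDatalogNeqRewritablePEQ {T : TBox} (hT : UnravelingTolerant T) :
    MonadicDatalogNeqRewritablePEQ T := by
  intro n q
  obtain ⟨m, hm⟩ : ∃ m, m = q.formula.matchSize := ⟨_, rfl⟩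
  obtain ⟨C₁, hC₁⟩ : ∃ C₁, C₁ = conj (charConcepts q.formula.conceptNames
    q.formula.roleNames m) := ⟨_, rfl⟩
  obtain ⟨occ, hocc⟩ : ∃ occ : List Role, ∀ R, R ∈ occ ↔ RoleOccurs T C₁ R :=
    ⟨(roleOccurs_finite T C₁).toFinset.toList, fun R => by simp⟩
  obtain ⟨N, hN⟩ : ∃ N, (types T C₁ ×ˢ {R | RoleOccurs T C₁ R} ×ˢ types T C₁).ncard ≤ N :=
    ⟨_, le_rfl⟩
  obtain ⟨C₀, hC₀⟩ : ∃ C₀, C₀ = conj (reachConcepts occ (charConcepts q.formula.conceptNames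
    q.formula.roleNames m) N) := ⟨_, rfl⟩
  let Rn := q.formula.roleNames ++ funcRoleNames T
  have hfunc : funcRoleNames T ⊆ Rn := List.subset_append_right _ _
  -- There are `n` variables for the answer, at most `m` for the individuals charged by a match, and
  -- three to exhibit a functionality violation.
  let K := n + m + 3
  refine ⟨queryProgram T C₀ q K Rn, queryProgram_isProgram (by omega), fun _ => rfl,
    fun A hA a ha => ⟨fun hq M hM => ?_, queryProgram_sound⟩⟩
  obtain ⟨S, hS, hD⟩ := exists_typeAssignment (T := T) (C₀ := C₀) (n := n)
    (rules := {ρ | IsQueryProgramRule T C₀ q K Rn ρ}) (fun ρ h => .type ρ h) A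
  suffices h : ∃ (z : Var → IndName) (ρ : Fin n → Fin K), (∀ v, z v ∈ Ind A) ∧
      (∀ i, z (ρ i) = a i) ∧
      ImpliesQuery T C₀ q K (coreOf A K Rn z) (fun v => S (z v)) ρ by
    obtain ⟨z, ρ, hz, hρ, h⟩ := h
    obtain rfl : (fun i => z (ρ i)) = a := funext hρ
    exact queryProgram_derives hM hS (fun b hb => hD b hb M hM) hz h
  have henum : ∀ l : List IndName, (∀ b ∈ l, b ∈ Ind A) → l.length ≤ 3 →
      ∃ (z : Var → IndName) (ρ : Fin n → Fin K), (∀ v, z v ∈ Ind A) ∧ (∀ i, z (ρ i) = a i) ∧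
        ∀ b ∈ l, ∃ v < K, z v = b := by
    intro l hl hlen
    obtain ⟨z, hz, hza, hzl⟩ := exists_enumeration (K := K) (ind_nonempty hA.2) a ha l hl (by omega)
    choose ρ hρ hρ' using hza
    exact ⟨z, fun i => ⟨ρ i, hρ i⟩, hz, hρ', hzl⟩
  by_cases hf : RespectsFunc T A
  · by_cases hne : ∀ b ∈ Ind A, (S b).Nonempty
    · exact exists_impliesQuery hT hA ha hq (List.subset_append_left _ _) hm hC₁ hocc hN hC₀
        (by omega) hS hne hf
    · push Not at hne
      obtain ⟨b, hb, hSb⟩ := hne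
      obtain ⟨z, ρ, hz, hρ, hl⟩ := henum [b] (by simpa using hb) (by simp)
      obtain ⟨v, hv, hvb⟩ := hl b (by simp)
      refine ⟨z, ρ, hz, hρ, fun V σ _ _ hty => ?_⟩
      have := hty ⟨v, hv⟩
      dsimp only at this
      rw [hvb, hSb] at this
      exact this.elim
  · unfold RespectsFunc at hf
    push Not at hf
    obtain ⟨R, y, z₁, z₂, hR, h₁, h₂, hz₁₂⟩ := hf
    obtain ⟨z, ρ, hz, hρ, hl⟩ := henum [y, z₁, z₂]
      (by simpa using ⟨h₁.ind_left, h₁.ind_right, h₂.ind_right⟩) (by simp)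
    obtain ⟨v, hv, rfl⟩ := hl y (by simp)
    obtain ⟨v₁, hv₁, rfl⟩ := hl z₁ (by simp)
    obtain ⟨v₂, hv₂, rfl⟩ := hl z₂ (by simp)
    refine ⟨z, ρ, hz, hρ, fun V σ hVT hcore _ => ?_⟩
    have k₁ := rel_of_coreHolds hR hfunc hv hv₁ h₁ hcore
    have k₂ := rel_of_coreHolds hR hfunc hv hv₂ h₂ hcore
    have hne : σ v₁ ≠ σ v₂ := hcore _ (List.mem_filter.2 ⟨neq_mem_coreAtoms hv₁ hv₂,
      decide_eq_true (p := BodyAtom.Holds A ∅ z (.neq v₁ v₂)) hz₁₂⟩)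
    exact (hne (hVT _ hR _ _ _ k₁ k₂)).elim

end DL

/-! ### Compilation of structured stack programs to Turing machines. -/

namespace DL

open Turing Computability

/-! ### Structured programs for machines with stacks -/

/-- Structured programs over stacks indexed by `K`, with stack alphabet `Γ` and a finite control
with states `σ`. -/
inductive Cmd (K Γ σ : Type) where
  | push (k : K) (f : σ → Γ)
  | pop (k : K) (f : σ → Option Γ → σ)
  | peek (k : K) (f : σ → Option Γ → σ)
  | load (f : σ → σ)
  | seq (c d : Cmd K Γ σ)
  | ite (p : σ → Bool) (c d : Cmd K Γ σ)
  | loop (p : σ → Bool) (c : Cmd K Γ σ)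

namespace Cmd

variable {K Γ σ : Type} [DecidableEq K]

/-- `Run c v S v' S' t`: started with control state `v` and stacks `S`, the program `c` stops after
`t` steps with control state `v'` and stacks `S'`. -/
inductive Run : Cmd K Γ σ → σ → (K → List Γ) → σ → (K → List Γ) → ℕ → Prop
  | push {k f v S} : Run (.push k f) v S v (Function.update S k (f v :: S k)) 1
  | pop {k f v S} : Run (.pop k f) v S (f v (S k).head?) (Function.update S k (S k).tail) 1
  | peek {k f v S} : Run (.peek k f) v S (f v (S k).head?) S 1
  | load {f v S} : Run (.load f) v S (f v) S 1
  | seq {c d v S v₁ S₁ v₂ S₂ s t} :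
      Run c v S v₁ S₁ s → Run d v₁ S₁ v₂ S₂ t → Run (.seq c d) v S v₂ S₂ (s + t)
  | ite_true {p c d v S v₁ S₁ t} :
      p v = true → Run c v S v₁ S₁ t → Run (.ite p c d) v S v₁ S₁ (1 + t)
  | ite_false {p c d v S v₁ S₁ t} :
      p v = false → Run d v S v₁ S₁ t → Run (.ite p c d) v S v₁ S₁ (1 + t)
  | loop_done {p c v S} : p v = false → Run (.loop p c) v S v S 1
  | loop_step {p c v S v₁ S₁ v₂ S₂ s t} :
      p v = true → Run c v S v₁ S₁ s → Run (.loop p c) v₁ S₁ v₂ S₂ t →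
      Run (.loop p c) v S v₂ S₂ (1 + (s + t))

/-- The labels of the machine for a program. -/
def Pos : Cmd K Γ σ → Type
  | .seq c d => c.Pos ⊕ d.Pos
  | .ite _ c d => Option (c.Pos ⊕ d.Pos)
  | .loop _ c => Option c.Pos
  | _ => Unit

omit [DecidableEq K] in
theorem finite_pos : ∀ c : Cmd K Γ σ, Finite c.Pos
  | .push _ _ | .pop _ _ | .peek _ _ | .load _ => inferInstanceAs (Finite Unit)
  | .seq c d =>
    have := c.finite_pos
    have := d.finite_pos
    inferInstanceAs (Finite (c.Pos ⊕ d.Pos))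
  | .ite _ c d =>
    have := c.finite_pos
    have := d.finite_pos
    inferInstanceAs (Finite (Option (c.Pos ⊕ d.Pos)))
  | .loop _ c =>
    have := c.finite_pos
    inferInstanceAs (Finite (Option c.Pos))

/-- The label at which a program starts. -/
def entry : ∀ c : Cmd K Γ σ, c.Pos
  | .push _ _ | .pop _ _ | .peek _ _ | .load _ => ()
  | .seq c _ => Sum.inl c.entry
  | .ite _ _ _ => (none : Option _)
  | .loop _ _ => (none : Option _)

/-- The alphabets of the machine: an input stack, an output stack, and the stacks of the
program. -/
def Alphabet (K Γ : Type) : Option (Option K) → Type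
  | none => Γ'
  | some none => Bool
  | some (some _) => Γ

/-- The statement at a label of a program whose labels are embedded by `ι` and which is followed by
the statement `next`. -/
def code {Λ : Type} : ∀ c : Cmd K Γ σ, (c.Pos → Λ) → TM2.Stmt (Alphabet K Γ) Λ σ → c.Pos →
    TM2.Stmt (Alphabet K Γ) Λ σ
  | .push k f, _, next, _ => .push (some (some k)) f next
  | .pop k f, _, next, _ => .pop (some (some k)) f next
  | .peek k f, _, next, _ => .peek (some (some k)) f next
  | .load f, _, next, _ => .load f next
  | .seq c d, ι, next, p =>
    match p with
    | .inl p => c.code (fun p => ι (Sum.inl p)) (.goto fun _ => ι (Sum.inr d.entry)) p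
    | .inr p => d.code (fun p => ι (Sum.inr p)) next p
  | .ite b c d, ι, next, p =>
    match p with
    | none => .branch b (.goto fun _ => ι (some (Sum.inl c.entry)))
        (.goto fun _ => ι (some (Sum.inr d.entry)))
    | some (.inl p) => c.code (fun p => ι (some (Sum.inl p))) next p
    | some (.inr p) => d.code (fun p => ι (some (Sum.inr p))) next p
  | .loop b c, ι, next, p =>
    match p with
    | none => .branch b (.goto fun _ => ι (some c.entry)) next
    | some p => c.code (fun p => ι (some p)) (.goto fun _ => ι none) p

/-- The stacks of the machine when the program has stacks `S`. -/
def allStacks (i : List Γ') (o : List Bool) (S : K → List Γ) : ∀ k, List (Alphabet K Γ k)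
  | none => i
  | some none => o
  | some (some k) => S k

theorem allStacks_update (i : List Γ') (o : List Bool) (S : K → List Γ) (k : K) (l : List Γ) :
    Function.update (allStacks i o S) (some (some k)) l = allStacks i o (Function.update S k l) := by
  funext j
  rcases j with _ | _ | j
  · rfl
  · rfl
  · by_cases h : j = k
    · subst h
      exact (Function.update_self ..).trans (Function.update_self (β := fun _ => List Γ) ..).symm
    · refine (Function.update_of_ne (by simpa using h) ..).trans ?_
      exact (Function.update_of_ne (β := fun _ => List Γ) h ..).symm

theorem allStacks_update_input (i j : List Γ') (o : List Bool) (S : K → List Γ) :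
    Function.update (allStacks i o S) none j = allStacks j o S := by
  funext k
  rcases k with _ | _ | k <;> rfl

/-- `t` steps of a machine. -/
abbrev steps {Λ : Type} (M : Λ → TM2.Stmt (Alphabet K Γ) Λ σ) (t : ℕ)
    (c : TM2.Cfg (Alphabet K Γ) Λ σ) : Option (TM2.Cfg (Alphabet K Γ) Λ σ) :=
  (flip bind (TM2.step M))^[t] (some c)

theorem steps_add {Λ : Type} {M : Λ → TM2.Stmt (Alphabet K Γ) Λ σ} {s t : ℕ}
    {c d : TM2.Cfg (Alphabet K Γ) Λ σ} (h : steps M s c = some d) :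
    steps M (s + t) c = steps M t d := by
  rw [steps, Nat.add_comm, Function.iterate_add_apply]
  exact congrArg _ h

theorem steps_one {Λ : Type} (M : Λ → TM2.Stmt (Alphabet K Γ) Λ σ) (l : Λ) (v : σ)
    (S : ∀ k, List (Alphabet K Γ k)) :
    steps M 1 ⟨some l, v, S⟩ = some (TM2.stepAux (M l) v S) := rfl

/-- Big-step and small-step semantics agree step for step, because every basic command and every
test has its own label. The induction works thanks to the arbitrary embedding of labels and the
arbitrary continuation `next`. -/
theorem Run.steps_code {c : Cmd K Γ σ} {v v' : σ} {S S' : K → List Γ} {t : ℕ}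
    (h : Run c v S v' S' t) {Λ : Type} (M : Λ → TM2.Stmt (Alphabet K Γ) Λ σ) (i : List Γ')
    (o : List Bool) (ι : c.Pos → Λ) (next : TM2.Stmt (Alphabet K Γ) Λ σ)
    (hM : ∀ p, M (ι p) = c.code ι next p) :
    steps M t ⟨some (ι c.entry), v, allStacks i o S⟩ =
      some (TM2.stepAux next v' (allStacks i o S')) := by
  induction h generalizing next with
  | @push k f v S =>
    rw [steps_one, hM, ← allStacks_update]
    rfl
  | @pop k f v S =>
    rw [steps_one, hM, ← allStacks_update]
    rfl
  | peek =>
    rw [steps_one, hM]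
    rfl
  | load =>
    rw [steps_one, hM]
    rfl
  | seq _ _ ih₁ ih₂ =>
    refine (steps_add (ih₁ _ _ fun p => hM (Sum.inl p))).trans ?_
    exact ih₂ _ _ fun p => hM (Sum.inr p)
  | @ite_true p c d v S _ _ _ hp _ ih =>
    refine (steps_add (d := ⟨some (ι (some (Sum.inl c.entry))), v, allStacks i o S⟩) ?_).trans
      (ih _ _ fun p => hM (some (Sum.inl p)))
    rw [steps_one, hM]
    simp only [entry, code, TM2.stepAux, hp, cond_true]
  | @ite_false p c d v S _ _ _ hp _ ih =>
    refine (steps_add (d := ⟨some (ι (some (Sum.inr d.entry))), v, allStacks i o S⟩) ?_).trans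
      (ih _ _ fun p => hM (some (Sum.inr p)))
    rw [steps_one, hM]
    simp only [entry, code, TM2.stepAux, hp, cond_false]
  | loop_done hp =>
    rw [steps_one, hM]
    simp only [entry, code, TM2.stepAux, hp, cond_false]
  | @loop_step p c v S v₁ S₁ v₂ S₂ s t hp _ _ ih₁ ih₂ =>
    refine (steps_add (d := ⟨some (ι (some c.entry)), v, allStacks i o S⟩) ?_).trans
      ((steps_add (ih₁ _ _ fun p => hM (some p))).trans (ih₂ _ _ hM))
    rw [steps_one, hM]
    simp only [entry, code, TM2.stepAux, hp, cond_true]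

/-- The statements of a machine that moves its input to the stack `k`, runs the program `c` and
outputs a bit that is determined by the control state. -/
def machineCode (c : Cmd K Γ σ) (k : K) (v₀ : σ) (read : Option Γ' → σ) (conv : σ → Option Γ)
    (γ : Γ) (acc : σ → Bool) : Option c.Pos → TM2.Stmt (Alphabet K Γ) (Option c.Pos) σ
  | none => .pop none (fun _ s => read s) (.branch (fun v => (conv v).isSome)
      (.push (some (some k)) (fun v => (conv v).getD γ) (.goto fun _ => none))
      (.load (fun _ => v₀) (.goto fun _ => some c.entry)))
  | some p => c.code some (.push (some none) acc (.load (fun _ => v₀) .halt)) p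

/-- Popping the input and pushing each symbol reverses it. The extra step is the one that finds the
input stack empty. -/
theorem steps_machineCode_none (c : Cmd K Γ σ) (k : K) (v₀ : σ) {read : Option Γ' → σ}
    {conv : σ → Option Γ} {g : Γ' → Γ} (hconv : ∀ s, conv (read s) = s.map g) (γ : Γ)
    (acc : σ → Bool) (w : List Γ') (v : σ) (l : List Γ) :
    steps (c.machineCode k v₀ read conv γ acc) (w.length + 1)
        ⟨some none, v, allStacks w [] (Function.update (fun _ => []) k l)⟩ =
      some ⟨some (some c.entry), v₀,
        allStacks [] [] (Function.update (fun _ => []) k (w.reverse.map g ++ l))⟩ := by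
  induction w generalizing v l with
  | nil =>
    have hb : (conv (read none)).isSome = false := by rw [hconv]; rfl
    rw [List.length_nil, Nat.zero_add, steps_one]
    change some (cond (conv (read none)).isSome _ _) = _
    rw [hb]
    exact congrArg (fun S => some (TM2.Cfg.mk (some (some c.entry)) v₀ S))
      (allStacks_update_input [] [] [] _)
  | cons s w ih =>
    have hb : (conv (read (some s))).isSome = true := by rw [hconv]; rfl
    have hg : (conv (read (some s))).getD γ = g s := by rw [hconv]; rfl
    rw [List.length_cons, Nat.add_comm _ 1]
    refine (steps_add (d := ⟨some none, read (some s),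
      allStacks w [] (Function.update (fun _ => []) k (g s :: l))⟩) ?_).trans ?_
    · rw [steps_one]
      change some (cond (conv (read (some s))).isSome _ _) = _
      rw [hb]
      have h : Function.update (allStacks (s :: w) [] (Function.update (fun _ => []) k l)) none w =
        allStacks w [] (Function.update (fun _ => []) k l) := allStacks_update_input ..
      refine congrArg (fun S => some (TM2.Cfg.mk (some none) (read (some s)) S)) ?_
      refine (congrArg₂ (fun (a : Γ) (S : ∀ k, List (Alphabet K Γ k)) =>
        Function.update S (some (some k)) (a :: S (some (some k)))) hg h).trans ?_
      refine (allStacks_update ..).trans (congrArg _ ?_)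
      refine (Function.update_idem (β := fun _ => List Γ) ..).trans ?_
      exact congrArg (fun l => Function.update (β := fun _ => List Γ) _ k (g s :: l))
        (show Function.update (fun _ => ([] : List Γ)) k l k = l from Function.update_self ..)
    · refine (ih _ _).trans ?_
      rw [List.reverse_cons, List.map_append, List.append_assoc]
      rfl

/-- The machine with these statements. -/
noncomputable def machine [Fintype K] [Fintype σ] (c : Cmd K Γ σ) (k : K) (v₀ : σ)
    (read : Option Γ' → σ) (conv : σ → Option Γ) (γ : Γ) (acc : σ → Bool) : FinTM2 where
  K := Option (Option K)
  k₀ := none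
  k₁ := some none
  Γ := Alphabet K Γ
  Λ := Option c.Pos
  main := none
  ΛFin :=
    have := c.finite_pos
    Fintype.ofFinite _
  σ := σ
  initialState := v₀
  Γk₀Fin := inferInstanceAs (Fintype Γ')
  m := c.machineCode k v₀ read conv γ acc

/-- A program that decides a property in polynomially many steps, and finally clears its stacks,
gives a polynomial time machine. -/
theorem nonempty_computableInPolyTime [Fintype K] [Fintype σ] {α : Type} {enc : α → List Γ'}
    {f : α → Bool} (c : Cmd K Γ σ) (k : K) (v₀ : σ) (read : Option Γ' → σ) (conv : σ → Option Γ)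
    (g : Γ' → Γ) (hconv : ∀ s, conv (read s) = s.map g) (acc : σ → Bool) (p : Polynomial ℕ)
    (h : ∀ a, ∃ v t, Run c v₀ (Function.update (fun _ => []) k ((enc a).reverse.map g)) v
      (fun _ => []) t ∧ acc v = f a ∧ t ≤ p.eval (enc a).length) :
    Nonempty (TM2ComputableInPolyTime enc encodeBool f) := by
  refine ⟨⟨⟨c.machine k v₀ read conv (g default) acc, Equiv.refl _, Equiv.refl _⟩,
    Polynomial.X + 1 + p, fun a => ?_⟩⟩
  have h' := h a
  choose v t hrun hacc ht using h'
  refine ⟨⟨(enc a).length + 1 + t, ?_⟩, ?_⟩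
  · have h₁ := steps_machineCode_none c k v₀ hconv (g default) acc (enc a) v₀ []
    rw [List.append_nil] at h₁
    have h₀ : Function.update (fun _ => []) k [] = fun _ : K => ([] : List Γ) :=
      Function.update_eq_self k _
    have h₂ := (steps_add h₁).trans
      (hrun.steps_code (c.machineCode k v₀ read conv (g default) acc) [] [] some _ fun p => rfl)
    refine Eq.trans ?_ (h₂.trans ?_)
    · refine congrArg (fun S => steps (c.machineCode k v₀ read conv (g default) acc)
        ((enc a).length + 1 + t) ⟨some none, v₀, S⟩) ?_
      funext j
      rcases j with _ | _ | j
      · exact List.map_id _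
      · rfl
      · exact (congrFun h₀ j).symm
    -- A halting configuration must have the initial control state and all stacks empty except the
    -- output. For this reason the control state is reset at the end and the program has to clear
    -- its stacks.
    · refine congrArg (fun S => some (TM2.Cfg.mk none v₀ S)) ?_
      funext j
      rcases j with _ | _ | j
      · rfl
      · change [acc v] = [f a]
        rw [hacc]
      · rfl
  · simp only [Polynomial.eval_add, Polynomial.eval_X, Polynomial.eval_one]
    exact Nat.add_le_add_left ht _

end Cmd

end DL

/-! ### Token programs: stack implementation and running time. -/

namespace DL

open Computability

namespace Cmd

variable {K Γ σ : Type} [DecidableEq K]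

/-- `c` runs from control state `v` and stacks `S` to `v'` and `S'` in at most `B` steps. -/
def Exec (c : Cmd K Γ σ) (v : σ) (S : K → List Γ) (v' : σ) (S' : K → List Γ) (B : ℕ) : Prop :=
  ∃ t ≤ B, Run c v S v' S' t

variable {c d : Cmd K Γ σ} {v v₁ v₂ : σ} {S S₁ S₂ : K → List Γ} {B B₁ B₂ : ℕ}

theorem Exec.mono (h : Exec c v S v₁ S₁ B₁) (hB : B₁ ≤ B₂) : Exec c v S v₁ S₁ B₂ :=
  let ⟨t, ht, hr⟩ := h
  ⟨t, ht.trans hB, hr⟩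

theorem Exec.congr {v' v'' : σ} {S' S'' : K → List Γ} (h : Exec c v S v' S' B₁) (hv : v' = v'')
    (hS : S' = S'') (hB : B₁ ≤ B₂) : Exec c v S v'' S'' B₂ :=
  hv ▸ hS ▸ h.mono hB

theorem Exec.seq (h₁ : Exec c v S v₁ S₁ B₁) (h₂ : Exec d v₁ S₁ v₂ S₂ B₂) :
    Exec (.seq c d) v S v₂ S₂ (B₁ + B₂) :=
  let ⟨_, ht₁, hr₁⟩ := h₁
  let ⟨_, ht₂, hr₂⟩ := h₂
  ⟨_, Nat.add_le_add ht₁ ht₂, .seq hr₁ hr₂⟩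

theorem exec_push {k : K} {f : σ → Γ} :
    Exec (.push k f) v S v (Function.update S k (f v :: S k)) 1 := ⟨1, le_rfl, .push⟩

theorem exec_pop {k : K} {f : σ → Option Γ → σ} :
    Exec (.pop k f) v S (f v (S k).head?) (Function.update S k (S k).tail) 1 := ⟨1, le_rfl, .pop⟩

theorem exec_peek {k : K} {f : σ → Option Γ → σ} :
    Exec (.peek k f) v S (f v (S k).head?) S 1 := ⟨1, le_rfl, .peek⟩

theorem exec_load {f : σ → σ} : Exec (.load f) v S (f v) S 1 := ⟨1, le_rfl, .load⟩

theorem Exec.ite_true {p : σ → Bool} (hp : p v = true) (h : Exec c v S v₁ S₁ B) :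
    Exec (.ite p c d) v S v₁ S₁ (B + 1) :=
  let ⟨_, ht, hr⟩ := h
  ⟨_, by omega, .ite_true hp hr⟩

theorem Exec.ite_false {p : σ → Bool} (hp : p v = false) (h : Exec d v S v₁ S₁ B) :
    Exec (.ite p c d) v S v₁ S₁ (B + 1) :=
  let ⟨_, ht, hr⟩ := h
  ⟨_, by omega, .ite_false hp hr⟩

theorem exec_loop_done {p : σ → Bool} (hp : p v = false) : Exec (.loop p c) v S v S 1 :=
  ⟨1, le_rfl, .loop_done hp⟩

theorem Exec.loop_step {p : σ → Bool} (hp : p v = true) (h₁ : Exec c v S v₁ S₁ B₁)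
    (h₂ : Exec (.loop p c) v₁ S₁ v₂ S₂ B₂) : Exec (.loop p c) v S v₂ S₂ (B₁ + B₂ + 1) :=
  let ⟨_, ht₁, hr₁⟩ := h₁
  let ⟨_, ht₂, hr₂⟩ := h₂
  ⟨_, by omega, .loop_step hp hr₁ hr₂⟩

/-- The program that does nothing. -/
def skip : Cmd K Γ σ := .load id

omit [DecidableEq K] in
/-- Sequential composition of a list of programs. -/
def seqs (l : List (Cmd K Γ σ)) : Cmd K Γ σ := l.foldr .seq skip

end Cmd

/-! ### Programs on stacks of tokens -/

/-- Stack symbols: bits and headers. -/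
abbrev Sym (H : Type) := Bool ⊕ H

/-- A token: a bit string followed by a header. -/
abbrev Token (H : Type) := List Bool × H

/-- The word of a token. -/
def Token.word {H : Type} (t : Token H) : List (Sym H) := t.1.map .inl ++ [.inr t.2]

/-- The word of a list of tokens. -/
def words {H : Type} (l : List (Token H)) : List (Sym H) := l.flatMap Token.word

/-- The stacks: the input `W`, the facts `F`, two auxiliary stacks, and a stack for each element of
`X`, whose first token is the current value of this element. -/
inductive Stk (X : Type) where
  | W
  | F
  | G
  | E
  | D (x : X)
  deriving DecidableEq

/-- Control states: two symbols, flags for the elements of `X`, a state of an automaton, and the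
answer. -/
@[ext]
structure Ctl (H X Q : Type) where
  c₁ : Option (Sym H)
  c₂ : Option (Sym H)
  fl : X → Bool
  q : Q
  a : Bool

section

variable {H X Q : Type}

instance [Finite X] : Finite (Stk X) :=
  Finite.of_injective (β := Option (Option (Option (Option X))))
    (fun
      | .W => none
      | .F => some none
      | .G => some (some none)
      | .E => some (some (some none))
      | .D x => some (some (some (some x))))
    (by rintro (_ | _ | _ | _ | x) (_ | _ | _ | _ | y) h <;> simp_all)

instance [Finite H] [Finite X] [Finite Q] : Finite (Ctl H X Q) :=
  Finite.of_injective (β := Option (Sym H) × Option (Sym H) × (X → Bool) × Q × Bool)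
    (fun v => (v.c₁, v.c₂, v.fl, v.q, v.a))
    (by rintro ⟨⟩ ⟨⟩ h; simpa using h)

/-- The next symbol is a bit. -/
def isBit : Option (Sym H) → Bool
  | some (.inl _) => true
  | _ => false

abbrev TCmd (H X Q : Type) := Cmd (Stk X) (Sym H) (Ctl H X Q)

namespace TCmd

open Cmd

/-- Read the first symbol of a stack into the first register. -/
def peek₁ (a : Stk X) : TCmd H X Q := .peek a fun v s => { v with c₁ := s }

/-- Move the first symbol of a stack into the first register. -/
def pop₁ (a : Stk X) : TCmd H X Q := .pop a fun v s => { v with c₁ := s }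

/-- Push the first register. -/
def push₁ (a : Stk X) : TCmd H X Q := .push a fun v => v.c₁.getD (.inl false)

/-- Clear the first register. -/
def clear₁ : TCmd H X Q := .load fun v => { v with c₁ := none }

/-- Push the first register to several stacks. -/
def pushes (bs : List (Stk X)) : TCmd H X Q := seqs (bs.map push₁)

/-- Move symbols from a stack to several stacks as long as they satisfy `p`. -/
def spill (p : Option (Sym H) → Bool) (a : Stk X) (bs : List (Stk X)) : TCmd H X Q :=
  .seq (peek₁ a) (.seq (.loop (fun v => p v.c₁) (.seq (pushes bs) (.seq (pop₁ a) (peek₁ a))))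
    clear₁)

variable [DecidableEq X] {c₁ c₂ : Option (Sym H)} {fl : X → Bool} {q : Q} {b : Bool}
  {S : Stk X → List (Sym H)}

/-- Prepend a word to several stacks. -/
def prepend (l : List (Sym H)) (bs : List (Stk X)) (S : Stk X → List (Sym H)) :
    Stk X → List (Sym H) := fun k => if k ∈ bs then l ++ S k else S k

theorem exec_pushes {s : Sym H} {bs : List (Stk X)} (hbs : bs.Nodup) :
    Exec (pushes bs) ⟨some s, c₂, fl, q, b⟩ S ⟨some s, c₂, fl, q, b⟩ (prepend [s] bs S)
      (bs.length + 1) := by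
  induction bs generalizing S with
  | nil => exact exec_load
  | cons k bs ih =>
    have hk := List.nodup_cons.1 hbs
    refine (exec_push.seq (ih hk.2)).congr rfl ?_ (by rw [List.length_cons]; omega)
    funext j
    by_cases hj : j = k
    · subst hj
      simp [prepend, hk.1]
    · simp [prepend, hj]

/-- Each symbol costs one push per target, the trailing skip, a pop, a peek and a loop test, hence
the factor `bs.length + 4`. Moving reverses the word, so copying takes two such moves via an
auxiliary stack. -/
theorem exec_spill {p : Option (Sym H) → Bool} {a : Stk X} {bs : List (Stk X)} (hbs : bs.Nodup)
    (ha : a ∉ bs) {l r : List (Sym H)} (hl : ∀ s ∈ l, p (some s) = true)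
    (hr : p r.head? = false) (hS : S a = l ++ r) :
    Exec (spill p a bs) ⟨c₁, c₂, fl, q, b⟩ S ⟨none, c₂, fl, q, b⟩
      (Function.update (prepend l.reverse bs S) a r) ((bs.length + 4) * l.length + 3) := by
  have key : Exec (.loop (fun v => p v.c₁) (.seq (pushes bs) (.seq (pop₁ a) (peek₁ a))))
      ⟨(S a).head?, c₂, fl, q, b⟩ S ⟨r.head?, c₂, fl, q, b⟩
      (Function.update (prepend l.reverse bs S) a r) ((bs.length + 4) * l.length + 1) := by
    induction l generalizing S with
    | nil =>
      have h : Function.update (prepend ([] : List (Sym H)).reverse bs S) a r = S := by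
        funext j
        by_cases hj : j = a
        · subst hj
          simp [hS]
        · simp [prepend, hj]
      rw [h, hS]
      exact exec_loop_done hr
    | cons s l ih =>
      have hSa : prepend [s] bs S a = s :: (l ++ r) := by simp [prepend, ha, hS]
      have h₁ := ih (S := Function.update (prepend [s] bs S) a (l ++ r))
        (fun s' hs' => hl s' (List.mem_cons_of_mem _ hs')) (Function.update_self ..)
      have h₂ : Exec (.seq (pushes bs) (.seq (pop₁ a) (peek₁ a))) ⟨some s, c₂, fl, q, b⟩ S
          ⟨(l ++ r).head?, c₂, fl, q, b⟩ (Function.update (prepend [s] bs S) a (l ++ r))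
          (bs.length + 3) := by
        refine ((exec_pushes hbs).seq (exec_pop.seq exec_peek)).congr ?_ ?_ le_rfl
        · simp [hSa]
        · simp [hSa]
      rw [hS]
      rw [Function.update_self] at h₁
      refine (h₂.loop_step (p := fun v => p v.c₁) (hl s List.mem_cons_self) h₁).congr rfl ?_ ?_
      · funext j
        by_cases hj : j = a
        · subst hj
          simp
        · by_cases hjb : j ∈ bs <;> simp [prepend, hj, hjb]
      · rw [List.length_cons, Nat.mul_add]
        omega
  exact ((exec_peek (k := a)).seq (key.seq exec_load)).mono (by omega)

/-- The value of an element of `X`: the bits of the first token on its stack. -/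
def val (D : X → List (Token H)) (x : X) : List Bool := ((D x).head?.map Prod.fst).getD []

omit [DecidableEq X] in
theorem val_eq {D : X → List (Token H)} {x : X} {t : Token H} {r : List (Token H)}
    (h : D x = t :: r) : val D x = t.1 := by
  rw [val, h]
  rfl

/-- The stacks with given contents. -/
def conf (W F : List (Sym H)) (G : List (Sym H)) (D : X → List (Sym H)) : Stk X → List (Sym H)
  | .W => W
  | .F => F
  | .G => G
  | .E => []
  | .D x => D x

theorem words_cons (t : Token H) (l : List (Token H)) :
    words (t :: l) = t.1.map .inl ++ .inr t.2 :: words l := by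
  simp [words, Token.word]

theorem length_words_cons (t : Token H) (l : List (Token H)) :
    (words (t :: l)).length = t.1.length + (words l).length + 1 := by
  simp [words_cons]
  omega

theorem length_le_length_words (l : List (Token H)) : l.length ≤ (words l).length := by
  induction l with
  | nil => exact le_rfl
  | cons t l ih =>
    rw [length_words_cons, List.length_cons]
    omega

theorem head_words {l : List (Token H)} : (words l).head?.isSome = !l.isEmpty := by
  cases l with
  | nil => rfl
  | cons t l =>
    rw [words_cons]
    rcases t with ⟨_ | _, _⟩ <;> rfl

theorem isBit_of_mem_map {l : List Bool} {s : Sym H} (h : s ∈ l.map Sum.inl) :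
    isBit (some s) = true := by
  obtain ⟨b, -, rfl⟩ := List.mem_map.1 h
  rfl

section Compare

variable [DecidableEq H]

/-- Read the first symbol of a stack into the second register. -/
def peek₂ (a : Stk X) : TCmd H X Q := .peek a fun v s => { v with c₂ := s }

/-- Move the bits on top of two stacks to an auxiliary stack as long as they agree. -/
def compareLoop (a b : Stk X) : TCmd H X Q :=
  .loop (fun v => isBit v.c₁ && decide (v.c₁ = v.c₂))
    (.seq (pop₁ a) (.seq (.pop b fun v _ => v) (.seq (push₁ .E) (.seq (peek₁ a) (peek₂ b)))))

/-- Compare the bits on top of two stacks, and set a flag. -/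
def compare (a b : Stk X) (x : X) : TCmd H X Q :=
  .seq (peek₁ a) (.seq (peek₂ b) (.seq (compareLoop a b)
    (.seq (.load fun v =>
        ⟨none, none, Function.update v.fl x (!isBit v.c₁ && !isBit v.c₂), v.q, v.a⟩)
      (spill Option.isSome .E [a, b]))))

/-- The loop removes the longest common prefix of the bits. Both bit strings are followed by a
header, so they are equal exactly if neither stack then shows a bit. -/
theorem exec_compare_loop {a b : Stk X} (hab : a ≠ b) (ha : a ≠ .E) (hb : b ≠ .E)
    {l₁ l₂ : List Bool} {r₁ r₂ : List (Sym H)} {h₁ h₂ : H} {bl : Bool}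
    (hS₁ : S a = l₁.map .inl ++ .inr h₁ :: r₁) (hS₂ : S b = l₂.map .inl ++ .inr h₂ :: r₂) :
    ∃ l s₁ s₂, S a = l ++ s₁ ∧ S b = l ++ s₂ ∧
      (!isBit s₁.head? && !isBit s₂.head?) = decide (l₁ = l₂) ∧ l.length ≤ l₂.length ∧
      Exec (compareLoop a b)
        ⟨(S a).head?, (S b).head?, fl, q, bl⟩ S
        ⟨s₁.head?, s₂.head?, fl, q, bl⟩
        (Function.update (Function.update (Function.update S a s₁) b s₂) .E (l.reverse ++ S .E))
        (6 * l.length + 1) := by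
  have done_of : ∀ (S : Stk X → List (Sym H)) (c₁ c₂ : Option (Sym H)), (isBit c₁ && decide (c₁ = c₂)) = false →
      Exec (compareLoop a b)
        ⟨c₁, c₂, fl, q, bl⟩ S ⟨c₁, c₂, fl, q, bl⟩
        (Function.update (Function.update (Function.update S a (S a)) b (S b)) .E
          (([] : List (Sym H)).reverse ++ S .E)) 1 := by
    intro S c₁ c₂ h
    refine Exec.congr (exec_loop_done (p := fun v : Ctl H X Q => isBit v.c₁ && decide (v.c₁ = v.c₂))
      h) rfl ?_ le_rfl
    simp
  induction l₁ generalizing S l₂ with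
  | nil =>
    refine ⟨[], S a, S b, rfl, rfl, ?_, Nat.zero_le _, done_of _ _ _ ?_⟩
    · rw [hS₁, hS₂]
      cases l₂ <;> simp [isBit]
    · rw [hS₁]
      rfl
  | cons b₁ l₁ ih =>
    cases l₂ with
    | nil =>
      refine ⟨[], S a, S b, rfl, rfl, ?_, Nat.zero_le _, done_of _ _ _ ?_⟩
      · rw [hS₁, hS₂]
        simp [isBit]
      · rw [hS₁, hS₂]
        simp
    | cons b₂ l₂ =>
      by_cases hbb : b₁ = b₂
      · subst hbb
        obtain ⟨t₁, ht₁⟩ : ∃ t : List (Sym H), t = l₁.map .inl ++ .inr h₁ :: r₁ := ⟨_, rfl⟩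
        obtain ⟨t₂, ht₂⟩ : ∃ t : List (Sym H), t = l₂.map .inl ++ .inr h₂ :: r₂ := ⟨_, rfl⟩
        rw [List.map_cons, List.cons_append, ← ht₁] at hS₁
        rw [List.map_cons, List.cons_append, ← ht₂] at hS₂
        obtain ⟨S', hS'⟩ : ∃ S', S' = Function.update (Function.update (Function.update S a t₁) b t₂)
          .E (.inl b₁ :: S .E) := ⟨_, rfl⟩
        have ea : S' a = t₁ := by simp [hS', ha, hab]
        have eb : S' b = t₂ := by simp [hS', hb]
        have hbody : Exec (.seq (pop₁ a) (.seq (.pop b fun v _ => v) (.seq (push₁ .E)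
            (.seq (peek₁ a) (peek₂ b))))) ⟨some (.inl b₁), some (.inl b₁), fl, q, bl⟩ S
            ⟨t₁.head?, t₂.head?, fl, q, bl⟩ S' 5 := by
          refine (exec_pop.seq (exec_pop.seq (exec_push.seq (exec_peek.seq exec_peek)))).congr
            ?_ ?_ le_rfl
          · simp [hS₁, hS₂, hab, hab.symm, ha, hb, ha.symm, hb.symm]
          · simp [hS₁, hS₂, hab.symm, ha.symm, hb.symm, hS']
        obtain ⟨l, s₁, s₂, e₁, e₂, hd, hl, h⟩ := ih (S := S') (l₂ := l₂) (ea.trans ht₁)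
          (eb.trans ht₂)
        rw [ea] at e₁ h
        rw [eb] at e₂ h
        refine ⟨.inl b₁ :: l, s₁, s₂, ?_, ?_, ?_, ?_, ?_⟩
        · rw [hS₁, e₁, List.cons_append]
        · rw [hS₂, e₂, List.cons_append]
        · rw [hd]
          simp
        · simpa using hl
        · rw [hS₁, hS₂]
          refine (Exec.loop_step (p := fun v : Ctl H X Q => isBit v.c₁ && decide (v.c₁ = v.c₂))
            (by simp [isBit]) hbody h).congr rfl ?_ ?_
          · funext j
            rw [hS']
            by_cases hE' : j = .E
            · subst hE'
              simp
            · by_cases hjb : j = b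
              · subst hjb
                simp [hb]
              · by_cases hja : j = a
                · subst hja
                  simp [hab, ha]
                · simp [hE', hja, hjb]
          · rw [List.length_cons]
            omega
      · refine ⟨[], S a, S b, rfl, rfl, ?_, Nat.zero_le _, done_of _ _ _ ?_⟩
        · rw [hS₁, hS₂]
          simp [isBit, hbb]
        · rw [hS₁, hS₂]
          simp [hbb]

/-- The common prefix, parked on `E`, is poured back onto both stacks, so the comparison leaves no
trace but the flag. Its cost depends only on the second string, the value of a register. -/
theorem exec_compare {a b : Stk X} (hab : a ≠ b) (ha : a ≠ .E) (hb : b ≠ .E) {x : X}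
    {l₁ l₂ : List Bool} {r₁ r₂ : List (Sym H)} {h₁ h₂ : H} {bl : Bool}
    (hS₁ : S a = l₁.map .inl ++ .inr h₁ :: r₁) (hS₂ : S b = l₂.map .inl ++ .inr h₂ :: r₂)
    (hE : S .E = []) :
    Exec (compare a b x) ⟨c₁, c₂, fl, q, bl⟩ S
      ⟨none, none, Function.update fl x (decide (l₁ = l₂)), q, bl⟩ S (12 * l₂.length + 7) := by
  obtain ⟨l, s₁, s₂, e₁, e₂, hd, hl, h⟩ := exec_compare_loop (fl := fl) (q := q) (bl := bl)
    hab ha hb hS₁ hS₂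
  rw [← hd]
  have h' := exec_spill (Q := Q) (c₁ := none) (c₂ := none)
    (fl := Function.update fl x (!isBit s₁.head? && !isBit s₂.head?)) (q := q) (b := bl)
    (p := Option.isSome) (a := Stk.E) (bs := [a, b]) (by simp [hab]) (by simp [ha.symm, hb.symm])
    (l := l.reverse) (r := []) (fun _ _ => rfl) rfl
    (S := Function.update (Function.update (Function.update S a s₁) b s₂) .E (l.reverse ++ S .E))
    (by simp [hE])
  refine (exec_peek.seq (exec_peek.seq (h.seq (exec_load.seq h')))).congr rfl ?_ ?_
  · funext j
    by_cases hE' : j = .E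
    · subst hE'
      simp [hE]
    · by_cases hja : j = a
      · subst hja
        simp [prepend, e₁, hab, ha]
      · by_cases hjb : j = b
        · subst hjb
          simp [prepend, e₂, hb]
        · simp [prepend, hE', hja, hjb]
  · simp only [List.length_cons, List.length_nil, List.length_reverse]
    omega

end Compare

section Program

/-- What a program does with a list of tokens `F` and a valuation of `X`: it scans `F` with a finite
automaton that sees the headers and which elements of `X` have the bits of the token as their value,
and adds tokens to `F` depending on the final state. -/
structure TokenProgram (H X Q : Type) where
  init : Q
  trans : Q → H → (X → Bool) → Q
  emits : List ((Q → Bool) × H × X)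
  acc : Q → Bool

variable [DecidableEq H]

namespace TokenProgram

variable (P : TokenProgram H X Q)

/-- The state of the automaton after a scan. -/
def scan (Z : X → List Bool) (F : List (Token H)) (q : Q) : Q :=
  F.foldl (fun q t => P.trans q t.2 fun x => decide (t.1 = Z x)) q

/-- Add a token if the state has a property. -/
def emit (Z : X → List Bool) (q : Q) (F : List (Token H)) (e : (Q → Bool) × H × X) :
    List (Token H) :=
  if e.1 q then (Z e.2.2, e.2.1) :: F else F

/-- One round for a valuation. -/
def step (s : List (Token H) × Bool) (Z : X → List Bool) : List (Token H) × Bool :=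
  (P.emits.foldl (emit Z (P.scan Z s.1 P.init)) s.1, s.2 || P.acc (P.scan Z s.1 P.init))

/-- The program that reads a token. -/
def tokenCmd (xs : List X) : TCmd H X Q :=
  .seq (seqs (xs.map fun x => compare .F (.D x) x))
    (.seq (spill isBit .F [.G]) (.seq (pop₁ .F) (.seq (push₁ .G)
      (.seq (.load fun v =>
          { v with q := (v.c₁.bind Sum.getRight?).elim v.q (P.trans v.q · v.fl), c₁ := none })
        (peek₁ .F)))))

/-- The program for a scan. -/
def scanCmd (xs : List X) : TCmd H X Q :=
  .seq (peek₁ .F) (.seq (.loop (fun v => v.c₁.isSome) (P.tokenCmd xs))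
    (.seq (.load fun v => { v with c₁ := none, c₂ := none, fl := fun _ => false })
      (spill Option.isSome .G [.F])))

/-- The program that possibly adds a token. -/
def emitCmd (e : (Q → Bool) × H × X) : TCmd H X Q :=
  .ite (fun v => e.1 v.q) (.seq (.push .F fun _ => .inr e.2.1)
    (.seq (spill isBit (.D e.2.2) [.E]) (spill Option.isSome .E [.D e.2.2, .F]))) skip

/-- The program for a round. -/
def stepCmd (xs : List X) : TCmd H X Q :=
  .seq (P.scanCmd xs) (.seq (seqs (P.emits.map emitCmd))
    (.load fun v => { v with q := P.init, a := v.a || P.acc v.q }))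

/-- Nested loops over all values of the elements in a list that are bits of tokens in `W`. -/
def loopCmd (xs : List X) : List X → TCmd H X Q
  | [] => P.stepCmd xs
  | x :: vs => .seq (spill Option.isSome .W [.E]) (.seq (spill Option.isSome .E [.W, .D x])
      (.seq (peek₁ (.D x)) (.seq (.loop (fun v => v.c₁.isSome)
        (.seq clear₁ (.seq (loopCmd xs vs)
          (.seq (spill isBit (.D x) []) (.seq (pop₁ (.D x)) (peek₁ (.D x)))))))
        clear₁)))

/-- The valuations that these loops go through, starting from `Z`. -/
def valuations (W : List (Token H)) : List X → (X → List Bool) → List (X → List Bool)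
  | [], Z => [Z]
  | x :: vs, Z => W.flatMap fun t => valuations W vs (Function.update Z x t.1)

omit [DecidableEq H] in
theorem length_valuations (W : List (Token H)) (vs : List X) (Z : X → List Bool) :
    (valuations W vs Z).length = W.length ^ vs.length := by
  induction vs generalizing Z with
  | nil => rfl
  | cons x vs ih =>
    simp only [valuations, List.length_flatMap, ih, List.map_const', List.sum_replicate,
      List.length_cons, smul_eq_mul]
    ring

/-- A bound for the number of steps of a round. -/
def stepCost (k L M : ℕ) : ℕ := M * (k * (12 * L + 7) + 14) + P.emits.length * (11 * L + 8) + 8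

/-- A bound for the number of steps of nested loops. -/
def loopCost (k L M : ℕ) : ℕ → ℕ
  | 0 => P.stepCost k L M
  | n + 1 => L * (loopCost k L M n + 4 * L + 7) + 11 * L + 9

end TokenProgram

variable {W G : List (Sym H)} {F : List (Token H)} {D : X → List (Token H)} {L : ℕ}

theorem exec_compares {t : Token H} (hD : ∀ x, D x ≠ []) (hL : ∀ x, (val D x).length ≤ L)
    (xs : List X) : ∃ c₁' c₂', Exec (seqs (xs.map fun x => compare .F (.D x) x))
      ⟨c₁, c₂, fl, q, b⟩ (conf W (words (t :: F)) G fun x => words (D x))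
      ⟨c₁', c₂', fun x => if x ∈ xs then decide (t.1 = val D x) else fl x, q, b⟩
      (conf W (words (t :: F)) G fun x => words (D x)) (xs.length * (12 * L + 7) + 1) := by
  induction xs generalizing fl c₁ c₂ with
  | nil => exact ⟨c₁, c₂, exec_load.congr (by simp) rfl (by simp)⟩
  | cons x xs ih =>
    obtain ⟨t', r, hr⟩ := List.exists_cons_of_ne_nil (hD x)
    obtain ⟨c₁', c₂', h⟩ := ih (c₁ := none) (c₂ := none)
      (fl := Function.update fl x (decide (t.1 = val D x)))
    have h' := exec_compare (a := Stk.F) (b := Stk.D x) (x := x) (c₁ := c₁) (c₂ := c₂) (fl := fl)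
      (q := q) (bl := b) (S := conf W (words (t :: F)) G fun x => words (D x)) (by simp) (by simp)
      (by simp) (words_cons t F) (show words (D x) = _ by rw [hr]; exact words_cons t' r) rfl
    rw [val_eq hr] at h
    refine ⟨c₁', c₂', (h'.seq h).congr ?_ rfl ?_⟩
    · ext y <;> try rfl
      by_cases hy : y = x
      · subst hy
        simp [val_eq hr]
      · simp [hy]
    · have := hL x
      rw [val_eq hr] at this
      rw [List.length_cons, Nat.add_mul]
      omega

theorem exec_tokenCmd (P : TokenProgram H X Q) {t : Token H} {xs : List X} (hxs : ∀ x, x ∈ xs)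
    (hD : ∀ x, D x ≠ []) (hL : ∀ x, (val D x).length ≤ L) :
    ∃ c₂', Exec (P.tokenCmd xs)
      ⟨c₁, c₂, fl, q, b⟩ (conf W (words (t :: F)) G fun x => words (D x))
      ⟨(words F).head?, c₂', fun x => decide (t.1 = val D x),
        P.trans q t.2 fun x => decide (t.1 = val D x), b⟩
      (conf W (words F) (t.word.reverse ++ G) fun x => words (D x))
      (xs.length * (12 * L + 7) + 1 + (5 * t.1.length + 7)) := by
  obtain ⟨c₁', c₂', h⟩ := exec_compares (c₁ := c₁) (c₂ := c₂) (fl := fl) (q := q) (b := b) (W := W)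
    (G := G) (F := F) (t := t) hD hL xs
  have h₂ := exec_spill (c₁ := c₁') (c₂ := c₂') (q := q) (b := b) (p := isBit) (a := Stk.F)
    (bs := [.G]) (by simp) (by simp) (l := t.1.map .inl) (r := .inr t.2 :: words F)
    (fun s hs => isBit_of_mem_map hs) rfl (S := conf W (words (t :: F)) G fun x => words (D x))
    (fl := fun x => if x ∈ xs then decide (t.1 = val D x) else fl x) (words_cons t F)
  refine ⟨c₂', (h.seq (h₂.seq (exec_pop.seq (exec_push.seq (exec_load.seq exec_peek))))).congr
    ?_ ?_ ?_⟩
  · simp [hxs]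
  · funext j
    cases j <;> simp [conf, prepend, Token.word]
  · simp only [List.length_map, List.length_cons, List.length_nil]
    omega

/-- The facts pass from `F` to `G` token by token and are poured back in reverse, which restores
`F`. -/
theorem exec_scanCmd (P : TokenProgram H X Q) {xs : List X} (hxs : ∀ x, x ∈ xs)
    (hD : ∀ x, D x ≠ []) (hL : ∀ x, (val D x).length ≤ L) :
    Exec (P.scanCmd xs) ⟨c₁, c₂, fl, q, b⟩ (conf W (words F) [] fun x => words (D x))
      ⟨none, none, fun _ => false, P.scan (val D) F q, b⟩
      (conf W (words F) [] fun x => words (D x))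
      ((words F).length * (xs.length * (12 * L + 7) + 14) + 6) := by
  have key : ∀ (F : List (Token H)) (G : List (Sym H)) (c₂ : Option (Sym H)) (fl : X → Bool) (q : Q),
      ∃ c₂' fl', Exec (.loop (fun v => v.c₁.isSome) (P.tokenCmd xs))
        ⟨(words F).head?, c₂, fl, q, b⟩ (conf W (words F) G fun x => words (D x))
        ⟨none, c₂', fl', P.scan (val D) F q, b⟩
        (conf W [] ((words F).reverse ++ G) fun x => words (D x))
        ((words F).length * (xs.length * (12 * L + 7) + 9) + 1) := by
    intro F
    induction F with
    | nil => exact fun G c₂ fl q => ⟨c₂, fl, (exec_loop_done rfl).mono (by omega)⟩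
    | cons t F ih =>
      intro G c₂ fl q
      obtain ⟨c', h⟩ := exec_tokenCmd P (c₁ := (words (t :: F)).head?) (c₂ := c₂) (fl := fl) (q := q)
        (b := b) (W := W) (G := G) (F := F) (t := t) hxs hD hL
      obtain ⟨c₂', fl', h'⟩ := ih (t.word.reverse ++ G) c' _
        (P.trans q t.2 fun x => decide (t.1 = val D x))
      refine ⟨c₂', fl', (Exec.loop_step (p := fun v : Ctl H X Q => v.c₁.isSome) ?_ h h').congr rfl
        ?_ ?_⟩
      · exact head_words
      · simp [words, Token.word]
      · rw [length_words_cons]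
        simp only [Nat.add_mul, Nat.mul_add]
        nlinarith [Nat.zero_le (t.1.length * (xs.length * (12 * L))),
          Nat.zero_le (t.1.length * xs.length)]
  obtain ⟨c', fl', h⟩ := key F [] c₂ fl q
  have h₂ := exec_spill (c₁ := none) (c₂ := none) (fl := fun _ => false) (q := P.scan (val D) F q)
    (b := b) (p := Option.isSome) (a := Stk.G) (bs := [.F]) (by simp) (by simp)
    (l := (words F).reverse) (r := []) (fun _ _ => rfl) rfl
    (S := conf W [] ((words F).reverse ++ []) fun x => words (D x)) rfl
  refine (exec_peek.seq (h.seq (exec_load.seq h₂))).congr rfl ?_ ?_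
  · funext j
    cases j <;> simp [conf, prepend]
  · simp only [List.length_reverse, List.length_cons, List.length_nil, Nat.mul_add]
    omega

-- The header is pushed before the bits because it lies below them. The bits of the register go to
-- `E` and from there to both `F` and the register, which is thereby restored.
omit [DecidableEq H] in
theorem exec_emitCmd {e : (Q → Bool) × H × X} (hD : ∀ x, D x ≠ [])
    (hL : ∀ x, (val D x).length ≤ L) :
    Exec (TokenProgram.emitCmd e) ⟨none, c₂, fl, q, b⟩ (conf W (words F) [] fun x => words (D x))
      ⟨none, c₂, fl, q, b⟩
      (conf W (words (TokenProgram.emit (val D) q F e)) [] fun x => words (D x))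
      (11 * L + 8) := by
  obtain ⟨f, h, x⟩ := e
  obtain ⟨t, r, hr⟩ := List.exists_cons_of_ne_nil (hD x)
  by_cases hf : f q = true
  · have h₁ := exec_spill (c₁ := none) (c₂ := c₂) (fl := fl) (q := q)
      (b := b) (p := isBit) (a := Stk.D x) (bs := [.E]) (by simp) (by simp)
      (l := t.1.map .inl) (r := .inr t.2 :: words r) (fun _ hs => isBit_of_mem_map hs) rfl
      (S := conf W (.inr h :: words F) [] fun x => words (D x))
      (show words (D x) = _ by rw [hr]; exact words_cons t r)
    have h₂ := exec_spill (c₁ := none) (c₂ := c₂) (fl := fl) (q := q)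
      (b := b) (p := Option.isSome) (a := Stk.E) (bs := [.D x, .F]) (by simp) (by simp)
      (l := (t.1.map .inl).reverse) (r := []) (fun _ _ => rfl) rfl
      (S := Function.update (prepend (t.1.map .inl).reverse [.E]
        (conf W (.inr h :: words F) [] fun x => words (D x))) (.D x) (.inr t.2 :: words r))
      (by simp [prepend, conf])
    have h₀ : Exec (Cmd.push (σ := Ctl H X Q) Stk.F fun _ => Sum.inr h) ⟨none, c₂, fl, q, b⟩
        (conf W (words F) [] fun x => words (D x)) ⟨none, c₂, fl, q, b⟩
        (conf W (.inr h :: words F) [] fun x => words (D x)) 1 := by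
      refine exec_push.congr rfl ?_ le_rfl
      funext j
      cases j <;> simp [conf]
    refine Exec.congr (Exec.ite_true (p := fun v : Ctl H X Q => f v.q) hf
      (h₀.seq (h₁.seq h₂))) rfl ?_ ?_
    · funext j
      have he : TokenProgram.emit (val D) q F (f, h, x) = (t.1, h) :: F := by
        simp [TokenProgram.emit, hf, val_eq hr]
      rw [he]
      cases j with
      | D y =>
        by_cases hy : y = x
        · subst hy
          simp [conf, prepend, hr, words_cons]
        · simp [conf, prepend, hy]
      | _ => simp [conf, prepend, words_cons]
    · have := hL x
      rw [val_eq hr] at this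
      simp only [List.length_reverse, List.length_cons, List.length_nil, List.length_map]
      omega
  · have hf' : f q = false := by simpa using hf
    refine Exec.congr (Exec.ite_false (p := fun v : Ctl H X Q => f v.q) hf' exec_load) rfl ?_
      (by omega)
    rw [TokenProgram.emit, if_neg (by simpa using hf)]

open TokenProgram

theorem exec_stepCmd (P : TokenProgram H X Q) {xs : List X} (hxs : ∀ x, x ∈ xs)
    (hD : ∀ x, D x ≠ []) (hL : ∀ x, (val D x).length ≤ L) {M : ℕ} (hF : (words F).length ≤ M) :
    Exec (P.stepCmd xs) ⟨none, none, fun _ => false, P.init, b⟩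
      (conf W (words F) [] fun x => words (D x))
      ⟨none, none, fun _ => false, P.init, (P.step (F, b) (val D)).2⟩
      (conf W (words (P.step (F, b) (val D)).1) [] fun x => words (D x))
      (P.stepCost xs.length L M) := by
  have key : ∀ (es : List ((Q → Bool) × H × X)) (F : List (Token H)) (q : Q),
      Exec (seqs (es.map emitCmd)) ⟨none, none, fun _ => false, q, b⟩
        (conf W (words F) [] fun x => words (D x)) ⟨none, none, fun _ => false, q, b⟩
        (conf W (words (es.foldl (emit (val D) q) F)) [] fun x => words (D x))
        (es.length * (11 * L + 8) + 1) := by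
    intro es
    induction es with
    | nil => exact fun F q => exec_load.mono (by omega)
    | cons e es ih =>
      intro F q
      refine ((exec_emitCmd hD hL).seq (ih _ q)).mono ?_
      rw [List.length_cons, Nat.add_mul]
      omega
  refine ((exec_scanCmd P hxs hD hL).seq ((key P.emits F _).seq exec_load)).mono ?_
  have := Nat.mul_le_mul_right (xs.length * (12 * L + 7) + 14) hF
  rw [stepCost]
  omega

-- Each added token has at most `L` bits and one header, since its bits are the value of a register.
omit [DecidableEq X] [DecidableEq H] in
theorem length_words_step (P : TokenProgram H X Q) {Z : X → List Bool}
    (hL : ∀ x, (Z x).length ≤ L) (s : List (Token H) × Bool) :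
    (words (P.step s Z).1).length ≤ (words s.1).length + P.emits.length * (L + 1) := by
  have key : ∀ (es : List ((Q → Bool) × H × X)) (F : List (Token H)) (q : Q),
      (words (es.foldl (emit Z q) F)).length ≤ (words F).length + es.length * (L + 1) := by
    intro es
    induction es with
    | nil => exact fun F q => Nat.le_add_right ..
    | cons e es ih =>
      intro F q
      refine (ih _ q).trans ?_
      have : (words (emit Z q F e)).length ≤ (words F).length + (L + 1) := by
        rw [emit]
        split
        · rw [length_words_cons]
          have := hL e.2.2
          change (Z e.2.2).length + _ + 1 ≤ _
          omega
        · omega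
      rw [List.length_cons, Nat.add_mul]
      omega
  exact key _ _ _

omit [DecidableEq H] in
theorem val_update {x : X} {t : Token H} {r : List (Token H)} :
    val (Function.update D x (t :: r)) = Function.update (val D) x t.1 := by
  funext y
  by_cases hy : y = x
  · subst hy
    simp [val]
  · simp [val, hy]

omit [DecidableEq H] in
theorem length_valuations_le {W : List (Token H)} (hW : ∀ t ∈ W, t.1.length ≤ L) {vs : List X}
    {Z : X → List Bool} (hZ : ∀ x ∉ vs, (Z x).length ≤ L) {Z' : X → List Bool}
    (hZ' : Z' ∈ valuations W vs Z) (x : X) : (Z' x).length ≤ L := by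
  induction vs generalizing Z with
  | nil =>
    rw [valuations, List.mem_singleton] at hZ'
    rw [hZ']
    exact hZ x List.not_mem_nil
  | cons y vs ih =>
    obtain ⟨t, ht, h⟩ := List.mem_flatMap.1 hZ'
    refine ih (fun x hx => ?_) h
    by_cases hxy : x = y
    · subst hxy
      simpa using hW t ht
    · simpa [hxy] using hZ x (by simp [hxy, hx])

omit [DecidableEq X] [DecidableEq H] in
theorem length_words_foldl (P : TokenProgram H X Q) {Zs : List (X → List Bool)}
    (hL : ∀ Z ∈ Zs, ∀ x, (Z x).length ≤ L) (s : List (Token H) × Bool) :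
    (words (Zs.foldl P.step s).1).length ≤
      (words s.1).length + Zs.length * (P.emits.length * (L + 1)) := by
  induction Zs generalizing s with
  | nil => exact Nat.le_add_right ..
  | cons Z Zs ih =>
    refine (ih (fun Z hZ => hL Z (List.mem_cons_of_mem _ hZ)) _).trans ?_
    have := length_words_step P (hL Z List.mem_cons_self) s
    rw [List.length_cons, Nat.add_mul (Zs.length)]
    omega

/-- The stacks of the registers still to be looped over are empty and are filled with a copy of the
input. The current value is on top and one token is dropped per iteration, so a finished loop leaves
its stack empty again. The hypothesis on `M` reserves room for all facts that the remaining
iterations can add. -/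
theorem exec_loopCmd (P : TokenProgram H X Q) {xs : List X} (hxs : ∀ x, x ∈ xs)
    {W : List (Token H)} (hW : ∀ t ∈ W, t.1.length ≤ L) (hWL : (words W).length ≤ L) {M : ℕ}
    {vs : List X} (hvs : vs.Nodup) (hD : ∀ x, x ∈ vs ↔ D x = [])
    (hL : ∀ x, (val D x).length ≤ L)
    (hF : (words F).length + W.length ^ vs.length * (P.emits.length * (L + 1)) ≤ M) :
    Exec (P.loopCmd xs vs) ⟨none, none, fun _ => false, P.init, b⟩
      (conf (words W) (words F) [] fun x => words (D x))
      ⟨none, none, fun _ => false, P.init, ((valuations W vs (val D)).foldl P.step (F, b)).2⟩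
      (conf (words W) (words ((valuations W vs (val D)).foldl P.step (F, b)).1) []
        fun x => words (D x))
      (P.loopCost xs.length L M vs.length) := by
  induction vs generalizing D F b with
  | nil => exact exec_stepCmd P hxs (fun x h => List.not_mem_nil ((hD x).2 h)) hL (by omega)
  | cons x vs ih =>
    have hvs' := List.nodup_cons.1 hvs
    have hDx : D x = [] := (hD x).1 List.mem_cons_self
    have key : ∀ (R : List (Token H)) (F : List (Token H)) (b : Bool), (∀ t ∈ R, t ∈ W) →
        (words F).length + R.length * W.length ^ vs.length * (P.emits.length * (L + 1)) ≤ M →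
        Exec (.loop (fun v => v.c₁.isSome)
            (.seq clear₁ (.seq (P.loopCmd xs vs)
              (.seq (spill isBit (.D x) []) (.seq (pop₁ (.D x)) (peek₁ (.D x)))))))
          ⟨(words R).head?, none, fun _ => false, P.init, b⟩
          (conf (words W) (words F) [] fun y => words (Function.update D x R y))
          ⟨none, none, fun _ => false, P.init, ((R.flatMap fun t =>
            valuations W vs (Function.update (val D) x t.1)).foldl P.step (F, b)).2⟩
          (conf (words W) (words ((R.flatMap fun t =>
            valuations W vs (Function.update (val D) x t.1)).foldl P.step (F, b)).1) []
            fun y => words (D y))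
          (R.length * (P.loopCost xs.length L M vs.length + 4 * L + 7) + 1) := by
      intro R
      induction R with
      | nil =>
        intro F b _ _
        refine Exec.congr (exec_loop_done rfl) rfl ?_ (by omega)
        rw [show Function.update D x [] = D by rw [← hDx, Function.update_eq_self]]
        rfl
      | cons t R ihR =>
        intro F b hR hM
        -- The growth caused by the current value is charged against `M`; what remains covers the
        -- rest `R`.
        have hbound := length_words_foldl P (L := L)
          (Zs := valuations W vs (Function.update (val D) x t.1)) (fun Z hZ y => by
            refine length_valuations_le hW (fun z _ => ?_) hZ y
            by_cases hz : z = x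
            · subst hz
              simpa using hW t (hR t List.mem_cons_self)
            · simpa [hz] using hL z) (F, b)
        rw [length_valuations] at hbound
        dsimp only at hbound
        rw [List.length_cons, Nat.add_mul, Nat.add_mul, Nat.one_mul] at hM
        have h₁ := ih (D := Function.update D x (t :: R)) (F := F) (b := b) hvs'.2 (fun y => by
            by_cases hy : y = x
            · subst hy
              simp [hvs'.1]
            · simp [hy, ← hD y])
          (fun y => by
            rw [val_update]
            by_cases hy : y = x
            · subst hy
              simpa using hW t (hR t List.mem_cons_self)
            · simpa [hy] using hL y) (by omega)
        rw [val_update] at h₁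
        have h₂ := exec_spill (c₁ := none) (c₂ := none) (fl := fun _ => false) (q := P.init)
          (b := ((valuations W vs (Function.update (val D) x t.1)).foldl P.step (F, b)).2)
          (p := isBit) (a := Stk.D x) (bs := []) (by simp) (by simp)
          (l := t.1.map .inl) (r := .inr t.2 :: words R) (fun _ hs => isBit_of_mem_map hs) rfl
          (S := conf (words W) (words ((valuations W vs
            (Function.update (val D) x t.1)).foldl P.step (F, b)).1) []
            fun y => words (Function.update D x (t :: R) y))
          (show words _ = _ by rw [Function.update_self, words_cons])
        have h₃ := ihR ((valuations W vs (Function.update (val D) x t.1)).foldl P.step (F, b)).1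
          ((valuations W vs (Function.update (val D) x t.1)).foldl P.step (F, b)).2
          (fun t' ht' => hR t' (List.mem_cons_of_mem _ ht')) (by omega)
        have h₄ : Exec (.seq clear₁ (.seq (P.loopCmd xs vs)
              (.seq (spill isBit (.D x) []) (.seq (pop₁ (.D x)) (peek₁ (.D x))))))
            ⟨(words (t :: R)).head?, none, fun _ => false, P.init, b⟩
            (conf (words W) (words F) [] fun y => words (Function.update D x (t :: R) y))
            ⟨(words R).head?, none, fun _ => false, P.init,
              ((valuations W vs (Function.update (val D) x t.1)).foldl P.step (F, b)).2⟩
            (conf (words W) (words ((valuations W vs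
              (Function.update (val D) x t.1)).foldl P.step (F, b)).1) []
              fun y => words (Function.update D x R y))
            (P.loopCost xs.length L M vs.length + 4 * L + 6) := by
          refine (exec_load.seq (h₁.seq (h₂.seq (exec_pop.seq exec_peek)))).congr ?_ ?_ ?_
          · simp
          · funext j
            cases j with
            | D y =>
              by_cases hy : y = x
              · subst hy
                simp [conf]
              · simp [conf, prepend, hy]
            | _ => simp [conf, prepend]
          · have := hW t (hR t List.mem_cons_self)
            simp only [List.length_nil, List.length_map]
            omega
        refine (Exec.loop_step (p := fun v : Ctl H X Q => v.c₁.isSome) head_words h₄ h₃).congr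
          ?_ ?_ ?_
        · rw [List.flatMap_cons, List.foldl_append]
        · rw [List.flatMap_cons, List.foldl_append]
        · rw [List.length_cons, Nat.add_mul]
          omega
    have h₁ := exec_spill (c₁ := none) (c₂ := none) (fl := fun _ => false) (q := P.init)
      (b := b) (p := Option.isSome) (a := Stk.W) (bs := [.E]) (by simp) (by simp)
      (l := words W) (r := []) (fun _ _ => rfl) rfl
      (S := conf (words W) (words F) [] fun x => words (D x)) (by simp [conf])
    have h₂ := exec_spill (c₁ := none) (c₂ := none) (fl := fun _ => false) (q := P.init)
      (b := b) (p := Option.isSome) (a := Stk.E) (bs := [.W, .D x]) (by simp) (by simp)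
      (l := (words W).reverse) (r := []) (fun _ _ => rfl) rfl
      (S := Function.update (prepend (words W).reverse [.E]
        (conf (words W) (words F) [] fun x => words (D x))) .W []) (by simp [conf, prepend])
    have e : Function.update (prepend (words W).reverse.reverse [.W, .D x]
        (Function.update (prepend (words W).reverse [.E]
          (conf (words W) (words F) [] fun x => words (D x))) .W [])) .E [] =
        conf (words W) (words F) [] fun y => words (Function.update D x W y) := by
      funext j
      cases j with
      | D y =>
        by_cases hy : y = x
        · subst hy
          simp [conf, prepend, hDx, words]
        · simp [conf, prepend, hy]
      | _ => simp [conf, prepend]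
    rw [e] at h₂
    have h₃ : Exec (peek₁ (.D x)) ⟨none, none, fun _ => false, P.init, b⟩
        (conf (words W) (words F) [] fun y => words (Function.update D x W y))
        ⟨(words W).head?, none, fun _ => false, P.init, b⟩
        (conf (words W) (words F) [] fun y => words (Function.update D x W y)) 1 :=
      exec_peek.congr (by simp [conf]) rfl le_rfl
    have h₄ := key W F b (fun _ h => h) (by rwa [List.length_cons, pow_succ'] at hF)
    refine (h₁.seq (h₂.seq (h₃.seq (h₄.seq exec_load)))).mono ?_
    have hT : W.length ≤ L := (length_le_length_words W).trans hWL
    have := Nat.mul_le_mul_right (P.loopCost xs.length L M vs.length + 4 * L + 7) hT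
    simp only [List.length_cons, List.length_nil, List.length_reverse, loopCost]
    omega

/-- Push a word to a stack. -/
def pushWord (k : Stk X) (l : List (Sym H)) : TCmd H X Q := seqs (l.map fun s => .push k fun _ => s)

omit [DecidableEq H] in
theorem exec_pushWord {k : Stk X} {v : Ctl H X Q} (l : List (Sym H)) :
    Exec (pushWord k l) v S v (Function.update S k (l.reverse ++ S k)) (l.length + 1) := by
  induction l generalizing S with
  | nil => exact exec_load.congr rfl (by simp) (by simp)
  | cons s l ih =>
    refine (exec_push.seq ih).congr rfl ?_ (by rw [List.length_cons]; omega)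
    simp

omit [DecidableEq H] in
theorem exec_pushWords {D : X → List (Sym H)} {v : Ctl H X Q} {L : ℕ} (hL : ∀ x, (D x).length ≤ L)
    {xs : List X} (hxs : xs.Nodup) :
    Exec (seqs (xs.map fun x => pushWord (.D x) (D x).reverse)) v (conf W (words F) [] fun _ => [])
      v (conf W (words F) [] fun x => if x ∈ xs then D x else []) (xs.length * (L + 1) + 1) := by
  have key : ∀ (E : X → List (Sym H)), Exec
      (seqs (xs.map fun x => pushWord (.D x) (D x).reverse)) v (conf W (words F) [] E)
      v (conf W (words F) [] fun x => if x ∈ xs then D x ++ E x else E x)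
      (xs.length * (L + 1) + 1) := by
    induction xs with
    | nil => exact fun E => exec_load.congr rfl (by simp) (by simp)
    | cons x xs ih =>
      intro E
      have hx := List.nodup_cons.1 hxs
      have h₁ := exec_pushWord (k := .D x) (v := v) (S := conf W (words F) [] E) (D x).reverse
      have e : Function.update (conf W (words F) [] E) (.D x)
          ((D x).reverse.reverse ++ conf W (words F) [] E (.D x)) =
          conf W (words F) [] (Function.update E x (D x ++ E x)) := by
        funext j
        cases j with
        | D y =>
          by_cases hy : y = x
          · subst hy
            simp [conf]
          · simp [conf, hy]
        | _ => simp [conf]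
      rw [e] at h₁
      refine (h₁.seq (ih hx.2 _)).congr rfl ?_ ?_
      · congr 1
        funext y
        by_cases hy : y = x
        · subst hy
          simp [hx.1]
        · simp [hy]
      · have := hL x
        rw [List.length_cons, Nat.add_mul, List.length_reverse]
        omega
  refine (key fun _ => []).congr rfl ?_ le_rfl
  simp

omit [DecidableEq H] in
theorem exec_clear {M : ℕ} (hM : ∀ k, (S k).length ≤ M) (ks : List (Stk X)) :
    Exec (seqs (ks.map fun k => spill Option.isSome k [])) ⟨none, c₂, fl, q, b⟩ S
      ⟨none, c₂, fl, q, b⟩ (fun k => if k ∈ ks then [] else S k) (ks.length * (4 * M + 3) + 1) := by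
  induction ks generalizing S with
  | nil => exact exec_load.congr rfl (by simp) (by simp)
  | cons k ks ih =>
    have h := exec_spill (c₁ := none) (c₂ := c₂) (fl := fl) (q := q) (b := b) (p := Option.isSome)
      (a := k) (bs := []) (by simp) (by simp) (l := S k) (r := []) (fun _ _ => rfl) rfl
      (S := S) (by simp)
    refine (h.seq (ih fun j => ?_)).congr rfl ?_ ?_
    · by_cases hj : j = k
      · subst hj
        simp
      · simpa [hj, prepend] using hM j
    · funext j
      by_cases hj : j = k
      · subst hj
        simp
      · simp [hj, prepend]
    · have := hM k
      rw [List.length_cons, Nat.add_mul ks.length, List.length_nil]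
      omega

namespace TokenProgram

variable (P : TokenProgram H X Q)

/-- The whole program: it copies the input, pushes the given tokens to the stacks of the elements of
`X`, runs the nested loops for the elements in `vs`, and clears the stacks. -/
def mainCmd (xs vs : List X) (D : X → List (Token H)) : TCmd H X Q :=
  .seq (spill Option.isSome .W [.E]) (.seq (spill Option.isSome .E [.W, .F])
    (.seq (seqs (xs.map fun x => pushWord (.D x) (words (D x)).reverse)) (.seq (P.loopCmd xs vs)
      (seqs ((.W :: .F :: xs.map .D).map fun k => spill Option.isSome k [])))))

/-- A bound for the length of all words. -/
def size (v L : ℕ) : ℕ := L + L ^ v * (P.emits.length * (L + 1))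

/-- A bound for the number of steps. -/
def mainCost (k v L : ℕ) : ℕ :=
  11 * L + 6 + (k * (L + 1) + 1) + P.loopCost k L (P.size v L) v +
    ((k + 2) * (4 * P.size v L + 3) + 1)

/-- The answer. -/
def result (vs : List X) (D : X → List (Token H)) (W : List (Token H)) : Bool :=
  ((valuations W vs (val D)).foldl P.step (W, false)).2

end TokenProgram

/-- The original input `W` is kept as the source of loop values, while its copy `F` accumulates the
derived facts. -/
theorem exec_mainCmd (P : TokenProgram H X Q) {xs vs : List X} (hxs : ∀ x, x ∈ xs)
    (hxs' : xs.Nodup) (hvs : vs.Nodup) {D : X → List (Token H)} (hD : ∀ x, x ∈ vs ↔ D x = [])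
    (hL : ∀ x, (words (D x)).length ≤ L) {W : List (Token H)} (hW : (words W).length ≤ L) :
    Exec (P.mainCmd xs vs D) ⟨none, none, fun _ => false, P.init, false⟩
      (Function.update (fun _ => []) .W (words W))
      ⟨none, none, fun _ => false, P.init, P.result vs D W⟩ (fun _ => [])
      (P.mainCost xs.length vs.length L) := by
  have hWL : ∀ t ∈ W, t.1.length ≤ L := by
    intro t ht
    refine le_trans ?_ hW
    clear hW
    induction W with
    | nil => cases ht
    | cons s W ih =>
      rw [length_words_cons]
      rcases List.mem_cons.1 ht with rfl | h
      · omega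
      · have := ih h
        omega
  have hval : ∀ x, (val D x).length ≤ L := by
    intro x
    refine le_trans ?_ (hL x)
    rcases h : D x with _ | ⟨t, r⟩
    · simp [val, h]
    · rw [val_eq h, length_words_cons]
      omega
  have h₁ := exec_spill (c₁ := none) (c₂ := none) (fl := fun _ : X => false) (q := P.init)
    (b := false) (p := Option.isSome) (a := Stk.W) (bs := [.E]) (by simp) (by simp)
    (l := words W) (r := []) (fun _ _ => rfl) rfl
    (S := Function.update (fun _ => []) .W (words W)) (by simp)
  have h₂ := exec_spill (c₁ := none) (c₂ := none) (fl := fun _ : X => false) (q := P.init)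
    (b := false) (p := Option.isSome) (a := Stk.E) (bs := [.W, .F]) (by simp) (by simp)
    (l := (words W).reverse) (r := []) (fun _ _ => rfl) rfl
    (S := Function.update (prepend (words W).reverse [.E]
        (Function.update (fun _ => []) .W (words W))) .W []) (by simp [prepend])
  have e : Function.update (prepend (words W).reverse.reverse [.W, .F]
      (Function.update (prepend (words W).reverse [.E]
        (Function.update (fun _ => []) .W (words W))) .W [])) .E [] =
      conf (words W) (words W) [] fun _ : X => [] := by
    funext j
    cases j <;> simp [conf, prepend]
  rw [e] at h₂
  have h₃ := exec_pushWords (W := words W) (F := W) (D := fun x => words (D x))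
    (v := (⟨none, none, fun _ => false, P.init, false⟩ : Ctl H X Q)) hL hxs'
  simp only [hxs, if_true] at h₃
  have hT : W.length ^ vs.length * (P.emits.length * (L + 1)) ≤
      L ^ vs.length * (P.emits.length * (L + 1)) :=
    Nat.mul_le_mul_right _ (Nat.pow_le_pow_left ((length_le_length_words W).trans hW) _)
  have h₄ := exec_loopCmd P (F := W) (b := false) (M := P.size vs.length L) hxs hWL hW hvs hD hval
    (by rw [size]; omega)
  have hM := length_words_foldl P (L := L) (Zs := valuations W vs (val D))
    (fun Z hZ => length_valuations_le hWL (fun x _ => hval x) hZ) (W, false)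
  rw [length_valuations] at hM
  dsimp only at hM
  have h₅ := exec_clear (c₂ := none) (fl := fun _ : X => false) (q := P.init)
    (b := P.result vs D W) (M := P.size vs.length L) (S := conf (words W)
      (words ((valuations W vs (val D)).foldl P.step (W, false)).1) [] fun x => words (D x))
    (fun k => by
      rw [size]
      cases k with
      | D x => exact (hL x).trans (Nat.le_add_right ..)
      | W => exact hW.trans (Nat.le_add_right ..)
      | F => change (words _).length ≤ _; omega
      | G => exact Nat.zero_le _
      | E => exact Nat.zero_le _) (.W :: .F :: xs.map .D)
  refine (h₁.seq (h₂.seq (h₃.seq (h₄.seq h₅)))).congr rfl ?_ ?_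
  · funext j
    cases j <;> simp [conf, hxs]
  · simp only [List.length_cons, List.length_nil, List.length_map, List.length_reverse, mainCost]
    rw [show xs.length + 1 + 1 = xs.length + 2 from rfl]
    omega

/-- Functions that are given by a polynomial. -/
def IsPoly (f : ℕ → ℕ) : Prop := ∃ p : Polynomial ℕ, ∀ n, f n = p.eval n

theorem isPoly_id : IsPoly fun n => n := ⟨.X, fun n => by simp⟩

theorem isPoly_const (c : ℕ) : IsPoly fun _ => c := ⟨.C c, fun n => by simp⟩

theorem IsPoly.add {f g : ℕ → ℕ} : IsPoly f → IsPoly g → IsPoly fun n => f n + g n :=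
  fun ⟨p, hp⟩ ⟨r, hr⟩ => ⟨p + r, fun n => by simp [hp, hr]⟩

theorem IsPoly.mul {f g : ℕ → ℕ} : IsPoly f → IsPoly g → IsPoly fun n => f n * g n :=
  fun ⟨p, hp⟩ ⟨r, hr⟩ => ⟨p * r, fun n => by simp [hp, hr]⟩

theorem IsPoly.pow {f : ℕ → ℕ} (k : ℕ) : IsPoly f → IsPoly fun n => f n ^ k :=
  fun ⟨p, hp⟩ => ⟨p ^ k, fun n => by simp [hp]⟩

omit [DecidableEq X] [DecidableEq H] in
theorem isPoly_mainCost (P : TokenProgram H X Q) (k v c : ℕ) :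
    IsPoly fun n => P.mainCost k v (n + c) := by
  have hL : IsPoly fun n => n + c := isPoly_id.add (isPoly_const c)
  have hM : IsPoly fun n => P.size v (n + c) :=
    hL.add ((hL.pow v).mul ((isPoly_const _).mul (hL.add (isPoly_const 1))))
  have hl : ∀ j, IsPoly fun n => P.loopCost k (n + c) (P.size v (n + c)) j := by
    intro j
    induction j with
    | zero =>
      exact ((hM.mul (((isPoly_const k).mul (((isPoly_const 12).mul hL).add (isPoly_const 7))).add
        (isPoly_const 14))).add ((isPoly_const _).mul (((isPoly_const 11).mul hL).add
          (isPoly_const 8)))).add (isPoly_const 8)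
    | succ j ih =>
      exact ((hL.mul ((ih.add ((isPoly_const 4).mul hL)).add (isPoly_const 7))).add
        ((isPoly_const 11).mul hL)).add (isPoly_const 9)
  exact (((((isPoly_const 11).mul hL).add (isPoly_const 6)).add
    (((isPoly_const k).mul (hL.add (isPoly_const 1))).add (isPoly_const 1))).add (hl v)).add
    (((isPoly_const (k + 2)).mul (((isPoly_const 4).mul hM).add (isPoly_const 3))).add
      (isPoly_const 1))

/-- Token programs run in polynomial time. -/
theorem TokenProgram.nonempty_computableInPolyTime [Fintype X] [Finite H] [Finite Q] {α : Type}
    {enc : α → List Γ'} {f : α → Bool} (P : TokenProgram H X Q) {vs : List X} (hvs : vs.Nodup)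
    {D : X → List (Token H)} (hD : ∀ x, x ∈ vs ↔ D x = []) (g : Γ' → Sym H)
    (W : α → List (Token H)) (hW : ∀ a, (enc a).reverse.map g = words (W a))
    (hf : ∀ a, f a = P.result vs D (W a)) :
    Nonempty (Turing.TM2ComputableInPolyTime enc encodeBool f) := by
  let _ := Fintype.ofFinite (Stk X)
  let _ := Fintype.ofFinite (Ctl H X Q)
  -- The preloaded registers do not depend on the input, so they change the size bound only by a
  -- constant.
  obtain ⟨c, hc⟩ : ∃ c, ∀ x, (words (D x)).length ≤ c :=
    ⟨∑ x, (words (D x)).length, fun x => Finset.single_le_sum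
      (f := fun x => (words (D x)).length) (fun _ _ => Nat.zero_le _) (Finset.mem_univ x)⟩
  obtain ⟨p, hp⟩ := isPoly_mainCost P (Finset.univ : Finset X).toList.length vs.length c
  refine (P.mainCmd Finset.univ.toList vs D).nonempty_computableInPolyTime .W
    ⟨none, none, fun _ => false, P.init, false⟩
    (fun s => ⟨s.map g, none, fun _ => false, P.init, false⟩) Ctl.c₁ g (fun _ => rfl) Ctl.a p
    fun a => ?_
  have hlen : (words (W a)).length = (enc a).length := by rw [← hW]; simp
  obtain ⟨t, ht, hr⟩ := exec_mainCmd P (xs := Finset.univ.toList) (by simp)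
    (Finset.nodup_toList _) hvs hD (L := (enc a).length + c) (W := W a)
    (fun x => (hc x).trans (Nat.le_add_left ..)) (by omega)
  rw [← hW] at hr
  exact ⟨_, t, hr, (hf a).symm, ht.trans (hp _).le⟩

end Program

end TCmd

end

end DL

/-! ### Reading an encoded input with a finite automaton. -/

namespace DL

open Computability

namespace TCmd

namespace TokenProgram

variable {H X Q : Type} [DecidableEq X]

theorem mem_valuations {W : List (Token H)} {vs : List X} {Z Z' : X → List Bool} :
    Z' ∈ valuations W vs Z ↔ (∀ x ∉ vs, Z' x = Z x) ∧ ∀ x ∈ vs, ∃ t ∈ W, Z' x = t.1 := by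
  induction vs generalizing Z with
  | nil =>
    rw [valuations, List.mem_singleton]
    exact ⟨fun h => ⟨fun _ _ => h ▸ rfl, fun x h => nomatch h⟩, fun h =>
      funext fun x => h.1 x List.not_mem_nil⟩
  | cons x vs ih =>
    simp only [valuations, List.mem_flatMap, ih]
    constructor
    · rintro ⟨t, ht, h₁, h₂⟩
      refine ⟨fun y hy => ?_, fun y hy => ?_⟩
      · rw [List.mem_cons, not_or] at hy
        rw [h₁ y hy.2, Function.update_of_ne hy.1]
      · by_cases hyv : y ∈ vs
        · exact h₂ y hyv
        · obtain rfl : y = x := (List.mem_cons.1 hy).resolve_right hyv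
          exact ⟨t, ht, by rw [h₁ y hyv, Function.update_self]⟩
    · rintro ⟨h₁, h₂⟩
      obtain ⟨t, ht, hZ⟩ := h₂ x List.mem_cons_self
      refine ⟨t, ht, fun y hy => ?_, fun y hy => h₂ y (List.mem_cons_of_mem _ hy)⟩
      by_cases hyx : y = x
      · subst hyx
        rw [hZ, Function.update_self]
      · rw [Function.update_of_ne hyx]
        exact h₁ y (by simp [hyx, hy])

/-- The outer loops merely repeat the inner ones; this isolates the repetitions as rounds. -/
theorem valuations_append (W : List (Token H)) (v₁ v₂ : List X) (Z : X → List Bool) :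
    valuations W (v₁ ++ v₂) Z = (valuations W v₁ Z).flatMap (valuations W v₂) := by
  induction v₁ generalizing Z with
  | nil => simp [valuations]
  | cons x v ih => simp [valuations, ih, List.flatMap_assoc]

omit [DecidableEq X] in
theorem foldl_emit (es : List ((Q → Bool) × H × X)) (Z : X → List Bool) (q : Q)
    (F : List (Token H)) : ∃ E, es.foldl (emit Z q) F = E ++ F ∧
      ∀ t, t ∈ E ↔ ∃ e ∈ es, e.1 q = true ∧ t = (Z e.2.2, e.2.1) := by
  induction es generalizing F with
  | nil => exact ⟨[], rfl, by simp⟩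
  | cons e es ih =>
    obtain ⟨E, hE, hE'⟩ := ih (emit Z q F e)
    by_cases he : e.1 q = true
    · refine ⟨E ++ [(Z e.2.2, e.2.1)], ?_, fun t => ?_⟩
      · rw [List.foldl_cons, hE, emit, if_pos he]
        simp
      · simp only [List.mem_append, hE', List.mem_cons, exists_eq_or_imp, he,
          true_and, List.not_mem_nil, or_false]
        exact or_comm
    · refine ⟨E, ?_, fun t => ?_⟩
      · rw [List.foldl_cons, hE, emit, if_neg he]
      · simp [hE', he]

end TokenProgram

end TCmd

/-! ### Evaluation of monadic Datalog programs -/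

/-- The headers of the tokens: the separators of the input, and intensional symbols. -/
inductive Header (ι : Type) where
  | bra
  | ket
  | comma
  | idb (i : ι)

/-- Atoms about the values of `k` variables: membership in the set of individual names, atoms of the
input with one of `k` predicate names, derived facts, occurrence as a component of the tuple of
length `n`, and equality. -/
inductive DAtom (ι : Type) (k n : ℕ) where
  | ind (v : Fin k)
  | con (A v : Fin k)
  | rol (r u v : Fin k)
  | idb (i : ι) (v : Fin k)
  | ans (j : Fin n) (v : Fin k)
  | eq (u v : Fin k)

/-- What is known about the part of the input that is being read: the number of components of the
tuple that are still to be read, or the variables whose values are the names that have been read in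
the current assertion. -/
inductive Buffer (k n : ℕ) where
  | ans (j : Fin (n + 1))
  | zero
  | one (f : Fin k → Bool)
  | two (f g : Fin k → Bool)

instance {ι : Type} [Finite ι] : Finite (Header ι) :=
  Finite.of_injective (β := Option (Option (Option ι)))
    (fun
      | .bra => none
      | .ket => some none
      | .comma => some (some none)
      | .idb i => some (some (some i)))
    (by rintro (_ | _ | _ | i) (_ | _ | _ | j) h <;> simp_all)

instance {ι : Type} {k n : ℕ} [Finite ι] : Finite (DAtom ι k n) :=
  Finite.of_injective (β := Fin k ⊕ (Fin k × Fin k) ⊕ (Fin k × Fin k × Fin k) ⊕ (ι × Fin k) ⊕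
      (Fin n × Fin k) ⊕ (Fin k × Fin k))
    (fun
      | .ind v => .inl v
      | .con A v => .inr (.inl (A, v))
      | .rol r u v => .inr (.inr (.inl (r, u, v)))
      | .idb i v => .inr (.inr (.inr (.inl (i, v))))
      | .ans j v => .inr (.inr (.inr (.inr (.inl (j, v)))))
      | .eq u v => .inr (.inr (.inr (.inr (.inr (u, v))))))
    (by rintro ⟨⟩ ⟨⟩ h <;> simp_all)

instance {k n : ℕ} : Finite (Buffer k n) :=
  Finite.of_injective (β := Fin (n + 1) ⊕ Option ((Fin k → Bool) ⊕ ((Fin k → Bool) × (Fin k → Bool))))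
    (fun
      | .ans j => .inl j
      | .zero => .inr none
      | .one f => .inr (some (.inl f))
      | .two f g => .inr (some (.inr (f, g))))
    (by rintro ⟨⟩ ⟨⟩ h <;> simp_all)

/-- The registers: values of variables, of unused variables, and constants. -/
abbrev Reg (k r : ℕ) := Fin k ⊕ Fin r ⊕ Fin k

section Scan

variable {ι : Type} {k n r : ℕ}

/-- The buffer after a token. -/
def Buffer.next (b : Buffer k n) (h : Header ι) (fl : Reg k r → Bool) : Buffer k n :=
  match h, b with
  | .bra, _ => .zero
  | .ket, _ => .zero
  | .comma, .ans j => .ans ⟨j - 1, by omega⟩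
  | .comma, .zero => .one fun v => fl (.inl v)
  | .comma, .one f => .two f fun v => fl (.inl v)
  | .comma, .two f g => .two f g
  | .idb _, b => b

/-- The atoms that a token contributes. -/
def newAtoms (b : Buffer k n) (h : Header ι) (fl : Reg k r → Bool) : Set (DAtom ι k n) :=
  {x | match x with
    | .ind v => h = .comma ∧ fl (.inl v)
    | .con A v => h = .bra ∧ fl (.inr (.inr A)) ∧ ∃ f, b = .one f ∧ f v
    | .rol r u v => h = .bra ∧ fl (.inr (.inr r)) ∧ ∃ f g, b = .two f g ∧ g u ∧ f v
    | .idb i v => h = .idb i ∧ fl (.inl v)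
    | .ans j v => h = .comma ∧ b = .ans j.succ ∧ fl (.inl v)
    | .eq u v => fl (.inl u) ∧ fl (.inl v)}

/-- Which registers contain the bits of a token. -/
def flags (Z : Reg k r → List Bool) (t : Token (Header ι)) (x : Reg k r) : Bool :=
  decide (t.1 = Z x)

/-- The buffer after several tokens. -/
def Buffer.after (Z : Reg k r → List Bool) (b : Buffer k n) (F : List (Token (Header ι))) :
    Buffer k n :=
  F.foldl (fun b t => b.next t.2 (flags Z t)) b

/-- The atoms that several tokens contribute. -/
def scanAtoms (Z : Reg k r → List Bool) : Buffer k n → List (Token (Header ι)) →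
    Set (DAtom ι k n)
  | _, [] => ∅
  | b, t :: F => newAtoms b t.2 (flags Z t) ∪ scanAtoms Z (b.next t.2 (flags Z t)) F

variable {Z : Reg k r → List Bool} {b : Buffer k n} {F G : List (Token (Header ι))}

theorem scanAtoms_append :
    scanAtoms Z b (F ++ G) = scanAtoms Z b F ∪ scanAtoms Z (b.after Z F) G := by
  induction F generalizing b with
  | nil => exact (Set.empty_union _).symm
  | cons t F ih =>
    rw [List.cons_append, scanAtoms, ih, scanAtoms, Set.union_assoc]
    rfl

theorem eq_mem_scanAtoms {u v : Fin k} :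
    .eq u v ∈ scanAtoms Z b F ↔ ∃ t ∈ F, t.1 = Z (.inl u) ∧ t.1 = Z (.inl v) := by
  induction F generalizing b with
  | nil => simp [scanAtoms]
  | cons t F ih =>
    rw [scanAtoms, Set.mem_union, ih]
    simp [newAtoms, flags]

theorem ind_mem_scanAtoms {v : Fin k} :
    .ind v ∈ scanAtoms Z b F ↔ (Z (.inl v), .comma) ∈ F := by
  induction F generalizing b with
  | nil => simp [scanAtoms]
  | cons t F ih =>
    rw [scanAtoms, Set.mem_union, ih, List.mem_cons]
    refine or_congr ?_ Iff.rfl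
    rw [Prod.ext_iff]
    simp only [newAtoms, flags, Set.mem_ofPred_eq, decide_eq_true_eq]
    exact ⟨fun h => ⟨h.2.symm, h.1.symm⟩, fun h => ⟨h.2.symm, h.1.symm⟩⟩

theorem idb_mem_scanAtoms {i : ι} {v : Fin k} :
    .idb i v ∈ scanAtoms Z b F ↔ (Z (.inl v), .idb i) ∈ F := by
  induction F generalizing b with
  | nil => simp [scanAtoms]
  | cons t F ih =>
    rw [scanAtoms, Set.mem_union, ih, List.mem_cons]
    refine or_congr ?_ Iff.rfl
    rw [Prod.ext_iff]
    simp only [newAtoms, flags, Set.mem_ofPred_eq, decide_eq_true_eq]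
    exact ⟨fun h => ⟨h.2.symm, h.1.symm⟩, fun h => ⟨h.2.symm, h.1.symm⟩⟩

/-- Atoms about the assertions or the tuple of the input. -/
def DAtom.IsInput : DAtom ι k n → Prop
  | .con _ _ | .rol _ _ _ | .ans _ _ => True
  | _ => False

/-- Derived facts are stacked on top of the input, so the buffer must reach the input unchanged. -/
theorem after_idb (hF : ∀ t ∈ F, ∃ i, t.2 = .idb i) : b.after Z F = b := by
  induction F with
  | nil => rfl
  | cons t F ih =>
    obtain ⟨i, hi⟩ := hF t List.mem_cons_self
    change (b.next t.2 _).after Z F = b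
    rw [hi]
    exact ih fun t ht => hF t (List.mem_cons_of_mem _ ht)

theorem not_mem_scanAtoms_idb (hF : ∀ t ∈ F, ∃ i, t.2 = .idb i) {x : DAtom ι k n}
    (hx : x.IsInput) : x ∉ scanAtoms Z b F := by
  induction F generalizing b with
  | nil => exact id
  | cons t F ih =>
    obtain ⟨i, hi⟩ := hF t List.mem_cons_self
    rw [scanAtoms, Set.mem_union, not_or]
    refine ⟨?_, ih fun t ht => hF t (List.mem_cons_of_mem _ ht)⟩
    rw [hi]
    cases x <;> simp_all [newAtoms, DAtom.IsInput]

/-- The bits of a name, last bit first. -/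
def bits (a : ℕ) : List Bool := (encodeNat a).reverse

theorem bits_injective : Function.Injective bits := fun a b h => by
  rw [← decode_encodeNat a, ← decode_encodeNat b, List.reverse_injective h]

/-- The tokens of an assertion, last token first. -/
def assertionTokens : Assertion IndName → List (Token (Header ι))
  | .concept A a => [([], .ket), (bits a, .comma), (bits A, .bra)]
  | .role r a b => [([], .ket), (bits b, .comma), (bits a, .comma), (bits r, .bra)]

/-- The tokens of a tuple, last token first. -/
def tupleTokens (l : List IndName) : List (Token (Header ι)) :=
  l.reverse.map fun a => (bits a, .comma)

/-- The tokens of an input, last token first. -/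
def inputTokens (p : EvalInput n) : List (Token (Header ι)) :=
  tupleTokens (List.ofFn p.1.2) ++ p.1.1.reverse.flatMap assertionTokens

/-- Read from the end, an assertion starts with a closing bracket, which resets the buffer; the
result does not depend on `b`. The predicate name comes last, when the arguments have already been
buffered. -/
theorem con_mem_scanAtoms_assertion {s : Assertion IndName} {A v : Fin k} :
    .con A v ∈ scanAtoms (ι := ι) Z b (assertionTokens s) ↔
      ∃ B a, s = .concept B a ∧ bits B = Z (.inr (.inr A)) ∧ bits a = Z (.inl v) := by
  cases s <;> cases b <;> simp [assertionTokens, scanAtoms, newAtoms, Buffer.next, flags]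

theorem rol_mem_scanAtoms_assertion {s : Assertion IndName} {r' u v : Fin k} :
    .rol r' u v ∈ scanAtoms (ι := ι) Z b (assertionTokens s) ↔
      ∃ B a c, s = .role B a c ∧ bits B = Z (.inr (.inr r')) ∧ bits a = Z (.inl u) ∧
        bits c = Z (.inl v) := by
  cases s <;> cases b <;> simp [assertionTokens, scanAtoms, newAtoms, Buffer.next, flags]

theorem ans_not_mem_scanAtoms_assertion {s : Assertion IndName} {j : Fin n} {v : Fin k} :
    .ans j v ∉ scanAtoms (ι := ι) Z b (assertionTokens s) := by
  cases s <;> cases b <;> simp [assertionTokens, scanAtoms, newAtoms, Buffer.next, flags]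

/-- Because the hypothesis is uniform in the buffer, the assertions can be treated independently. -/
theorem mem_scanAtoms_flatMap {α : Type} {l : List α} {f : α → List (Token (Header ι))}
    {x : DAtom ι k n} {p : α → Prop} (h : ∀ b, ∀ s ∈ l, x ∈ scanAtoms Z b (f s) ↔ p s) :
    x ∈ scanAtoms Z b (l.flatMap f) ↔ ∃ s ∈ l, p s := by
  induction l generalizing b with
  | nil => simp [scanAtoms]
  | cons s l ih =>
    rw [List.flatMap_cons, scanAtoms_append, Set.mem_union, h b s List.mem_cons_self,
      ih fun b s hs => h b s (List.mem_cons_of_mem _ hs)]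
    simp

theorem not_mem_scanAtoms_tuple {l : List IndName} {x : DAtom ι k n} {j : Fin (n + 1)}
    (hx : ∀ i v, x ≠ .ans i v) (hx' : x.IsInput) : x ∉ scanAtoms Z (.ans j) (tupleTokens l) := by
  rw [tupleTokens]
  generalize l.reverse = l'
  induction l' generalizing j with
  | nil => exact id
  | cons a l ih =>
    rw [List.map_cons, scanAtoms, Set.mem_union, not_or]
    refine ⟨?_, ih⟩
    cases x <;> simp_all [newAtoms, DAtom.IsInput]

/-- The tuple is read from its last component on and the buffer counts down, so the counter
identifies the component. The induction is over prefixes of the tuple, with the counter equal to the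
length of the prefix. -/
theorem ans_mem_scanAtoms_tuple {a : Fin n → IndName} {j : Fin n} {v : Fin k} :
    .ans j v ∈ scanAtoms (ι := ι) Z (.ans (Fin.last n)) (tupleTokens (List.ofFn a)) ↔
      bits (a j) = Z (.inl v) := by
  have key : ∀ (m : ℕ) (hm : m ≤ n), .ans j v ∈ scanAtoms (ι := ι) Z (.ans ⟨m, by omega⟩)
      (tupleTokens ((List.ofFn a).take m)) ↔ j.1 < m ∧ bits (a j) = Z (.inl v) := by
    intro m
    induction m with
    | zero => simp [tupleTokens, scanAtoms]
    | succ m ih =>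
      intro hm
      have e : (tupleTokens ((List.ofFn a).take (m + 1)) : List (Token (Header ι))) =
          (bits (a ⟨m, hm⟩), .comma) :: tupleTokens ((List.ofFn a).take m) := by
        rw [tupleTokens, List.take_succ_eq_append_getElem (by simpa using hm)]
        simp [tupleTokens]
      rw [e, scanAtoms, Set.mem_union]
      have := ih (by omega)
      simp only [Buffer.next, Nat.add_sub_cancel]
      rw [this]
      simp only [newAtoms, flags, Set.mem_ofPred_eq, true_and, Buffer.ans.injEq, Fin.ext_iff,
        Fin.val_succ, decide_eq_true_eq]
      constructor
      · rintro (⟨h, h'⟩ | ⟨h, h'⟩)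
        · obtain rfl : j = ⟨m, hm⟩ := Fin.ext (by simp; omega)
          exact ⟨by simp, h'⟩
        · exact ⟨by omega, h'⟩
      · rintro ⟨h, h'⟩
        by_cases hj : j.1 = m
        · obtain rfl : j = ⟨m, hm⟩ := Fin.ext hj
          exact Or.inl ⟨rfl, h'⟩
        · exact Or.inr ⟨by omega, h'⟩
  have h := key n le_rfl
  rw [List.take_of_length_le (by simp)] at h
  refine h.trans ?_
  simp

end Scan

end DL

/-! ### The token list of a complete input. -/

namespace DL

open Computability

section Input

variable {ι : Type} {k n r : ℕ} {Z : Reg k r → List Bool} {E : List (Token (Header ι))}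
  {p : EvalInput n}

/-- The ABox of an input. -/
abbrev EvalInput.abox (p : EvalInput n) : Set (Assertion IndName) := {s | s ∈ p.1.1}

/-- The state of the buffer before reading. -/
abbrev Buffer.init : Buffer k n := .ans (Fin.last n)

theorem con_mem_scanAtoms (hE : ∀ t ∈ E, ∃ i, t.2 = .idb i) {A v : Fin k} :
    .con A v ∈ scanAtoms Z (Buffer.init (n := n)) (E ++ inputTokens p) ↔
      ∃ B a, .concept B a ∈ p.abox ∧ bits B = Z (.inr (.inr A)) ∧ bits a = Z (.inl v) := by
  rw [scanAtoms_append, after_idb hE, inputTokens, scanAtoms_append, Set.mem_union, Set.mem_union,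
    or_iff_right (not_mem_scanAtoms_idb hE (by exact trivial)),
    or_iff_right (not_mem_scanAtoms_tuple (by simp) (by exact trivial)),
    mem_scanAtoms_flatMap fun b s _ => con_mem_scanAtoms_assertion]
  constructor
  · rintro ⟨s, hs, B, a, rfl, h⟩
    exact ⟨B, a, List.mem_reverse.1 hs, h⟩
  · rintro ⟨B, a, hs, h⟩
    exact ⟨_, List.mem_reverse.2 hs, B, a, rfl, h⟩

theorem rol_mem_scanAtoms (hE : ∀ t ∈ E, ∃ i, t.2 = .idb i) {R u v : Fin k} :
    .rol R u v ∈ scanAtoms Z (Buffer.init (n := n)) (E ++ inputTokens p) ↔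
      ∃ B a c, .role B a c ∈ p.abox ∧ bits B = Z (.inr (.inr R)) ∧ bits a = Z (.inl u) ∧
        bits c = Z (.inl v) := by
  rw [scanAtoms_append, after_idb hE, inputTokens, scanAtoms_append, Set.mem_union, Set.mem_union,
    or_iff_right (not_mem_scanAtoms_idb hE (by exact trivial)),
    or_iff_right (not_mem_scanAtoms_tuple (by simp) (by exact trivial)),
    mem_scanAtoms_flatMap fun b s _ => rol_mem_scanAtoms_assertion]
  constructor
  · rintro ⟨s, hs, B, a, c, rfl, h⟩
    exact ⟨B, a, c, List.mem_reverse.1 hs, h⟩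
  · rintro ⟨B, a, c, hs, h⟩
    exact ⟨_, List.mem_reverse.2 hs, B, a, c, rfl, h⟩

theorem ans_mem_scanAtoms (hE : ∀ t ∈ E, ∃ i, t.2 = .idb i) {j : Fin n} {v : Fin k} :
    .ans j v ∈ scanAtoms Z (Buffer.init (n := n)) (E ++ inputTokens p) ↔ bits (p.1.2 j) = Z (.inl v) := by
  rw [scanAtoms_append, after_idb hE, inputTokens, scanAtoms_append, Set.mem_union, Set.mem_union,
    or_iff_right (not_mem_scanAtoms_idb hE (by exact trivial)), ans_mem_scanAtoms_tuple,
    mem_scanAtoms_flatMap fun b s _ => iff_false_intro ans_not_mem_scanAtoms_assertion]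
  simp

/-- Loop values are the bits of arbitrary tokens, so each must at least denote a name; only tokens
with a comma are guaranteed to denote individuals of the ABox. -/
theorem mem_inputTokens {t : Token (Header ι)} (ht : t ∈ inputTokens p) :
    (∃ a, t.1 = bits a) ∧ (∀ i, t.2 ≠ .idb i) ∧
      (t.2 = .comma → ∃ a ∈ Ind p.abox, t.1 = bits a) := by
  -- The token of a closing bracket has no bits, which happens to be the encoding of `0`.
  have h₀ : ([] : List Bool) = bits 0 := rfl
  rcases List.mem_append.1 ht with h | h
  · obtain ⟨a, ha, rfl⟩ := List.mem_map.1 h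
    rw [List.mem_reverse, List.mem_ofFn] at ha
    obtain ⟨j, rfl⟩ := ha
    exact ⟨⟨_, rfl⟩, by simp, fun _ => ⟨_, p.2.2 j, rfl⟩⟩
  · obtain ⟨s, hs, h⟩ := List.mem_flatMap.1 h
    rw [List.mem_reverse] at hs
    cases s with
    | concept A a =>
      simp only [assertionTokens, List.mem_cons, List.not_mem_nil, or_false] at h
      rcases h with rfl | rfl | rfl
      · exact ⟨⟨0, h₀⟩, by simp, by simp⟩
      · exact ⟨⟨_, rfl⟩, by simp, fun _ => ⟨a, ⟨_, hs, rfl⟩, rfl⟩⟩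
      · exact ⟨⟨_, rfl⟩, by simp, by simp⟩
    | role R a b =>
      simp only [assertionTokens, List.mem_cons, List.not_mem_nil, or_false] at h
      rcases h with rfl | rfl | rfl | rfl
      · exact ⟨⟨0, h₀⟩, by simp, by simp⟩
      · exact ⟨⟨_, rfl⟩, by simp, fun _ => ⟨b, ⟨_, hs, Or.inr rfl⟩, rfl⟩⟩
      · exact ⟨⟨_, rfl⟩, by simp, fun _ => ⟨a, ⟨_, hs, Or.inl rfl⟩, rfl⟩⟩
      · exact ⟨⟨_, rfl⟩, by simp, by simp⟩

theorem comma_mem_inputTokens {a : IndName} (ha : a ∈ Ind p.abox) :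
    (bits a, .comma) ∈ inputTokens (ι := ι) p := by
  obtain ⟨s, hs, h⟩ := ha
  refine List.mem_append_right _ (List.mem_flatMap.2 ⟨s, List.mem_reverse.2 hs, ?_⟩)
  cases s with
  | concept A b =>
    obtain rfl : a = b := h
    simp [assertionTokens]
  | role R b c =>
    rcases (h : a = b ∨ a = c) with rfl | rfl <;> simp [assertionTokens]

theorem ncard_ind_le (p : EvalInput n) : (Ind p.abox).ncard ≤ (inputTokens (ι := ι) p).length := by
  classical
  rw [← List.length_map Prod.fst]
  refine le_trans ?_ (List.toFinset_card_le _)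
  rw [← Set.ncard_coe_finset]
  exact Set.ncard_le_ncard_of_injOn bits
    (fun a ha => by
      rw [List.coe_toFinset]
      exact List.mem_map.2 ⟨_, comma_mem_inputTokens ha, rfl⟩)
    bits_injective.injOn (Finset.finite_toSet _)

/-- This ensures that powers of the input length dominate powers of two when rounds are counted. -/
theorem two_le_length_inputTokens (p : EvalInput n) : 2 ≤ (inputTokens (ι := ι) p).length := by
  obtain ⟨s, l, h⟩ := List.exists_cons_of_ne_nil
    (show p.1.1.reverse ≠ [] by simpa using p.2.1)
  rw [inputTokens, h, List.flatMap_cons, List.length_append, List.length_append]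
  cases s <;> simp only [assertionTokens, List.length_cons] <;> omega

/-- The stack symbol of an input symbol. -/
def inputSym : Γ' → Sym (Header ι)
  | .blank => .inr .ket
  | .bit b => .inl b
  | .bra => .inr .bra
  | .ket => .inr .ket
  | .comma => .inr .comma

/-- Every separator precedes its name in the encoding. Reversal, which is the effect of loading the
input, places it after the bits, as the token format requires. -/
theorem map_inputSym_encodeInput (p : EvalInput n) :
    (encodeInput p).reverse.map inputSym = words (inputTokens (ι := ι) p) := by
  have hname : ∀ a : ℕ, (encodeName a).reverse.map (inputSym (ι := ι)) = (bits a).map .inl := by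
    intro a
    rw [encodeName, ← List.map_reverse, List.map_map]
    rfl
  have hass : ∀ s : Assertion IndName, (encodeAssertion s).reverse.map (inputSym (ι := ι)) =
      words (assertionTokens s) := by
    intro s
    cases s <;> simp [encodeAssertion, assertionTokens, words, Token.word, -List.map_reverse,
      hname, inputSym]
  have happ : ∀ l l' : List (Token (Header ι)), words (l ++ l') = words l ++ words l' :=
    fun l l' => List.flatMap_append
  rw [encodeInput, inputTokens, List.reverse_append, List.map_append, happ]
  congr 1
  · rw [tupleTokens]
    generalize List.ofFn p.1.2 = l
    induction l with
    | nil => rfl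
    | cons a l ih =>
      rw [List.flatMap_cons, List.reverse_append, List.map_append, ih, List.reverse_cons (a := a),
        List.map_append (f := fun a => (bits a, Header.comma)), happ, List.reverse_cons,
        List.map_append, hname]
      simp [words, Token.word, inputSym]
  · generalize p.1.1 = l
    induction l with
    | nil => rfl
    | cons s l ih =>
      rw [List.flatMap_cons, List.reverse_append, List.map_append, ih, List.reverse_cons,
        List.flatMap_append, happ, hass]
      simp

end Input

end DL

/-! ### Rules evaluated on registers. -/

namespace DL

open Computability

/-! ### Datalog programs as token programs -/

namespace DatalogProgram

variable {n : ℕ} (P : DatalogProgram n)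

/-- The intensional symbols that occur in rule heads. -/
def HeadSymbol : Type := {i : P.IDB // ∃ ρ ∈ P.rules, ∃ args, ρ.head = .idb i args}

variable {P}

/-- The type of intensional symbols may be infinite, but a rule determines its head symbol and there
are finitely many rules. Symbols that head no rule have no derivable facts. -/
theorem finite_headSymbol (hP : P.rules.Finite) : Finite P.HeadSymbol := by
  have := hP.to_subtype
  choose ρ hρ args h using fun i : P.HeadSymbol => i.2
  refine Finite.of_injective (β := P.rules) (fun i => ⟨ρ i, hρ i⟩) fun i j hij => ?_
  have e := (h i).symm.trans ((congrArg (fun x : P.rules => x.1.head) hij).trans (h j))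
  exact Subtype.ext (HeadAtom.idb.inj e).1

/-- The register of a variable, or of a predicate name. -/
abbrev reg (m x : ℕ) : Fin (m + 1) := Fin.ofNat (m + 1) x

theorem reg_val {m x : ℕ} (h : x ≤ m) : (reg m x).1 = x := Nat.mod_eq_of_lt (by omega)

variable {m r : ℕ}

/-- Truth of a body atom according to a set of atoms about registers. -/
def Check (D : Set (DAtom P.HeadSymbol (m + 1) n)) : BodyAtom P.arity → Prop
  | .top x => .ind (reg m x) ∈ D
  | .concept A x => .con (reg m A) (reg m x) ∈ D
  | .role R x y => .rol (reg m R) (reg m x) (reg m y) ∈ D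
  | .idb i args => ∃ j : P.HeadSymbol, j.1 = i ∧ ∀ l, .idb j (reg m (args l)) ∈ D
  | .neq x y => .eq (reg m x) (reg m y) ∉ D

/-- Some rule derives a fact for the value of a register. -/
def Derives (D : Set (DAtom P.HeadSymbol (m + 1) n)) (i : P.HeadSymbol) (v : Fin (m + 1)) : Prop :=
  ∃ ρ ∈ P.rules, (∃ args, ρ.head = .idb i.1 args ∧ ∀ l, reg m (args l) = v) ∧
    ∀ b ∈ ρ.body, Check D b

/-- Some rule derives the goal for the given tuple. -/
def DerivesGoal (D : Set (DAtom P.HeadSymbol (m + 1) n)) : Prop :=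
  ∃ ρ ∈ P.rules, ∃ args, ρ.head = .goal args ∧ (∀ b ∈ ρ.body, Check D b) ∧
    ∀ j, .ans j (reg m (args j)) ∈ D

variable (P m r)

open Classical in
/-- The token program for a Datalog program. -/
noncomputable def tokenProgram [Fintype P.HeadSymbol] :
    TCmd.TokenProgram (Header P.HeadSymbol) (Reg (m + 1) r)
      (Buffer (m + 1) n × Set (DAtom P.HeadSymbol (m + 1) n)) where
  init := (Buffer.init, ∅)
  trans q h fl := (q.1.next h fl, q.2 ∪ newAtoms q.1 h fl)
  emits := (Finset.univ : Finset (P.HeadSymbol × Fin (m + 1))).toList.map fun x =>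
    (fun q => decide (Derives q.2 x.1 x.2), .idb x.1, .inl x.2)
  acc q := decide (DerivesGoal q.2)

variable {P m r} [Fintype P.HeadSymbol] {Z : Reg (m + 1) r → List Bool}
  {F : List (Token (Header P.HeadSymbol))}

theorem scan_tokenProgram (q : Buffer (m + 1) n × Set (DAtom P.HeadSymbol (m + 1) n)) :
    (P.tokenProgram m r).scan Z F q = (q.1.after Z F, q.2 ∪ scanAtoms Z q.1 F) := by
  induction F generalizing q with
  | nil => exact Prod.ext rfl (Set.union_empty _).symm
  | cons t F ih =>
    refine (ih _).trans (Prod.ext rfl ?_)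
    exact Set.union_assoc ..

/-- The atoms that are known after a scan. -/
abbrev known (Z : Reg (m + 1) r → List Bool) (F : List (Token (Header P.HeadSymbol))) :
    Set (DAtom P.HeadSymbol (m + 1) n) := scanAtoms Z Buffer.init F

theorem step_tokenProgram_snd (s : List (Token (Header P.HeadSymbol)) × Bool) :
    ((P.tokenProgram m r).step s Z).2 = true ↔ s.2 = true ∨ DerivesGoal (known Z s.1) := by
  classical
  change (s.2 || decide _) = true ↔ _
  rw [scan_tokenProgram, Bool.or_eq_true, decide_eq_true_eq]
  change _ ∨ DerivesGoal (∅ ∪ known Z s.1) ↔ _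
  rw [Set.empty_union]

theorem step_tokenProgram_fst (s : List (Token (Header P.HeadSymbol)) × Bool) :
    ∃ E, ((P.tokenProgram m r).step s Z).1 = E ++ s.1 ∧
      ∀ t, t ∈ E ↔ ∃ i v, Derives (known Z s.1) i v ∧ t = (Z (.inl v), .idb i) := by
  classical
  obtain ⟨E, hE, hE'⟩ := TCmd.TokenProgram.foldl_emit (P.tokenProgram m r).emits Z
    ((P.tokenProgram m r).scan Z s.1 (P.tokenProgram m r).init) s.1
  refine ⟨E, hE, fun t => (hE' t).trans ?_⟩
  have hD : ((P.tokenProgram m r).scan Z s.1 (P.tokenProgram m r).init).2 = known Z s.1 := by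
    rw [scan_tokenProgram]
    exact Set.empty_union _
  simp only [tokenProgram, List.mem_map, Finset.mem_toList, Finset.mem_univ, true_and, Prod.exists]
  constructor
  · rintro ⟨f, h, x, ⟨i, v, e⟩, hf, rfl⟩
    cases e
    rw [decide_eq_true_eq] at hf
    exact ⟨i, v, hD ▸ hf, rfl⟩
  · rintro ⟨i, v, h, rfl⟩
    refine ⟨_, _, _, ⟨i, v, rfl⟩, ?_, rfl⟩
    rw [decide_eq_true_eq]
    exact hD.symm ▸ h

/-- The derived facts in a list of tokens. -/
def facts (F : List (Token (Header P.HeadSymbol))) : Set (P.HeadSymbol × IndName) :=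
  {x | (bits x.2, .idb x.1) ∈ F}

/-- The intensional facts for a set of pairs, with some facts for the goal relation. -/
def factSet (Φ : Set (P.HeadSymbol × IndName)) (G : (Fin n → IndName) → Prop) :
    Set (HeadAtom P.arity n IndName) :=
  {h | match h with
    | .idb i args => ∃ j : P.HeadSymbol, j.1 = i ∧ ∀ l, (j, args l) ∈ Φ
    | .goal args => G args}

variable {p : EvalInput n}

/-- A list of tokens that consists of the input and derivable facts. -/
def SoundTokens (p : EvalInput n) (F : List (Token (Header P.HeadSymbol))) : Prop :=
  ∃ E, F = E ++ inputTokens p ∧ ∀ t ∈ E, ∃ i a, t = (bits a, .idb i) ∧ a ∈ Ind p.abox ∧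
    ∀ M, P.IsClosed p.abox M → .idb i.1 (fun _ => a) ∈ M

omit [Fintype P.HeadSymbol] in
theorem SoundTokens.of_mem_facts (hF : SoundTokens p F) {i : P.HeadSymbol} {a : IndName}
    (h : (i, a) ∈ facts F) :
    a ∈ Ind p.abox ∧ ∀ M, P.IsClosed p.abox M → .idb i.1 (fun _ => a) ∈ M := by
  obtain ⟨E, rfl, hE⟩ := hF
  rcases List.mem_append.1 h with h | h
  · obtain ⟨j, b, e, hb⟩ := hE _ h
    obtain ⟨e₁, e₂⟩ := Prod.mk.inj e
    obtain rfl := bits_injective e₁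
    obtain rfl := Header.idb.inj e₂
    exact hb
  · exact ((mem_inputTokens h).2.1 i rfl).elim

omit [Fintype P.HeadSymbol] in
theorem SoundTokens.idb (hF : SoundTokens p F) : ∃ E, F = E ++ inputTokens p ∧
    ∀ t ∈ E, ∃ i, t.2 = .idb i := by
  obtain ⟨E, rfl, hE⟩ := hF
  refine ⟨E, rfl, fun t ht => ?_⟩
  obtain ⟨i, a, rfl, -⟩ := hE t ht
  exact ⟨i, rfl⟩

/-- All variables and all predicate names in a body atom are at most `m`. -/
def BoundedAtom (m : ℕ) : BodyAtom P.arity → Prop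
  | .top x => x ≤ m
  | .concept A x => A ≤ m ∧ x ≤ m
  | .role R x y => R ≤ m ∧ x ≤ m ∧ y ≤ m
  | .idb _ args => ∀ l, args l ≤ m
  | .neq x y => x ≤ m ∧ y ≤ m

-- Names are compared through their injective encoding, and predicate names through the constant
-- registers. Equality of two registers is noticed only if some scanned token carries the value,
-- hence the hypothesis `hin`.
omit [Fintype P.HeadSymbol] in
theorem check_iff (hF : SoundTokens p F) {σ : Fin (m + 1) → IndName}
    (hσ : ∀ v, Z (.inl v) = bits (σ v)) (hZ : ∀ A : Fin (m + 1), Z (.inr (.inr A)) = bits A)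
    (hin : ∀ v, ∃ t ∈ F, t.1 = Z (.inl v)) {G : (Fin n → IndName) → Prop} {b : BodyAtom P.arity}
    (hb : BoundedAtom m b) :
    Check (known Z F) b ↔ b.Holds p.abox (factSet (facts F) G) (fun x => σ (reg m x)) := by
  obtain ⟨E, rfl, hE⟩ := hF.idb
  cases b with
  | top x =>
    refine ind_mem_scanAtoms.trans ?_
    rw [hσ]
    change _ ↔ σ (reg m x) ∈ Ind p.abox
    constructor
    · intro h
      rcases List.mem_append.1 h with h | h
      · obtain ⟨i, hi⟩ := hE _ h
        exact absurd hi (by simp)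
      · obtain ⟨a, ha, e⟩ := (mem_inputTokens h).2.2 rfl
        rwa [bits_injective e]
    · exact fun h => List.mem_append_right _ (comma_mem_inputTokens h)
  | concept A x =>
    refine (con_mem_scanAtoms hE).trans ?_
    rw [hσ, hZ, reg_val hb.1]
    constructor
    · rintro ⟨B, a, h, e₁, e₂⟩
      rw [bits_injective e₁, bits_injective e₂] at h
      exact h
    · exact fun h => ⟨_, _, h, rfl, rfl⟩
  | role R x y =>
    refine (rol_mem_scanAtoms hE).trans ?_
    rw [hσ, hσ, hZ, reg_val hb.1]
    constructor
    · rintro ⟨B, a, c, h, e₁, e₂, e₃⟩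
      rw [bits_injective e₁, bits_injective e₂, bits_injective e₃] at h
      exact h
    · exact fun h => ⟨_, _, _, h, rfl, rfl, rfl⟩
  | idb i args =>
    refine exists_congr fun j => and_congr_right fun _ => forall_congr' fun l => ?_
    rw [idb_mem_scanAtoms, hσ]
    rfl
  | neq x y =>
    refine not_congr (eq_mem_scanAtoms.trans ?_)
    constructor
    · rintro ⟨t, -, h₁, h₂⟩
      rw [hσ] at h₁ h₂
      exact bits_injective (h₁.symm.trans h₂)
    · intro h
      obtain ⟨t, ht, e⟩ := hin (reg m x)
      refine ⟨t, ht, e, ?_⟩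
      rw [e, hσ, hσ]
      exact congrArg bits h

end DatalogProgram

end DL

/-! ### Soundness of derived tokens, and closure after a stable round. -/

namespace DL

open Computability

namespace DatalogProgram

variable {n : ℕ} {P : DatalogProgram n} {m r : ℕ} {p : EvalInput n}

theorem holds_congr {A : Set (Assertion IndName)} {M : Set (HeadAtom P.arity n IndName)}
    {σ τ : Var → IndName} {b : BodyAtom P.arity} (h : ∀ x ∈ b.vars, σ x = τ x)
    (hb : b.Holds A M σ) : b.Holds A M τ := by
  cases b with
  | top x =>
    change τ x ∈ Ind A
    rw [← h x rfl]
    exact hb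
  | concept B x =>
    change Assertion.concept B (τ x) ∈ A
    rw [← h x rfl]
    exact hb
  | role R x y =>
    change Assertion.role R (τ x) (τ y) ∈ A
    rw [← h x (Or.inl rfl), ← h y (Or.inr rfl)]
    exact hb
  | idb i args =>
    have : σ ∘ args = τ ∘ args := funext fun l => h _ ⟨l, rfl⟩
    change HeadAtom.idb i (τ ∘ args) ∈ M
    exact this ▸ hb
  | neq x y =>
    change τ x ≠ τ y
    rw [← h x (Or.inl rfl), ← h y (Or.inr rfl)]
    exact hb

theorem holds_mono {A : Set (Assertion IndName)} {M M' : Set (HeadAtom P.arity n IndName)}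
    {σ : Var → IndName} {b : BodyAtom P.arity}
    (h : ∀ i args, HeadAtom.idb i args ∈ M → HeadAtom.idb i args ∈ M') (hb : b.Holds A M σ) :
    b.Holds A M' σ := by
  cases b with
  | idb i args => exact h _ _ hb
  | _ => exact hb

theorem mem_ind_of_holds {A : Set (Assertion IndName)} {Φ : Set (P.HeadSymbol × IndName)}
    {G : (Fin n → IndName) → Prop} (hΦ : ∀ x ∈ Φ, x.2 ∈ Ind A) {σ : Var → IndName}
    {b : BodyAtom P.arity} (hr : b.IsRelational) (hb : b.Holds A (factSet Φ G) σ) {x : Var}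
    (hx : x ∈ b.vars) : σ x ∈ Ind A := by
  cases b with
  | top y => exact (hx : x = y) ▸ hb
  | concept B y => exact (hx : x = y) ▸ ⟨_, hb, rfl⟩
  | role R y z =>
    rcases (hx : x = y ∨ x = z) with rfl | rfl
    · exact ⟨_, hb, Or.inl rfl⟩
    · exact ⟨_, hb, Or.inr rfl⟩
  | idb i args =>
    obtain ⟨l, rfl⟩ := hx
    obtain ⟨j, -, h⟩ := hb
    exact hΦ _ (h l)
  | neq y z => exact hr.elim

theorem factSet_subset (hM : P.IsMonadic) {Φ : Set (P.HeadSymbol × IndName)}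
    {M : Set (HeadAtom P.arity n IndName)} (hΦ : ∀ x ∈ Φ, .idb x.1.1 (fun _ => x.2) ∈ M)
    (i : P.IDB) (args : Fin (P.arity i) → IndName) {G : (Fin n → IndName) → Prop}
    (h : HeadAtom.idb i args ∈ factSet Φ G) : HeadAtom.idb i args ∈ M := by
  obtain ⟨j, rfl, h⟩ := h
  have hpos : 0 < P.arity j.1 := by rw [hM]; exact Nat.one_pos
  have : args = fun _ => args ⟨0, hpos⟩ := funext fun l => congrArg args (Fin.ext (by
    have := l.2.trans_eq (hM _)
    simp only
    omega))
  rw [this]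
  exact hΦ _ (h _)

/-- Valuations of the registers by names of the input. -/
def IsValuation (p : EvalInput n) (Z : Reg (m + 1) r → List Bool) : Prop :=
  (∀ v, ∃ t ∈ inputTokens (ι := P.HeadSymbol) p, t.1 = Z (.inl v)) ∧
    ∀ A : Fin (m + 1), Z (.inr (.inr A)) = bits A

theorem IsValuation.exists_names {Z : Reg (m + 1) r → List Bool} (hZ : IsValuation (P := P) p Z) :
    ∃ σ : Fin (m + 1) → IndName, ∀ v, Z (.inl v) = bits (σ v) := by
  choose t ht h using hZ.1
  choose σ hσ using fun v => (mem_inputTokens (ht v)).1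
  exact ⟨σ, fun v => (h v).symm.trans (hσ v)⟩

theorem IsValuation.exists_token {Z : Reg (m + 1) r → List Bool} (hZ : IsValuation (P := P) p Z)
    {F : List (Token (Header P.HeadSymbol))} (hF : SoundTokens p F) (v : Fin (m + 1)) :
    ∃ t ∈ F, t.1 = Z (.inl v) := by
  obtain ⟨E, rfl, -⟩ := hF
  obtain ⟨t, ht, h⟩ := hZ.1 v
  exact ⟨t, List.mem_append_right _ ht, h⟩

/-- Assumptions on a program, all of whose variables and predicate names are at most `m`. -/
structure IsBounded (P : DatalogProgram n) (m : ℕ) : Prop where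
  safe : ∀ ρ ∈ P.rules, ρ.Safe
  monadic : P.IsMonadic
  bounded : ∀ ρ ∈ P.rules, ∀ b ∈ ρ.body, BoundedAtom m b

/-- Rules that fire for sound tokens derive facts that hold in all closed sets. -/
theorem IsBounded.map_head_mem (hP : P.IsBounded m) {Z : Reg (m + 1) r → List Bool}
    {F : List (Token (Header P.HeadSymbol))} (hF : SoundTokens p F)
    (hZ : IsValuation (P := P) p Z) {σ : Fin (m + 1) → IndName} (hσ : ∀ v, Z (.inl v) = bits (σ v))
    {ρ : DatalogRule P.arity n} (hρ : ρ ∈ P.rules) (h : ∀ b ∈ ρ.body, Check (known Z F) b) :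
    ∃ τ : Var → IndName, (∀ x ∈ ρ.head.vars, τ x = σ (reg m x) ∧ τ x ∈ Ind p.abox) ∧
      ∀ M, P.IsClosed p.abox M → ρ.head.map τ ∈ M := by
  classical
  have hA : ∃ a, a ∈ Ind p.abox := ind_nonempty (by
    obtain ⟨s, l, h⟩ := List.exists_cons_of_ne_nil p.2.1
    exact ⟨s, by simp [EvalInput.abox, h]⟩)
  obtain ⟨a, ha⟩ := hA
  have hb : ∀ b ∈ ρ.body, b.Holds p.abox (factSet (facts F) fun _ => False)
      (fun x => σ (reg m x)) := fun b hb =>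
    (check_iff hF hσ hZ.2 (hZ.exists_token hF) (hP.bounded ρ hρ b hb)).1 (h b hb)
  have hind : ∀ b ∈ ρ.body, b.IsRelational → ∀ x ∈ b.vars, σ (reg m x) ∈ Ind p.abox :=
    fun b hbρ hr x hx => mem_ind_of_holds (fun y hy => (hF.of_mem_facts hy).1) hr (hb b hbρ) hx
  have hsafe := hP.safe ρ hρ
  -- Registers may hold values that are not individuals of the ABox, while closed sets only concern
  -- assignments to individuals. By safety, the variables of a rule whose body holds take
  -- individuals as values; the irrelevant variables are redirected to `a`.
  obtain ⟨τ, hτ⟩ : ∃ τ : Var → IndName, τ = fun x =>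
    if σ (reg m x) ∈ Ind p.abox then σ (reg m x) else a := ⟨_, rfl⟩
  have hτ₁ : ∀ x, τ x ∈ Ind p.abox := by
    intro x
    rw [hτ]
    dsimp only
    split
    · assumption
    · exact ha
  have hτ₂ : ∀ x, σ (reg m x) ∈ Ind p.abox → τ x = σ (reg m x) := fun x hx => by
    rw [hτ]
    exact if_pos hx
  refine ⟨τ, fun x hx => ?_, fun M hcl => hcl ρ hρ τ hτ₁ fun b hbρ => ?_⟩
  · obtain ⟨b, hbρ, hr, hxb⟩ := hsafe.2.1 x hx
    exact ⟨hτ₂ x (hind b hbρ hr x hxb), hτ₁ x⟩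
  · refine holds_mono (fun i args h => factSet_subset hP.monadic
        (fun y hy => (hF.of_mem_facts hy).2 M hcl) i args h)
      (holds_congr (fun x hx => ?_) (hb b hbρ))
    obtain ⟨c, hc, hr, hxc⟩ := hsafe.2.2 b hbρ x hx
    exact (hτ₂ x (hind c hc hr x hxc)).symm

/-- Soundness of the tokens and of the answer. -/
def Invariant (p : EvalInput n) (s : List (Token (Header P.HeadSymbol)) × Bool) : Prop :=
  SoundTokens p s.1 ∧ (s.2 = true → P.Returns p.abox p.1.2)

variable [Fintype P.HeadSymbol] {Z : Reg (m + 1) r → List Bool}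
  {s : List (Token (Header P.HeadSymbol)) × Bool}

/-- A round only applies rules to derivable facts. When the answer is set, the head arguments have
been matched with the given tuple, so the derived goal fact is the required one. -/
theorem Invariant.step (hP : P.IsBounded m) (hZ : IsValuation (P := P) p Z) (hs : Invariant p s) :
    Invariant p ((P.tokenProgram m r).step s Z) := by
  obtain ⟨σ, hσ⟩ := hZ.exists_names
  refine ⟨?_, fun h => ?_⟩
  · obtain ⟨E, hE, hE'⟩ := step_tokenProgram_fst (r := r) (Z := Z) s
    obtain ⟨E₀, hE₀, hE₀'⟩ := hs.1
    refine ⟨E ++ E₀, by rw [hE, hE₀, List.append_assoc], fun t ht => ?_⟩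
    rcases List.mem_append.1 ht with ht | ht
    · obtain ⟨i, v, ⟨ρ, hρ, ⟨args, hh, hv⟩, hb⟩, rfl⟩ := (hE' t).1 ht
      obtain ⟨τ, hτ, hτ'⟩ := hP.map_head_mem hs.1 hZ hσ hρ hb
      rw [hh] at hτ
      have hτv : ∀ l, τ (args l) = σ v := fun l => (hv l) ▸ (hτ _ ⟨l, rfl⟩).1
      have hpos : 0 < P.arity i.1 := by rw [hP.monadic]; exact Nat.one_pos
      refine ⟨i, σ v, by rw [hσ], ?_, fun M hcl => ?_⟩
      · rw [← hτv ⟨0, hpos⟩]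
        exact (hτ _ ⟨_, rfl⟩).2
      · have h := hτ' M hcl
        rw [hh] at h
        have e : τ ∘ args = fun _ => σ v := funext hτv
        exact e ▸ h
    · exact hE₀' t ht
  · rcases (step_tokenProgram_snd s).1 h with h | ⟨ρ, hρ, args, hh, hb, hans⟩
    · exact hs.2 h
    · intro M hcl
      obtain ⟨τ, hτ, hτ'⟩ := hP.map_head_mem hs.1 hZ hσ hρ hb
      have h := hτ' M hcl
      rw [hh] at hτ h
      obtain ⟨E, hE, hE'⟩ := hs.1.idb
      have e : τ ∘ args = p.1.2 := funext fun j => by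
        have hj := hans j
        rw [hE] at hj
        have := (ans_mem_scanAtoms hE').1 hj
        rw [hσ] at this
        exact ((hτ _ ⟨j, rfl⟩).1).trans (bits_injective this).symm
      exact e ▸ h

theorem Invariant.foldl (hP : P.IsBounded m) {Zs : List (Reg (m + 1) r → List Bool)}
    (hZ : ∀ Z ∈ Zs, IsValuation (P := P) p Z) (hs : Invariant p s) :
    Invariant p (Zs.foldl (P.tokenProgram m r).step s) := by
  induction Zs generalizing s with
  | nil => exact hs
  | cons Z Zs ih =>
    exact ih (fun Z hZ' => hZ Z (List.mem_cons_of_mem _ hZ')) (hs.step hP (hZ Z List.mem_cons_self))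

theorem facts_foldl_mono (Zs : List (Reg (m + 1) r → List Bool)) :
    facts s.1 ⊆ facts (Zs.foldl (P.tokenProgram m r).step s).1 := by
  induction Zs generalizing s with
  | nil => exact subset_rfl
  | cons Z Zs ih =>
    refine Set.Subset.trans (fun x hx => ?_) ih
    obtain ⟨E, hE, -⟩ := step_tokenProgram_fst (r := r) (Z := Z) s
    change _ ∈ ((P.tokenProgram m r).step s Z).1
    rw [hE]
    exact List.mem_append_right _ hx

theorem answer_foldl_mono (Zs : List (Reg (m + 1) r → List Bool)) (h : s.2 = true) :
    (Zs.foldl (P.tokenProgram m r).step s).2 = true := by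
  induction Zs generalizing s with
  | nil => exact h
  | cons Z Zs ih => exact ih ((step_tokenProgram_snd s).2 (Or.inl h))

/-- If no new facts are derived for a list of valuations that covers all assignments, then the
facts are closed under the rules. -/
theorem answer_of_stable (hP : P.IsBounded m) {Zs : List (Reg (m + 1) r → List Bool)}
    (hZ : ∀ Z ∈ Zs, IsValuation (P := P) p Z)
    (hcover : ∀ σ : Fin (m + 1) → IndName, (∀ v, σ v ∈ Ind p.abox) →
      ∃ Z ∈ Zs, ∀ v, Z (.inl v) = bits (σ v))
    (hs : Invariant p s) (hstable : facts (Zs.foldl (P.tokenProgram m r).step s).1 = facts s.1)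
    (hret : P.Returns p.abox p.1.2) : (Zs.foldl (P.tokenProgram m r).step s).2 = true := by
  -- Test the least-fixed-point condition on the current facts, with goal facts chosen so that the
  -- given tuple belongs to them exactly if the answer flag is set at the end.
  refine hret (factSet (facts s.1) fun a => a = p.1.2 →
    (Zs.foldl (P.tokenProgram m r).step s).2 = true) ?_ rfl
  intro ρ hρ σ hσ hbody
  obtain ⟨Z, hZs, hZσ⟩ := hcover (fun v => σ v) fun v => hσ v
  obtain ⟨l₁, l₂, rfl⟩ := List.append_of_mem hZs
  rw [List.foldl_append, List.foldl_cons] at hstable hbody ⊢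
  have hs' : Invariant p (l₁.foldl (P.tokenProgram m r).step s) :=
    hs.foldl hP fun Z hZ' => hZ Z (List.mem_append_left _ hZ')
  obtain ⟨s', hs₁⟩ : ∃ s', s' = l₁.foldl (P.tokenProgram m r).step s := ⟨_, rfl⟩
  have hmono₁ := facts_foldl_mono (s := s) l₁
  rw [← hs₁] at hstable hbody hs' hmono₁ ⊢
  have hmono₂ := facts_foldl_mono (s := (P.tokenProgram m r).step s' Z) l₂
  have hmono₃ := facts_foldl_mono (s := s') [Z]
  rw [hstable] at hmono₂
  -- Facts only grow and are the same before and after the round, so they are constant during it. A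
  -- rule applicable to the initial facts is therefore noticed when its assignment comes up.
  have heq : facts s'.1 = facts s.1 := (hmono₃.trans hmono₂).antisymm hmono₁
  have hvars : ∀ b ∈ ρ.body, ∀ x ∈ b.vars, x ≤ m := by
    intro b hb x hx
    have hbd := hP.bounded ρ hρ b hb
    cases b with
    | top y => exact (hx : x = y) ▸ hbd
    | concept B y => exact (hx : x = y) ▸ hbd.2
    | role R y z => exact hx.elim (fun h => h ▸ hbd.2.1) fun h => (h : x = z) ▸ hbd.2.2
    | idb i args => obtain ⟨l, rfl⟩ := hx; exact hbd l
    | neq y z => exact hx.elim (fun h => h ▸ hbd.1) fun h => (h : x = z) ▸ hbd.2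
  have hhead : ∀ x ∈ ρ.head.vars, x ≤ m := fun x hx =>
    let ⟨b, hb, _, hxb⟩ := (hP.safe ρ hρ).2.1 x hx
    hvars b hb x hxb
  have hcheck : ∀ b ∈ ρ.body, Check (known Z s'.1) b := by
    intro b hb
    have hZv := hZ Z hZs
    refine (check_iff (G := fun a => a = p.1.2 → (l₂.foldl (P.tokenProgram m r).step
      ((P.tokenProgram m r).step s' Z)).2 = true) hs'.1 hZσ hZv.2 (hZv.exists_token hs'.1)
      (hP.bounded ρ hρ b hb)).2 ?_
    rw [heq]
    refine holds_congr (fun x hx => ?_) (hbody b hb)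
    rw [reg_val (hvars b hb x hx)]
  cases hh : ρ.head with
  | goal args =>
    rw [hh] at hhead
    intro ha
    refine answer_foldl_mono _ ((step_tokenProgram_snd s').2
      (Or.inr ⟨ρ, hρ, args, hh, hcheck, fun j => ?_⟩))
    obtain ⟨E, hE, hE'⟩ := hs'.1.idb
    rw [hE]
    refine (ans_mem_scanAtoms hE').2 ?_
    rw [hZσ, reg_val (hhead _ ⟨j, rfl⟩)]
    exact congrArg bits (congrFun ha j).symm
  | idb i args =>
    rw [hh] at hhead
    refine ⟨⟨i, ρ, hρ, args, hh⟩, rfl, fun l => hmono₂ ?_⟩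
    obtain ⟨E, hE, hE'⟩ := step_tokenProgram_fst (r := r) (Z := Z) s'
    change _ ∈ ((P.tokenProgram m r).step s' Z).1
    rw [hE]
    refine List.mem_append_left _ ((hE' _).2 ⟨(⟨i, ρ, hρ, args, hh⟩ : P.HeadSymbol),
      reg m (args l), ⟨ρ, hρ, ⟨args, hh, fun l' => ?_⟩,
      hcheck⟩, ?_⟩)
    · have : l' = l := Fin.ext (by
        have h₁ := l.2.trans_eq (hP.monadic _)
        have h₂ := l'.2.trans_eq (hP.monadic _)
        omega)
      rw [this]
    · rw [hZσ, reg_val (hhead _ ⟨l, rfl⟩)]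
      rfl

end DatalogProgram

end DL

/-! ### Counting rounds and the polynomial-time conclusion. -/

namespace DL

open Computability

theorem isABox_abox {n : ℕ} (p : EvalInput n) : IsABox p.abox :=
  ⟨List.finite_toSet _, List.exists_mem_of_ne_nil _ p.2.1⟩

namespace DatalogProgram

variable {n : ℕ} {P : DatalogProgram n} {m r : ℕ} {p : EvalInput n}

theorem eventually_boundedAtom (b : BodyAtom P.arity) :
    ∀ᶠ m in Filter.atTop, BoundedAtom m b := by
  cases b with
  | top x => exact Filter.eventually_ge_atTop x
  | concept A x => exact (Filter.eventually_ge_atTop A).and (Filter.eventually_ge_atTop x)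
  | role R x y =>
    exact (Filter.eventually_ge_atTop R).and
      ((Filter.eventually_ge_atTop x).and (Filter.eventually_ge_atTop y))
  | idb i args => exact Filter.eventually_all.2 fun l => Filter.eventually_ge_atTop (args l)
  | neq x y => exact (Filter.eventually_ge_atTop x).and (Filter.eventually_ge_atTop y)

theorem exists_isBounded (hP : P.IsProgram) (hM : P.IsMonadic) : ∃ m, P.IsBounded m := by
  have h : ∀ᶠ m in Filter.atTop, ∀ ρ ∈ P.rules, ∀ b ∈ ρ.body, BoundedAtom m b :=
    (Filter.eventually_all_finite hP.1).2 fun ρ _ =>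
      (Filter.eventually_all_finite (List.finite_toSet ρ.body)).2 fun b _ =>
        eventually_boundedAtom b
  obtain ⟨m, hm⟩ := h.exists
  exact ⟨m, hP.2, hM, hm⟩

/-- The derivable facts about names of the input. -/
theorem Invariant.facts_subset {s : List (Token (Header P.HeadSymbol)) × Bool}
    (hs : Invariant p s) : facts s.1 ⊆ Set.univ ×ˢ Ind p.abox :=
  fun _ hx => ⟨trivial, (hs.1.of_mem_facts hx).1⟩

variable [Fintype P.HeadSymbol]

/-- After more rounds than there are facts, the goal has been derived. -/
theorem answer_of_rounds (hP : P.IsBounded m) {L : List (List (Reg (m + 1) r → List Bool))}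
    (hZ : ∀ Zs ∈ L, ∀ Z ∈ Zs, IsValuation (P := P) p Z)
    (hcover : ∀ Zs ∈ L, ∀ σ : Fin (m + 1) → IndName, (∀ v, σ v ∈ Ind p.abox) →
      ∃ Z ∈ Zs, ∀ v, Z (.inl v) = bits (σ v))
    {s : List (Token (Header P.HeadSymbol)) × Bool} (hs : Invariant p s)
    (hL : ((Set.univ : Set P.HeadSymbol) ×ˢ Ind p.abox).ncard < (facts s.1).ncard + L.length)
    (hret : P.Returns p.abox p.1.2) : (L.flatten.foldl (P.tokenProgram m r).step s).2 = true := by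
  have hfin := (Set.finite_univ (α := P.HeadSymbol)).prod (ind_finite (isABox_abox p).1)
  induction L generalizing s with
  | nil => exact absurd hL (Nat.not_lt.2 (Set.ncard_le_ncard hs.facts_subset hfin))
  | cons Zs L ih =>
    rw [List.flatten_cons, List.foldl_append]
    have hs' := hs.foldl (r := r) hP (hZ Zs List.mem_cons_self)
    -- Either the round is stable, and the answer is already correct, or the number of facts has
    -- increased; the bound on facts rules out that this happens in all rounds.
    by_cases h : facts (Zs.foldl (P.tokenProgram m r).step s).1 = facts s.1
    · exact answer_foldl_mono _ (answer_of_stable hP (hZ Zs List.mem_cons_self)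
        (hcover Zs List.mem_cons_self) hs h hret)
    · have hlt := Set.ncard_lt_ncard ((facts_foldl_mono (s := s) Zs).ssubset_of_ne (Ne.symm h))
        (hfin.subset hs'.facts_subset)
      refine ih (fun Zs h => hZ Zs (List.mem_cons_of_mem _ h))
        (fun Zs h => hcover Zs (List.mem_cons_of_mem _ h)) hs' ?_
      rw [List.length_cons] at hL
      omega

/-- The contents of the registers: the names of predicates. -/
def constants (ι : Type) (k r : ℕ) : Reg k r → List (Token (Header ι))
  | .inl _ => []
  | .inr (.inl _) => []
  | .inr (.inr A) => [(bits A, .bra)]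

/-- The registers for the variables of the program. -/
def mainRegs (k r : ℕ) : List (Reg k r) := (List.finRange k).map .inl

/-- The registers that count the rounds. -/
def roundRegs (k r : ℕ) : List (Reg k r) := (List.finRange r).map fun i => .inr (.inl i)

theorem inl_mem_mainRegs {k r : ℕ} (v : Fin k) : .inl v ∈ mainRegs k r :=
  List.mem_map.2 ⟨v, List.mem_finRange v, rfl⟩

theorem inr_not_mem_mainRegs {k r : ℕ} (x : Fin r ⊕ Fin k) : .inr x ∉ mainRegs k r := by
  simp [mainRegs]

theorem inr_inr_not_mem_roundRegs {k r : ℕ} (A : Fin k) : .inr (.inr A) ∉ roundRegs k r := by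
  simp [roundRegs]

theorem nodup_regs (k r : ℕ) : (roundRegs k r ++ mainRegs k r).Nodup := by
  refine List.nodup_append.2 ⟨(List.nodup_finRange r).map fun i j h => ?_,
    (List.nodup_finRange k).map Sum.inl_injective, ?_⟩
  · exact Sum.inl_injective (Sum.inr_injective h)
  · intro x hx y hy h
    obtain ⟨i, -, rfl⟩ := List.mem_map.1 hx
    exact inr_not_mem_mainRegs _ (h ▸ hy)

theorem mem_regs_iff {ι : Type} {k r : ℕ} (x : Reg k r) :
    x ∈ roundRegs k r ++ mainRegs k r ↔ constants ι k r x = [] := by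
  rcases x with v | i | A <;> simp [roundRegs, mainRegs, constants]

/-- The round registers do not influence the automaton. They come first in the nesting, so the whole
computation is a sequence of identical rounds over the main registers, one for each valuation of the
round registers. -/
theorem result_tokenProgram (hP : P.IsBounded m) (p : EvalInput n) :
    (P.tokenProgram m (Fintype.card P.HeadSymbol + 1)).result
      (roundRegs (m + 1) _ ++ mainRegs (m + 1) _) (constants P.HeadSymbol (m + 1) _)
      (inputTokens p) = true ↔ P.Returns p.abox p.1.2 := by
  obtain ⟨W, hW⟩ : ∃ W, W = inputTokens (ι := P.HeadSymbol) p := ⟨_, rfl⟩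
  obtain ⟨L, hL⟩ : ∃ L, L = (TCmd.TokenProgram.valuations W
      (roundRegs (m + 1) (Fintype.card P.HeadSymbol + 1))
      (TCmd.val (constants P.HeadSymbol (m + 1) _))).map
        (TCmd.TokenProgram.valuations W (mainRegs (m + 1) _)) := ⟨_, rfl⟩
  have hlen : L.length = W.length ^ (Fintype.card P.HeadSymbol + 1) := by
    rw [hL, List.length_map, TCmd.TokenProgram.length_valuations, roundRegs, List.length_map,
      List.length_finRange]
  have hZ : ∀ Zs ∈ L, ∀ Z ∈ Zs, IsValuation (P := P) p Z := by
    intro Zs hZs Z hZ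
    rw [hL] at hZs
    obtain ⟨Z₀, hZ₀, rfl⟩ := List.mem_map.1 hZs
    rw [TCmd.TokenProgram.mem_valuations] at hZ hZ₀
    refine ⟨fun v => ?_, fun A => ?_⟩
    · obtain ⟨t, ht, h⟩ := hZ.2 _ (inl_mem_mainRegs v)
      exact ⟨t, hW ▸ ht, h.symm⟩
    · rw [hZ.1 _ (inr_not_mem_mainRegs _), hZ₀.1 _ (inr_inr_not_mem_roundRegs A)]
      rfl
  have hcover : ∀ Zs ∈ L, ∀ σ : Fin (m + 1) → IndName, (∀ v, σ v ∈ Ind p.abox) →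
      ∃ Z ∈ Zs, ∀ v, Z (.inl v) = bits (σ v) := by
    intro Zs hZs σ hσ
    rw [hL] at hZs
    obtain ⟨Z₀, -, rfl⟩ := List.mem_map.1 hZs
    refine ⟨Sum.elim (fun v => bits (σ v)) fun x => Z₀ (.inr x),
      TCmd.TokenProgram.mem_valuations.2 ⟨fun x hx => ?_, fun x hx => ?_⟩, fun _ => rfl⟩
    · rcases x with v | x
      · exact absurd (inl_mem_mainRegs v) hx
      · rfl
    · obtain ⟨v, -, rfl⟩ := List.mem_map.1 hx
      exact ⟨_, hW ▸ comma_mem_inputTokens (hσ v), rfl⟩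
  have hinit : Invariant (P := P) p (W, false) :=
    ⟨⟨[], hW, fun t h => absurd h List.not_mem_nil⟩, fun h => absurd h Bool.false_ne_true⟩
  have hres : (P.tokenProgram m (Fintype.card P.HeadSymbol + 1)).result
      (roundRegs (m + 1) _ ++ mainRegs (m + 1) _) (constants P.HeadSymbol (m + 1) _) W =
      (L.flatten.foldl (P.tokenProgram m _).step (W, false)).2 := by
    rw [TCmd.TokenProgram.result, TCmd.TokenProgram.valuations_append, hL, List.flatMap_def]
  rw [← hW, hres]
  constructor
  · refine (hinit.foldl hP fun Z h => ?_).2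
    obtain ⟨Zs, hZs, h⟩ := List.mem_flatten.1 h
    exact hZ Zs hZs Z h
  · refine answer_of_rounds hP hZ hcover hinit ?_
    rw [Set.ncard_prod, Set.ncard_univ, Nat.card_eq_fintype_card, hlen]
    have h₁ : (Ind p.abox).ncard ≤ W.length := hW ▸ ncard_ind_le p
    have h₂ : 2 ≤ W.length := hW ▸ two_le_length_inputTokens p
    -- With `c` head symbols there are at most `c * |W|` facts, and `c < 2 ^ c ≤ |W| ^ c`. One more
    -- round register than head symbols thus gives enough rounds.
    calc Fintype.card P.HeadSymbol * (Ind p.abox).ncard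
        ≤ Fintype.card P.HeadSymbol * W.length := Nat.mul_le_mul_left _ h₁
      _ < 2 ^ Fintype.card P.HeadSymbol * W.length :=
        Nat.mul_lt_mul_of_pos_right Nat.lt_two_pow_self (by omega)
      _ ≤ W.length ^ Fintype.card P.HeadSymbol * W.length :=
        Nat.mul_le_mul_right _ (Nat.pow_le_pow_left h₂ _)
      _ = W.length ^ (Fintype.card P.HeadSymbol + 1) := (pow_succ ..).symm
      _ ≤ _ := Nat.le_add_left ..

end DatalogProgram

/-- Monadic Datalog programs can be evaluated in polynomial time. -/
theorem DatalogProgram.exists_polyTime {n : ℕ} {P : DatalogProgram n} (hP : P.IsProgram)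
    (hM : P.IsMonadic) : ∃ f : EvalInput n → Bool,
      (∀ p, f p = true ↔ P.Returns p.abox p.1.2) ∧
      Nonempty (Turing.TM2ComputableInPolyTime encodeInput encodeBool f) := by
  classical
  obtain ⟨m, hm⟩ := exists_isBounded hP hM
  have := finite_headSymbol hP.1
  let _ := Fintype.ofFinite P.HeadSymbol
  exact ⟨_, result_tokenProgram hm, TCmd.TokenProgram.nonempty_computableInPolyTime _
    (nodup_regs (m + 1) _) mem_regs_iff inputSym _ map_inputSym_encodeInput fun _ => rfl⟩

theorem peqEvaluationInPTime {T : TBox} (hT : UnravelingTolerant T) : PEQEvaluationInPTime T := by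
  intro n q
  obtain ⟨P, hP, hM, hR⟩ := monadicDatalogNeqRewritablePEQ hT n q
  obtain ⟨f, hf, hf'⟩ := DatalogProgram.exists_polyTime hP hM
  exact ⟨f, fun p => (hf p).trans (hR _ (isABox_abox p) _ p.2.2).symm, hf'⟩

end DL

theorem mainTheorem6 (T : DL.TBox) (hT : DL.UnravelingTolerant T) :
    (∀ C₀ : DL.Concept, C₀.IsELI →
      (DL.canonicalProgram T C₀).IsProgram ∧ (DL.canonicalProgram T C₀).IsMonadic ∧
      (DL.canonicalProgram T C₀).IsRewriting
        (fun A a => DL.CertainConcept T A C₀ (a 0))) ∧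
    DL.MonadicDatalogNeqRewritablePEQ T ∧
    DL.PEQEvaluationInPTime T :=
  ⟨fun C₀ h => ⟨DL.canonicalProgram_isProgram T C₀, fun _ => rfl,
    DL.canonicalProgram_isRewriting hT h⟩, DL.monadicDatalogNeqRewritablePEQ hT,
    DL.peqEvaluationInPTime hT⟩
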